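/- Let $n\ge 3$, $m\ge 1$, and let $\Omega_1,\dots,\Omega_m\subset\mathbb R^n$ be bounded Lipschitz domains (open connected sets which near each boundary point are, in suitable orthonormal coordinates, the region lying strictly above the graph of a Lipschitz function of $n-1$ variables) with $\overline{\Omega}_i\cap\overline{\Omega}_j=\emptyset$ for $i\ne j$. Put $\Omega=\bigcup_{i=1}^m\Omega_i$ and $\Omega_c=\mathbb R^n\setminus\overline\Omega$. Let $H:\Omega_c\times\mathbb R\to\mathbb R$ be a Carathéodory function ($H(\cdot,t)$ is measurable for all $t$, and $H(x,\cdot)$ is continuous for a.e. $x\in\Omega_c$) for which there are $s\in[1,\frac{2n}{n+2}]$ and $h\in L^s(\Omega_c)\cap L^\infty_{\mathrm{loc}}(\Omega_c)$ such that $n|H(x,t)|\le h(x)$ for a.e. $x\in\Omega_c$ and all $t\in\mathbb R$. With $2^*=\frac{2n}{n-2}$, let $\mathcal X$ be the set of the locally Lipschitz functions $u:\Omega_c\to\mathbb R$ such that $u\in L^{2^*}(\Omega_c)$, the distributional gradient $\nabla u$ belongs to $L^2(\Omega_c)$, and $|\nabla u|\le1$ a.e. in $\Omega_c$. Let $\varphi\in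 L^2(\partial\Omega)$ (with respect to the surface measure) be the trace on $\partial\Omega$ of some $w\in\mathcal X$, and set $\mathcal X_\varphi=\{u\in\mathcal X:\mathrm{Tr}(u)=\varphi\}$. Here the trace operator is the usual one: the continuous extension to $W^{1,2}(B(0,R)\setminus\overline\Omega)$, where $\overline\Omega\subset B(0,R)$, with values in $L^2(\partial\Omega)$, of the restriction to $\partial\Omega$ of functions that are smooth up to the boundary. Let $G(x,t)=n\int_0^tH(x,\sigma)\,d\sigma$. Then the functional $$\mathcal I(u)=\int_{\Omega_c}\bigl(1-\sqrt{1-|\nabla u|^2}\bigr)\,dx+\int_{\Omega_c}G(x,u(x))\,dx$$ is well defined on $\mathcal X_\varphi$ (both integrands are integrable for every $u\in\mathcal X_\varphi$), and it possesses a minimizer in $\mathcal X_\varphi$: there is $u\in\mathcal X_\varphi$ with $\mathcal I(u)\le\mathcal I(v)$ for all $v\in\mathcal X_\varphi$. -/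

import Mathlib

open MeasureTheory Filter Topology Set
open scoped ENNReal ContDiff

noncomputable section

namespace ExteriorBI

variable {n : ℕ}

/-- An open set `U ⊆ ℝⁿ` is Lipschitz: near each boundary point `p` there are a unit vector `e`
and a Lipschitz function `f` on the hyperplane `e^⊥` such that, in a ball around `p`, `U` is
the set of the points lying strictly above the graph of `f` in the direction `e`. -/
def IsLipschitzOpen (U : Set (EuclideanSpace ℝ (Fin n))) : Prop :=
  IsOpen U ∧ ∀ p ∈ frontier U, ∃ r : ℝ, 0 < r ∧ ∃ e : EuclideanSpace ℝ (Fin n), ‖e‖ = 1 ∧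
    ∃ f : (ℝ ∙ e)ᗮ → ℝ, (∃ K, LipschitzWith K f) ∧
      ∀ x ∈ Metric.ball p r, x ∈ U ↔ f ((ℝ ∙ e)ᗮ.orthogonalProjectionOnto x) < inner ℝ e x

/-- A bounded Lipschitz domain (a domain is an open connected set). -/
structure IsBoundedLipschitzDomain (U : Set (EuclideanSpace ℝ (Fin n))) : Prop where
  lipschitz : IsLipschitzOpen U
  connected : IsConnected U
  bounded : Bornology.IsBounded U

/-- `Ω_c = ℝⁿ \ closure Ω`. -/
def exterior (Ω : Set (EuclideanSpace ℝ (Fin n))) : Set (EuclideanSpace ℝ (Fin n)) :=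
  (closure Ω)ᶜ

/-- `g` is the weak (distributional) gradient of `u` in the open set `U`. -/
structure IsWeakGradient (U : Set (EuclideanSpace ℝ (Fin n)))
    (u : EuclideanSpace ℝ (Fin n) → ℝ)
    (g : EuclideanSpace ℝ (Fin n) → EuclideanSpace ℝ (Fin n)) : Prop where
  locallyIntegrable : LocallyIntegrableOn u U
  locallyIntegrable_grad : LocallyIntegrableOn g U
  integral_eq : ∀ ψ : EuclideanSpace ℝ (Fin n) → ℝ, ContDiff ℝ ∞ ψ → HasCompactSupport ψ →
    tsupport ψ ⊆ U → ∫ x in U, u x • gradient ψ x = -∫ x in U, ψ x • g x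

open Classical in
/-- The weak gradient of `u` in `U` (unique almost everywhere in `U` when it exists;
`0` if `u` has none). -/
def weakGradient (U : Set (EuclideanSpace ℝ (Fin n))) (u : EuclideanSpace ℝ (Fin n) → ℝ) :
    EuclideanSpace ℝ (Fin n) → EuclideanSpace ℝ (Fin n) :=
  if h : ∃ g, IsWeakGradient U u g then h.choose else 0

/-- The set `𝒳` of the admissible functions on `U = Ω_c`: locally Lipschitz functions in
`L^{2^*}(U)`, `2^* = 2n/(n-2)`, whose weak gradient is in `L²(U)` and satisfies `‖∇u‖_∞ ≤ 1`.
Functions on `U` are represented by functions on `ℝⁿ`, whose values outside `U` play no role. -/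
structure IsAdmissible (U : Set (EuclideanSpace ℝ (Fin n)))
    (u : EuclideanSpace ℝ (Fin n) → ℝ) : Prop where
  locallyLipschitz : LocallyLipschitzOn U u
  memLp : MemLp u (ENNReal.ofReal (2 * n / (n - 2))) (volume.restrict U)
  hasWeakGradient : ∃ g, IsWeakGradient U u g
  memLp_grad : MemLp (weakGradient U u) 2 (volume.restrict U)
  grad_le_one : ∀ᵐ x ∂(volume.restrict U), ‖weakGradient U u x‖ ≤ 1

/-- The surface measure of `∂Ω`, i.e. the `(n-1)`-dimensional Hausdorff measure on `∂Ω`. -/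
def surfaceMeasure (Ω : Set (EuclideanSpace ℝ (Fin n))) : Measure (EuclideanSpace ℝ (Fin n)) :=
  (Measure.hausdorffMeasure ((n : ℝ) - 1)).restrict (frontier Ω)

/-- `Tr(u) = φ` on `∂Ω`, for `u` on `Ω_c` with weak gradient in `L²` and `φ ∈ L²(∂Ω)`.
The trace operator is the continuous extension, from `W^{1,2}(B(0,R) \ closure Ω)` to `L²(∂Ω)`,
of the restriction to `∂Ω` of the functions that are smooth up to the boundary; so `φ` is the
trace of `u` when, for every ball `B(0,R) ⊇ closure Ω`, there are smooth functions converging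
to `u` in `W^{1,2}(B(0,R) \ closure Ω)` whose restrictions converge to `φ` in `L²(∂Ω)`. -/
def HasTrace (Ω : Set (EuclideanSpace ℝ (Fin n)))
    (u φ : EuclideanSpace ℝ (Fin n) → ℝ) : Prop :=
  ∀ R : ℝ, closure Ω ⊆ Metric.ball 0 R → ∃ v : ℕ → EuclideanSpace ℝ (Fin n) → ℝ,
    (∀ k, ContDiff ℝ ∞ (v k)) ∧
    Tendsto (fun k => eLpNorm (fun x => v k x - u x) 2
      (volume.restrict (Metric.ball 0 R ∩ exterior Ω))) atTop (𝓝 0) ∧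
    Tendsto (fun k => eLpNorm (fun x => gradient (v k) x - weakGradient (exterior Ω) u x) 2
      (volume.restrict (Metric.ball 0 R ∩ exterior Ω))) atTop (𝓝 0) ∧
    Tendsto (fun k => eLpNorm (fun x => v k x - φ x) 2 (surfaceMeasure Ω)) atTop (𝓝 0)

/-- `𝒳_φ = {u ∈ 𝒳 : Tr(u) = φ}`. -/
def admissibleWithTrace (Ω : Set (EuclideanSpace ℝ (Fin n)))
    (φ : EuclideanSpace ℝ (Fin n) → ℝ) : Set (EuclideanSpace ℝ (Fin n) → ℝ) :=
  {u | IsAdmissible (exterior Ω) u ∧ HasTrace Ω u φ}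

/-- `H` is a Carathéodory function on `U × ℝ`. -/
structure IsCaratheodory (U : Set (EuclideanSpace ℝ (Fin n)))
    (H : EuclideanSpace ℝ (Fin n) → ℝ → ℝ) : Prop where
  measurable : ∀ t, AEMeasurable (fun x => H x t) (volume.restrict U)
  continuous : ∀ᵐ x ∂(volume.restrict U), Continuous (H x)

/-- There is `h ∈ L^s(U) ∩ L^∞_loc(U)`, `s ∈ [1, 2n/(n+2)]`, with `n |H(x,t)| ≤ h(x)` for
almost every `x ∈ U` and all `t`. -/
def IsDominated (U : Set (EuclideanSpace ℝ (Fin n)))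
    (H : EuclideanSpace ℝ (Fin n) → ℝ → ℝ) : Prop :=
  ∃ (s : ℝ) (h : EuclideanSpace ℝ (Fin n) → ℝ), s ∈ Icc (1 : ℝ) (2 * n / (n + 2)) ∧
    MemLp h (ENNReal.ofReal s) (volume.restrict U) ∧
    (∀ K ⊆ U, IsCompact K → MemLp h ∞ (volume.restrict K)) ∧
    ∀ᵐ x ∂(volume.restrict U), ∀ t, n * |H x t| ≤ h x

/-- `G(x,t) = n ∫_0^t H(x,s) ds`. -/
def G (H : EuclideanSpace ℝ (Fin n) → ℝ → ℝ) (x : EuclideanSpace ℝ (Fin n)) (t : ℝ) : ℝ :=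
  n * ∫ s in (0 : ℝ)..t, H x s

/-- The integrand `1 - √(1 - |∇u|²)`. -/
def areaDensity (U : Set (EuclideanSpace ℝ (Fin n))) (u : EuclideanSpace ℝ (Fin n) → ℝ)
    (x : EuclideanSpace ℝ (Fin n)) : ℝ :=
  1 - √(1 - ‖weakGradient U u x‖ ^ 2)

/-- The functional `ℐ(u) = ∫_U (1 - √(1 - |∇u|²)) dx + ∫_U G(x,u) dx`. -/
def energy (U : Set (EuclideanSpace ℝ (Fin n))) (H : EuclideanSpace ℝ (Fin n) → ℝ → ℝ)
    (u : EuclideanSpace ℝ (Fin n) → ℝ) : ℝ :=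
  (∫ x in U, areaDensity U u x) + ∫ x in U, G H x (u x)

end ExteriorBI

end

/-!
The proof is the direct method, in a form that needs neither weak compactness nor a trace theorem.

*Differences of competitors.* Let `u` and `w` be admissible with the same trace. On the exterior
domain `u - w` has a weak gradient bounded by `2`; extended by zero, it is in fact `2`-Lipschitz on
all of `ℝⁿ` (`lipschitzWith_indicator_sub`). The reason is that the extension by zero still satisfies
the integration by parts formula across `∂Ω`. In a boundary chart, slicing along lines transversal to
the graph gives `|∫_{Ω_c} ∂_a F| ≤ C ∫_{∂Ω} |F|` for smooth `F` with small support
(`IsAboveGraph.enorm_integral_fderiv_le`), and for the smooth approximations of `u - w` the right-hand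
side tends to zero, by the definition of the trace (`IsAboveGraph.integral_sub_mul_fderiv`). A
function with bounded distributional derivative is Lipschitz, by mollification
(`abs_sub_le_of_integral_mul_fderiv_le`).

*Coercivity.* The Sobolev inequality for Lipschitz functions in `L^{2^*}` (`eLpNorm_le_of_lipschitz`)
bounds `‖u - w‖_{2^*}` by the gradients, and a Lipschitz function in `L^{2^*}` is bounded by an affine
function of its norm (`exists_abs_le_add_eLpNorm`). Splitting the dominating weight `h` into an
integrable part and a part in the dual of `L^{2^*}` shows that the lower order term grows at most
linearly in `‖∇u‖₂`, while the area term is at least `‖∇u‖₂² / 2` (`exists_coercive`). Admissible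
functions are bounded (`IsAdmissible.exists_bound`), so the lower order term is integrable.

*Convergence.* Subtract a fixed `w` from a minimizing sequence. By the uniform bounds, a subsequence
converges pointwise, and the lower order terms converge by dominated convergence, the part of `h` that
is not integrable being arbitrarily small (`tendsto_lintegral_mul_sub`). The density `1 - √(1 - |a|²)`
is uniformly convex (`density_midpoint_le`), so comparing midpoints with the infimum shows that the
gradients form a Cauchy sequence in `L²`. Under this strong convergence the constraints, in
particular the trace condition, pass to the limit (`mem_admissibleWithTrace_of_tendsto`), and Fatou's
lemma for the area term finishes the proof (`exists_minimizer`).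
-/

namespace ExteriorBI

/-! ### Lipschitz bounds from bounded weak derivatives -/

theorem fderiv_comp_sub_left_apply {E : Type*} [NormedAddCommGroup E] [NormedSpace ℝ E]
    {f : E → ℝ} (hf : ContDiff ℝ 1 f) (x s a : E) :
    fderiv ℝ (fun s => f (x - s)) s a = - fderiv ℝ f (x - s) a := by
  have h1 : HasFDerivAt f (fderiv ℝ f (x - s)) (x - s) :=
    (hf.differentiable one_ne_zero _).hasFDerivAt
  have h2 : HasFDerivAt (fun s : E => x - s) (-ContinuousLinearMap.id ℝ E) s :=
    (hasFDerivAt_id s).const_sub x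
  have h3 := h1.comp s h2
  rw [show (fun s => f (x - s)) = f ∘ (fun s : E => x - s) from rfl, h3.fderiv]
  simp

/-- A sequence of mollifiers with supports shrinking to the origin. -/
noncomputable def mollifier (E : Type*) [NormedAddCommGroup E] (k : ℕ) : ContDiffBump (0 : E) :=
  ⟨1 / (k + 2), 2 / (k + 2), by positivity, by gcongr; norm_num⟩

theorem tendsto_mollifier_rOut {E : Type*} [NormedAddCommGroup E] :
    Tendsto (fun k => (mollifier E k).rOut) atTop (𝓝 0) := by
  have h2 := ((tendsto_one_div_add_atTop_nhds_zero_nat (𝕜 := ℝ)).comp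
    (tendsto_add_atTop_nat 1)).const_mul 2
  rw [mul_zero] at h2
  refine h2.congr fun k => ?_
  simp only [Function.comp, Nat.cast_add, Nat.cast_one, mollifier]
  ring

section Generic
variable {E : Type*} [NormedAddCommGroup E] [NormedSpace ℝ E] [FiniteDimensional ℝ E]
  [MeasurableSpace E] [BorelSpace E] {μ : Measure E} [μ.IsAddHaarMeasure]

/-- The derivative of a mollification `f ⋆ g`, with the derivative falling on the kernel. -/
theorem exists_hasFDerivAt_convolution {f g : E → ℝ} (hfc : HasCompactSupport f)
    (hf : ContDiff ℝ 1 f) (hg : LocallyIntegrable g μ) (x : E) :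
    ∃ f' : E →L[ℝ] ℝ,
      HasFDerivAt (convolution f g (ContinuousLinearMap.lsmul ℝ ℝ) μ) f' x ∧
      ∀ a, f' a = - ∫ s, g s * fderiv ℝ (fun s => f (x - s)) s a ∂μ := by
  refine ⟨_, HasCompactSupport.hasFDerivAt_convolution_left (ContinuousLinearMap.lsmul ℝ ℝ)
    hfc hf hg x, fun a => ?_⟩
  have hint : Integrable (fun t => (ContinuousLinearMap.precompL E
      (ContinuousLinearMap.lsmul ℝ ℝ)) (fderiv ℝ f (x - t)) (g t)) μ := by
    have := (HasCompactSupport.convolutionExists_left (μ := μ)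
      (ContinuousLinearMap.precompL E (ContinuousLinearMap.lsmul ℝ ℝ)) (hfc.fderiv (𝕜 := ℝ))
      (hf.continuous_fderiv one_ne_zero) hg x).integrable_swap
    exact this
  rw [convolution_eq_swap, ContinuousLinearMap.integral_apply hint, ← integral_neg]
  refine integral_congr_ae (Eventually.of_forall fun s => ?_)
  simp only [fderiv_comp_sub_left_apply hf]
  simp [mul_comm]

/-- A function on a ball whose distributional derivative is bounded by `L` is `L`-Lipschitz on its
points of continuity: this holds for the mollifications, which converge at such points. -/
theorem abs_sub_le_of_integral_mul_fderiv_le {p : E} {r L : ℝ} {z : E → ℝ}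
    (hL : 0 ≤ L) (hz : IntegrableOn z (Metric.ball p r) μ)
    (hweak : ∀ ψ : E → ℝ, ContDiff ℝ ∞ ψ → HasCompactSupport ψ → tsupport ψ ⊆ Metric.ball p r →
      ∀ a, |∫ x in Metric.ball p r, z x * fderiv ℝ ψ x a ∂μ| ≤ L * ‖a‖ * ∫ x, |ψ x| ∂μ)
    {x y : E} (hx : x ∈ Metric.ball p r) (hy : y ∈ Metric.ball p r)
    (hzx : ContinuousAt z x) (hzy : ContinuousAt z y) : |z x - z y| ≤ L * ‖x - y‖ := by
  have hzi : Integrable ((Metric.ball p r).indicator z) μ :=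
    hz.integrable_indicator measurableSet_ball
  set zb := (Metric.ball p r).indicator z with hzb
  let φ : ℕ → ContDiffBump (0 : E) := mollifier E
  have hφ : Tendsto (fun k => (φ k).rOut) atTop (𝓝 0) := tendsto_mollifier_rOut
  let Z : ℕ → E → ℝ := fun k =>
    convolution ((φ k).normed μ) zb (ContinuousLinearMap.lsmul ℝ ℝ) μ
  have hconv : ∀ x ∈ Metric.ball p r, ContinuousAt z x →
      Tendsto (fun k => Z k x) atTop (𝓝 (z x)) := by
    intro x hx hzx
    refine ContDiffBump.convolution_tendsto_right (g := fun _ => zb) (k := fun _ => x)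
      (x₀ := x) hφ (Eventually.of_forall fun _ => hzi.aestronglyMeasurable) ?_ tendsto_const_nhds
    have h1 : Tendsto zb (𝓝 x) (𝓝 (z x)) := by
      refine Tendsto.congr' ?_ hzx
      filter_upwards [Metric.isOpen_ball.mem_nhds hx] with y hy
      exact (indicator_of_mem hy z).symm
    exact h1.comp tendsto_snd
  have hderiv : ∀ k x, Metric.closedBall x (φ k).rOut ⊆ Metric.ball p r →
      ∃ f' : E →L[ℝ] ℝ, HasFDerivAt (Z k) f' x ∧ ‖f'‖ ≤ L := by
    intro k x hxk
    set f := (φ k).normed μ with hf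
    have hfc : HasCompactSupport f := (φ k).hasCompactSupport_normed
    have hfs : ContDiff ℝ ∞ f := (φ k).contDiff_normed
    obtain ⟨f', hf', hf'a⟩ := exists_hasFDerivAt_convolution hfc (φ k).contDiff_normed
      hzi.locallyIntegrable x
    refine ⟨f', hf', ContinuousLinearMap.opNorm_le_bound _ hL fun a => ?_⟩
    set ψ : E → ℝ := fun s => f (x - s) with hψ
    have hψs : ContDiff ℝ ∞ ψ := hfs.comp (contDiff_const.sub contDiff_id)
    have hsupp : Function.support ψ ⊆ Metric.closedBall x (φ k).rOut := by
      intro s hs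
      have : x - s ∈ Function.support f := hs
      rw [hf, ContDiffBump.support_normed_eq] at this
      rw [Metric.mem_closedBall, dist_comm, dist_eq_norm]
      exact (mem_ball_zero_iff.1 this).le
    have hts : tsupport ψ ⊆ Metric.closedBall x (φ k).rOut :=
      closure_minimal hsupp Metric.isClosed_closedBall
    have hψc : HasCompactSupport ψ :=
      HasCompactSupport.of_support_subset_isCompact (isCompact_closedBall _ _) hsupp
    have hψi : ∫ s, |ψ s| ∂μ = 1 := by
      have : ∀ s, |ψ s| = f (x - s) := fun s => abs_of_nonneg ((φ k).nonneg_normed _)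
      simp_rw [this]
      rw [integral_sub_left_eq_self f μ x]
      exact (φ k).integral_normed
    have key := hweak ψ hψs hψc (hts.trans hxk) a
    rw [hψi, mul_one] at key
    refine le_trans (le_of_eq ?_) key
    rw [hf'a, Real.norm_eq_abs, abs_neg, ← integral_indicator measurableSet_ball]
    congr 1
    refine integral_congr_ae (Eventually.of_forall fun s => ?_)
    simp only [hzb, indicator]
    split_ifs <;> simp
  have hlip : ∀ᶠ k in atTop, |Z k x - Z k y| ≤ L * ‖x - y‖ := by
    obtain ⟨ρ, hρ, hρr⟩ : ∃ ρ < r, x ∈ Metric.ball p ρ ∧ y ∈ Metric.ball p ρ := by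
      obtain ⟨ρ, h1, h2⟩ := exists_between (max_lt (Metric.mem_ball.1 hx) (Metric.mem_ball.1 hy))
      exact ⟨ρ, h2, (le_max_left _ _).trans_lt h1, (le_max_right _ _).trans_lt h1⟩
    filter_upwards [hφ.eventually (gt_mem_nhds (sub_pos.2 hρ))] with k hk
    have hb : ∀ x' ∈ Metric.ball p ρ, ∃ f' : E →L[ℝ] ℝ, HasFDerivAt (Z k) f' x' ∧ ‖f'‖ ≤ L := by
      intro x' hx'
      refine hderiv k x' fun s hs => ?_
      rw [Metric.mem_closedBall] at hs
      rw [Metric.mem_ball] at hx' ⊢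
      linarith [dist_triangle s x' p]
    choose! f' hf' hf'L using hb
    have := (convex_ball p ρ).norm_image_sub_le_of_norm_hasFDerivWithin_le
      (fun x hx => (hf' x hx).hasFDerivWithinAt) hf'L hρr.2 hρr.1
    exact this
  refine le_of_tendsto ((hconv x hx hzx).sub (hconv y hy hzy)).abs hlip

end Generic

/-- A function that is `L`-Lipschitz near each point of a segment is `L`-Lipschitz between its
endpoints. -/
theorem abs_sub_le_of_locally_on_segment {E : Type*} [NormedAddCommGroup E] [NormedSpace ℝ E]
    {z : E → ℝ} {L : ℝ} (x y : E)
    (hloc : ∀ q ∈ segment ℝ x y, ∃ r > 0, ∀ a ∈ Metric.ball q r, ∀ b ∈ Metric.ball q r,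
      |z a - z b| ≤ L * ‖a - b‖) : |z x - z y| ≤ L * ‖x - y‖ := by
  let γ : ℝ → E := fun t => x + t • (y - x)
  have hγc : Continuous γ := by fun_prop
  have hseg : ∀ t ∈ Icc (0 : ℝ) 1, γ t ∈ segment ℝ x y := by
    intro t ht
    rw [segment_eq_image']
    exact ⟨t, ht, rfl⟩
  let s : Set ℝ := {t | |z (γ t) - z x| ≤ L * (t * ‖x - y‖)}
  have hdist : ∀ t t', ‖γ t - γ t'‖ = |t - t'| * ‖x - y‖ := by
    intro t t'
    have : γ t - γ t' = (t' - t) • (x - y) := by simp only [γ]; module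
    rw [this, norm_smul, Real.norm_eq_abs, abs_sub_comm]
  have hcont : ContinuousOn (fun t => z (γ t)) (Icc 0 1) := by
    intro t ht
    obtain ⟨r, hr, h⟩ := hloc _ (hseg t ht)
    have hz : ContinuousAt z (γ t) := by
      rw [ContinuousAt, tendsto_iff_dist_tendsto_zero]
      refine squeeze_zero' (g := fun a => L * ‖a - γ t‖) (Eventually.of_forall fun _ => dist_nonneg)
        ?_ ?_
      · filter_upwards [Metric.ball_mem_nhds _ hr] with a ha
        exact h a ha _ (Metric.mem_ball_self hr)
      · have : Continuous fun a => L * ‖a - γ t‖ := by fun_prop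
        simpa using this.tendsto (γ t)
    exact (ContinuousAt.comp (f := γ) (g := z) hz hγc.continuousAt).continuousWithinAt
  have hmain : Icc (0 : ℝ) 1 ⊆ s := by
    refine IsClosed.Icc_subset_of_forall_mem_nhdsWithin ?_ ?_ ?_
    · have : s ∩ Icc 0 1 = Icc 0 1 ∩ {t | |z (γ t) - z x| ≤ L * (t * ‖x - y‖)} := inter_comm _ _
      rw [this]
      exact IsClosed.isClosed_le isClosed_Icc ((hcont.sub continuousOn_const).abs)
        (by fun_prop)
    · simp [s, γ]
    · rintro t ⟨hts, ht⟩
      obtain ⟨r, hr, h⟩ := hloc _ (hseg t (Ico_subset_Icc_self ht))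
      filter_upwards [mem_nhdsWithin_of_mem_nhds
        (hγc.continuousAt.preimage_mem_nhds (Metric.ball_mem_nhds _ hr)), self_mem_nhdsWithin]
        with t' ht' htt'
      have h1 := h _ ht' _ (Metric.mem_ball_self hr)
      rw [hdist, abs_of_pos (a := t' - t) (sub_pos.2 htt')] at h1
      have h2 : |z (γ t) - z x| ≤ L * (t * ‖x - y‖) := hts
      change |z (γ t') - z x| ≤ L * (t' * ‖x - y‖)
      calc |z (γ t') - z x| ≤ |z (γ t') - z (γ t)| + |z (γ t) - z x| := abs_sub_le _ _ _
        _ ≤ _ := by nlinarith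
  have := hmain (right_mem_Icc.2 zero_le_one)
  simpa [s, γ, abs_sub_comm] using this

/-! ### Lipschitz graphs: slicing and surface measure -/

section Graph

variable {n : ℕ} {Ω : Set (EuclideanSpace ℝ (Fin n))} {p e : EuclideanSpace ℝ (Fin n)} {r : ℝ}
  {f : (ℝ ∙ e)ᗮ → ℝ} {K : NNReal}

/-- In the ball `B(p, r)` the set `Ω` is the region strictly above the graph of `f` in the
direction `e`. -/
def IsAboveGraph (Ω : Set (EuclideanSpace ℝ (Fin n))) (p : EuclideanSpace ℝ (Fin n)) (r : ℝ)
    (e : EuclideanSpace ℝ (Fin n)) (f : (ℝ ∙ e)ᗮ → ℝ) : Prop :=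
  ∀ x ∈ Metric.ball p r, x ∈ Ω ↔ f ((ℝ ∙ e)ᗮ.orthogonalProjectionOnto x) < inner ℝ e x

theorem inner_orthogonal_coe (y : (ℝ ∙ e)ᗮ) : inner ℝ e (y : EuclideanSpace ℝ (Fin n)) = 0 :=
  Submodule.mem_orthogonal_singleton_iff_inner_right.1 y.2

theorem orthogonalProjectionOnto_coe_add_smul (y : (ℝ ∙ e)ᗮ) (t : ℝ) :
    (ℝ ∙ e)ᗮ.orthogonalProjectionOnto ((y : EuclideanSpace ℝ (Fin n)) + t • e) = y := by
  have h : (ℝ ∙ e)ᗮ.orthogonalProjectionOnto e = 0 := by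
    rw [Submodule.orthogonalProjectionOnto_eq_zero_iff, Submodule.orthogonal_orthogonal]
    exact Submodule.mem_span_singleton_self e
  rw [map_add, map_smul, h, smul_zero, add_zero]
  exact Submodule.orthogonalProjectionOnto_mem_subspace_eq_self y

theorem inner_coe_add_smul (he : ‖e‖ = 1) (y : (ℝ ∙ e)ᗮ) (t : ℝ) :
    inner ℝ e ((y : EuclideanSpace ℝ (Fin n)) + t • e) = t := by
  rw [inner_add_right, inner_orthogonal_coe, inner_smul_right, real_inner_self_eq_norm_sq, he]
  ring

theorem orthogonalProjectionOnto_add_inner_smul (he : ‖e‖ = 1) (x : EuclideanSpace ℝ (Fin n)) :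
    ((ℝ ∙ e)ᗮ.orthogonalProjectionOnto x : EuclideanSpace ℝ (Fin n)) + inner ℝ e x • e = x := by
  have h := (ℝ ∙ e).starProjection_add_starProjection_orthogonal x
  rw [Submodule.starProjection_unit_singleton ℝ he] at h
  rw [add_comm]
  exact h

theorem continuous_graph_defect (hf : LipschitzWith K f) :
    Continuous fun x : EuclideanSpace ℝ (Fin n) =>
      inner ℝ e x - f ((ℝ ∙ e)ᗮ.orthogonalProjectionOnto x) :=
  (continuous_const.inner continuous_id).sub
    (hf.continuous.comp (ContinuousLinearMap.continuous _))

/-- In the ball where `Ω` lies above a graph, the exterior of `Ω` lies strictly below it. -/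
theorem IsAboveGraph.mem_exterior_iff (h : IsAboveGraph Ω p r e f) (he : ‖e‖ = 1)
    (hf : LipschitzWith K f) {x : EuclideanSpace ℝ (Fin n)} (hx : x ∈ Metric.ball p r) :
    x ∈ exterior Ω ↔ inner ℝ e x < f ((ℝ ∙ e)ᗮ.orthogonalProjectionOnto x) := by
  rw [exterior, mem_compl_iff]
  constructor
  · intro hxc
    by_contra! hle
    apply hxc
    -- moving upwards from a point on or above the graph leads into `Ω`
    have hlim : Tendsto (fun t : ℝ => x + t • e) (𝓝[>] 0) (𝓝 x) := by
      have : Continuous fun t : ℝ => x + t • e := by fun_prop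
      have h2 := this.tendsto 0
      simp only [zero_smul, add_zero] at h2
      exact h2.mono_left nhdsWithin_le_nhds
    refine mem_closure_of_tendsto hlim ?_
    filter_upwards [hlim.eventually (Metric.isOpen_ball.mem_nhds hx), self_mem_nhdsWithin]
      with t ht htpos
    rw [h _ ht]
    have h3 : x + t • e = ((ℝ ∙ e)ᗮ.orthogonalProjectionOnto x : EuclideanSpace ℝ (Fin n))
        + (inner ℝ e x + t) • e := by
      conv_lhs => rw [← orthogonalProjectionOnto_add_inner_smul he x]
      module
    rw [h3, orthogonalProjectionOnto_coe_add_smul, inner_coe_add_smul he]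
    have : 0 < t := htpos
    linarith
  · intro hlt hxc
    rw [mem_closure_iff_nhds] at hxc
    have hopen : {x : EuclideanSpace ℝ (Fin n) | inner ℝ e x -
        f ((ℝ ∙ e)ᗮ.orthogonalProjectionOnto x) < 0} ∈ 𝓝 x :=
      (isOpen_lt (continuous_graph_defect hf) continuous_const).mem_nhds (by
        simpa using sub_neg.2 hlt)
    obtain ⟨y, ⟨hy1, hy2⟩, hy3⟩ := hxc _ (inter_mem hopen (Metric.isOpen_ball.mem_nhds hx))
    have h1 := (h y hy2).1 hy3
    have h2 : inner ℝ e y - f ((ℝ ∙ e)ᗮ.orthogonalProjectionOnto y) < 0 := hy1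
    linarith

theorem IsAboveGraph.mem_frontier_iff (h : IsAboveGraph Ω p r e f) (hΩ : IsOpen Ω)
    (he : ‖e‖ = 1) (hf : LipschitzWith K f) {x : EuclideanSpace ℝ (Fin n)}
    (hx : x ∈ Metric.ball p r) :
    x ∈ frontier Ω ↔ inner ℝ e x = f ((ℝ ∙ e)ᗮ.orthogonalProjectionOnto x) := by
  have h1 := h.mem_exterior_iff he hf hx
  have h2 := h x hx
  rw [exterior, mem_compl_iff] at h1
  rw [hΩ.frontier_eq, Set.mem_sdiff, h2, not_lt]
  constructor
  · rintro ⟨h3, h4⟩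
    exact le_antisymm h4 (not_lt.1 fun h5 => (h1.2 h5) h3)
  · intro h3
    refine ⟨?_, h3.le⟩
    by_contra h4
    exact absurd h3 (h1.1 h4).ne

/-- The coordinates `(y, t) ↦ y + t (e + v)` on `e^⊥ × ℝ`, for `v ∈ e^⊥`. -/
noncomputable def slantCoord (he : ‖e‖ = 1) (v : (ℝ ∙ e)ᗮ) :
    ((ℝ ∙ e)ᗮ × ℝ) ≃L[ℝ] EuclideanSpace ℝ (Fin n) :=
  LinearEquiv.toContinuousLinearEquiv
    { toFun := fun q => (q.1 : EuclideanSpace ℝ (Fin n)) + q.2 • (e + v)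
      map_add' := fun a b => by simp only [Prod.fst_add, Prod.snd_add, Submodule.coe_add]; module
      map_smul' := fun c a => by
        simp only [Prod.smul_fst, Prod.smul_snd, Submodule.coe_smul, RingHom.id_apply, smul_eq_mul]
        module
      invFun := fun x => ((ℝ ∙ e)ᗮ.orthogonalProjectionOnto x - (inner ℝ e x : ℝ) • v, inner ℝ e x)
      left_inv := fun ⟨y, t⟩ => by
        have h : (y : EuclideanSpace ℝ (Fin n)) + t • (e + v)
            = ((y + t • v : (ℝ ∙ e)ᗮ) : EuclideanSpace ℝ (Fin n)) + t • e := by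
          simp only [Submodule.coe_add, Submodule.coe_smul]; module
        simp only [h, orthogonalProjectionOnto_coe_add_smul, inner_coe_add_smul he]
        simp
      right_inv := fun x => by
        conv_rhs => rw [← orthogonalProjectionOnto_add_inner_smul he x]
        simp only [Submodule.coe_sub, Submodule.coe_smul]
        module }

theorem slantCoord_apply (he : ‖e‖ = 1) (v y : (ℝ ∙ e)ᗮ) (t : ℝ) :
    slantCoord he v (y, t) = (y : EuclideanSpace ℝ (Fin n)) + t • (e + v) := rfl

theorem slantCoord_eq (he : ‖e‖ = 1) (v y : (ℝ ∙ e)ᗮ) (t : ℝ) :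
    slantCoord he v (y, t) = ((y + t • v : (ℝ ∙ e)ᗮ) : EuclideanSpace ℝ (Fin n)) + t • e := by
  rw [slantCoord_apply]
  simp only [Submodule.coe_add, Submodule.coe_smul]
  module

theorem inner_slantCoord (he : ‖e‖ = 1) (v y : (ℝ ∙ e)ᗮ) (t : ℝ) :
    inner ℝ e (slantCoord he v (y, t)) = t := by
  rw [slantCoord_eq, inner_coe_add_smul he]

theorem orthogonalProjectionOnto_slantCoord (he : ‖e‖ = 1) (v y : (ℝ ∙ e)ᗮ) (t : ℝ) :
    (ℝ ∙ e)ᗮ.orthogonalProjectionOnto (slantCoord he v (y, t)) = y + t • v := by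
  rw [slantCoord_eq, orthogonalProjectionOnto_coe_add_smul]

/-- When `e + v` is steep, each line in the direction `e + v` crosses the graph of `f` exactly once,
at a height depending measurably on the line. -/
theorem exists_crossing (hf : LipschitzWith K f) {v : (ℝ ∙ e)ᗮ} (hv : K * ‖v‖ ≤ 1 / 2) :
    ∃ τ : (ℝ ∙ e)ᗮ → ℝ, Measurable τ ∧ (∀ y, τ y = f (y + τ y • v)) ∧
      ∀ y t, t < f (y + t • v) ↔ t < τ y := by
  have hk : ∀ y : (ℝ ∙ e)ᗮ, ∀ s t : ℝ, |f (y + t • v) - f (y + s • v)| ≤ 1 / 2 * |t - s| := by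
    intro y s t
    have h1 := hf.dist_le_mul (y + t • v) (y + s • v)
    rw [Real.dist_eq, dist_add_left, dist_eq_norm, ← sub_smul, norm_smul, Real.norm_eq_abs] at h1
    nlinarith [abs_nonneg (t - s)]
  have hex : ∀ y : (ℝ ∙ e)ᗮ, ∃ t : ℝ, t = f (y + t • v) := by
    intro y
    have hc : ContractingWith (1 / 2) (fun t : ℝ => f (y + t • v)) := by
      refine ⟨by rw [← NNReal.coe_lt_coe]; norm_num, LipschitzWith.of_dist_le_mul fun s t => ?_⟩
      rw [Real.dist_eq, Real.dist_eq]
      simpa using hk y t s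
    exact ⟨_, hc.fixedPoint_isFixedPt.symm⟩
  choose τ hτ using hex
  have hlt : ∀ y t, t < f (y + t • v) ↔ t < τ y := by
    intro y t
    have h1 := hk y (τ y) t
    have h2 := hτ y
    rw [abs_le] at h1
    constructor
    · intro h
      by_contra! h3
      rw [abs_of_nonneg (sub_nonneg.2 h3)] at h1
      linarith
    · intro h
      rw [abs_of_neg (sub_neg.2 h)] at h1
      linarith
  refine ⟨τ, measurable_of_Ioi fun t => ?_, hτ, hlt⟩
  have : τ ⁻¹' Ioi t = {y | t < f (y + t • v)} := by
    ext y
    exact (hlt y t).symm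
  rw [this]
  exact (isOpen_lt continuous_const
    (hf.continuous.comp (continuous_id.add continuous_const))).measurableSet

theorem finrank_orthogonal (he : ‖e‖ = 1) : (Module.finrank ℝ (ℝ ∙ e)ᗮ : ℝ) = n - 1 := by
  have hne : e ≠ 0 := fun h => by simp [h] at he
  have h1 := Submodule.finrank_add_finrank_orthogonal (ℝ ∙ e)
  rw [finrank_span_singleton hne, finrank_euclideanSpace_fin] at h1
  have h2 : (1 + Module.finrank ℝ (ℝ ∙ e)ᗮ : ℝ) = n := by exact_mod_cast h1
  linarith

theorem isAddHaarMeasure_orthogonal (he : ‖e‖ = 1) :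
    (Measure.hausdorffMeasure ((n : ℝ) - 1) : Measure (ℝ ∙ e)ᗮ).IsAddHaarMeasure := by
  rw [← finrank_orthogonal he]
  infer_instance

theorem one_le_dim (he : ‖e‖ = 1) : (0 : ℝ) ≤ n - 1 := by
  rw [← finrank_orthogonal he]
  positivity

/-- One component of the divergence theorem, as an inequality: integrals of derivatives in a steep
direction over the exterior of `Ω` are controlled by the boundary values, by integration along
lines and because the projection onto `e^⊥` is Lipschitz. -/
theorem IsAboveGraph.enorm_integral_fderiv_le_of_steep (h : IsAboveGraph Ω p r e f)
    (hΩ : IsOpen Ω) (he : ‖e‖ = 1) (hf : LipschitzWith K f) {v : (ℝ ∙ e)ᗮ}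
    (hv : K * ‖v‖ ≤ 1 / 2) :
    ∃ C : NNReal, ∀ F : EuclideanSpace ℝ (Fin n) → ℝ, ContDiff ℝ 1 F → HasCompactSupport F →
      tsupport F ⊆ Metric.ball p r →
      ‖∫ x in exterior Ω, fderiv ℝ F x (e + v)‖ₑ ≤ C * ∫⁻ x, ‖F x‖ₑ ∂(surfaceMeasure Ω) := by
  obtain ⟨τ, hτm, hτ, hlt⟩ := exists_crossing hf hv
  have := isAddHaarMeasure_orthogonal he
  set μW : Measure (ℝ ∙ e)ᗮ := Measure.hausdorffMeasure ((n : ℝ) - 1) with hμW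
  set Λ := slantCoord he v with hΛ
  set ν : Measure (EuclideanSpace ℝ (Fin n)) := (μW.prod volume).map Λ with hν
  have : ν.IsAddHaarMeasure := ContinuousLinearEquiv.isAddHaarMeasure_map Λ _
  set c : NNReal := Measure.addHaarScalarFactor (volume : Measure (EuclideanSpace ℝ (Fin n))) ν
  have hvol : (volume : Measure (EuclideanSpace ℝ (Fin n))) = c • ν :=
    Measure.isAddLeftInvariant_eq_smul _ _
  let σ : (ℝ ∙ e)ᗮ → EuclideanSpace ℝ (Fin n) := fun y => Λ (y, τ y)
  have hσm : Measurable σ :=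
    Λ.continuous.measurable.comp (measurable_id.prodMk hτm)
  -- the projection along `e + v`, a left inverse of `σ`
  let Q : EuclideanSpace ℝ (Fin n) →L[ℝ] (ℝ ∙ e)ᗮ :=
    (ContinuousLinearMap.fst ℝ _ _).comp (Λ.symm : EuclideanSpace ℝ (Fin n) →L[ℝ] ((ℝ ∙ e)ᗮ × ℝ))
  have hQσ : ∀ y, Q (σ y) = y := fun y => by simp [Q, σ]
  let D : NNReal := ‖Q‖₊ ^ ((n : ℝ) - 1)
  have hmap : μW.map σ ≤ D • Measure.hausdorffMeasure ((n : ℝ) - 1) := by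
    refine Measure.le_iff.2 fun s hs => ?_
    rw [Measure.map_apply hσm hs, Measure.smul_apply]
    have h1 : σ ⁻¹' s ⊆ Q '' s := fun y hy => ⟨σ y, hy, hQσ y⟩
    refine (measure_mono h1).trans ((Q.lipschitz.hausdorffMeasure_image_le (one_le_dim he) s).trans
      (le_of_eq ?_))
    rw [ENNReal.smul_def, smul_eq_mul, ENNReal.coe_rpow_of_nonneg _ (one_le_dim he)]
  refine ⟨c * D, fun F hF hFc hFs => ?_⟩
  let Φ : EuclideanSpace ℝ (Fin n) → ℝ := (exterior Ω).indicator fun x => fderiv ℝ F x (e + v)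
  have hUm : MeasurableSet (exterior Ω) := isClosed_closure.measurableSet.compl
  have hFcont : Continuous fun x => fderiv ℝ F x (e + v) :=
    (hF.continuous_fderiv one_ne_zero).clm_apply continuous_const
  have hΦi : Integrable Φ ν :=
    (hFcont.integrable_of_hasCompactSupport (hFc.fderiv_apply (𝕜 := ℝ) _)).indicator hUm
  have hΦi' : Integrable (Φ ∘ Λ) (μW.prod volume) :=
    (Λ.toHomeomorph.measurableEmbedding.integrable_map_iff).1 hΦi
  have hinner : ∀ y, ∫ t, Φ (Λ (y, t)) = F (σ y) := by
    intro y
    let g : ℝ → ℝ := fun t => F (Λ (y, t))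
    have hline : ∀ t, HasDerivAt (fun t => Λ (y, t)) (e + v : EuclideanSpace ℝ (Fin n)) t := by
      intro t
      simp only [hΛ, slantCoord_apply]
      simpa using ((hasDerivAt_id t).smul_const (e + (v : EuclideanSpace ℝ (Fin n)))).const_add
        (y : EuclideanSpace ℝ (Fin n))
    have hgd : ∀ t, deriv g t = fderiv ℝ F (Λ (y, t)) (e + v) := by
      intro t
      exact (((hF.differentiable one_ne_zero _).hasFDerivAt).comp_hasDerivAt t (hline t)).deriv
    have hg : ContDiff ℝ 1 g :=
      hF.comp (Λ.contDiff.comp (contDiff_const.prodMk contDiff_id))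
    have hgc : HasCompactSupport g := by
      refine HasCompactSupport.of_support_subset_isCompact
        (isCompact_Icc (a := -(‖p‖ + r)) (b := ‖p‖ + r)) fun t ht => ?_
      have h1 := hFs (subset_tsupport F ht)
      have h2 : |t| ≤ ‖Λ (y, t)‖ := by
        have h3 := abs_real_inner_le_norm e (Λ (y, t))
        rwa [hΛ, inner_slantCoord, he, one_mul] at h3
      rw [Metric.mem_ball, dist_eq_norm] at h1
      have h4 := norm_le_norm_add_norm_sub' (Λ (y, t)) p
      exact abs_le.1 (by linarith)
    have h5 : (fun t => Φ (Λ (y, t))) = (Iio (τ y)).indicator (deriv g) := by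
      ext t
      by_cases ht : Λ (y, t) ∈ tsupport F
      · have h6 := h.mem_exterior_iff he hf (hFs ht)
        rw [hΛ, inner_slantCoord, orthogonalProjectionOnto_slantCoord, hlt] at h6
        by_cases h7 : t < τ y
        · rw [indicator_of_mem (show t ∈ Iio (τ y) from h7), hgd]
          exact indicator_of_mem (h6.2 h7) _
        · rw [indicator_of_notMem (show t ∉ Iio (τ y) from h7)]
          exact indicator_of_notMem (fun h8 => h7 (h6.1 h8)) _
      · have h6 : fderiv ℝ F (Λ (y, t)) = 0 := fderiv_of_notMem_tsupport (𝕜 := ℝ) ht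
        simp [Φ, indicator, hgd, h6]
    rw [h5, integral_indicator measurableSet_Iio, ← integral_Iic_eq_integral_Iio,
      hgc.integral_Iic_deriv_eq hg]
  have hint : ∫ x in exterior Ω, fderiv ℝ F x (e + v) = (c : ℝ) * ∫ y, F (σ y) ∂μW := by
    rw [← integral_indicator hUm, hvol, integral_smul_nnreal_measure, hν]
    have hmapint : ∫ x, Φ x ∂((μW.prod volume).map Λ) = ∫ q, (Φ ∘ Λ) q ∂(μW.prod volume) :=
      Λ.toHomeomorph.measurableEmbedding.integral_map _
    refine (congrArg (c • ·) (hmapint.trans (integral_prod _ hΦi'))).trans ?_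
    simp only [NNReal.smul_def, smul_eq_mul]
    congr 1
    exact integral_congr_ae (Eventually.of_forall hinner)
  have hfr : MeasurableSet (frontier Ω) := isClosed_frontier.measurableSet
  have hbd : ∀ y, ‖F (σ y)‖ₑ = (frontier Ω).indicator (fun x => ‖F x‖ₑ) (σ y) := by
    intro y
    by_cases h1 : F (σ y) = 0
    · simp [indicator, h1]
    · refine (indicator_of_mem (s := frontier Ω) (f := fun x => ‖F x‖ₑ) ?_).symm
      rw [h.mem_frontier_iff hΩ he hf (hFs (subset_tsupport F h1))]
      simp only [σ, hΛ, inner_slantCoord, orthogonalProjectionOnto_slantCoord]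
      exact hτ y
  rw [hint, enorm_mul]
  calc ‖(c : ℝ)‖ₑ * ‖∫ y, F (σ y) ∂μW‖ₑ
      ≤ c * ∫⁻ y, ‖F (σ y)‖ₑ ∂μW := by
        gcongr
        · simp [enorm]
        · exact enorm_integral_le_lintegral_enorm _
    _ = c * ∫⁻ x, (frontier Ω).indicator (fun x => ‖F x‖ₑ) x ∂(μW.map σ) := by
        rw [lintegral_map (hF.continuous.enorm.measurable.indicator hfr) hσm]
        simp_rw [hbd]
    _ ≤ c * ∫⁻ x, (frontier Ω).indicator (fun x => ‖F x‖ₑ) x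
          ∂(D • Measure.hausdorffMeasure ((n : ℝ) - 1)) := by
        gcongr
    _ = _ := by
        rw [lintegral_smul_measure, lintegral_indicator hfr, surfaceMeasure]
        simp only [ENNReal.smul_def, smul_eq_mul, ENNReal.coe_mul, mul_assoc]

/-- Integrals of derivatives over the exterior of `Ω` are controlled by the boundary values. -/
theorem IsAboveGraph.enorm_integral_fderiv_le (h : IsAboveGraph Ω p r e f)
    (hΩ : IsOpen Ω) (he : ‖e‖ = 1) (hf : LipschitzWith K f) (a : EuclideanSpace ℝ (Fin n)) :
    ∃ C : NNReal, ∀ F : EuclideanSpace ℝ (Fin n) → ℝ, ContDiff ℝ 1 F → HasCompactSupport F →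
      tsupport F ⊆ Metric.ball p r →
      ‖∫ x in exterior Ω, fderiv ℝ F x a‖ₑ ≤ C * ∫⁻ x, ‖F x‖ₑ ∂(surfaceMeasure Ω) := by
  -- `a` is a combination of the steep directions `e` and `e + v`
  set b : (ℝ ∙ e)ᗮ := (ℝ ∙ e)ᗮ.orthogonalProjectionOnto a
  obtain ⟨s, hs, hsb⟩ : ∃ s : ℝ, 0 < s ∧ K * ‖s • b‖ ≤ 1 / 2 := by
    refine ⟨1 / (2 * (K * ‖b‖ + 1)), by positivity, ?_⟩
    rw [norm_smul, Real.norm_eq_abs, abs_of_pos (by positivity)]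
    have : (0 : ℝ) ≤ K * ‖b‖ := by positivity
    rw [show (K : ℝ) * (1 / (2 * (K * ‖b‖ + 1)) * ‖b‖) = (K * ‖b‖) / (2 * (K * ‖b‖ + 1)) by ring,
      div_le_div_iff₀ (by positivity) (by norm_num)]
    linarith
  obtain ⟨C₁, h₁⟩ := h.enorm_integral_fderiv_le_of_steep hΩ he hf (v := 0) (by simp)
  obtain ⟨C₂, h₂⟩ := h.enorm_integral_fderiv_le_of_steep hΩ he hf hsb
  refine ⟨‖inner ℝ e a - s⁻¹‖₊ * C₁ + ‖s⁻¹‖₊ * C₂, fun F hF hFc hFs => ?_⟩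
  have hdec : a = (inner ℝ e a - s⁻¹) • (e + ((0 : (ℝ ∙ e)ᗮ) : EuclideanSpace ℝ (Fin n)))
      + s⁻¹ • (e + ((s • b : (ℝ ∙ e)ᗮ) : EuclideanSpace ℝ (Fin n))) := by
    conv_lhs => rw [← orthogonalProjectionOnto_add_inner_smul he a]
    rw [Submodule.coe_smul, smul_add s⁻¹, smul_smul, inv_mul_cancel₀ hs.ne', Submodule.coe_zero]
    module
  have hi : ∀ d, IntegrableOn (fun x => fderiv ℝ F x d) (exterior Ω) := fun d =>
    (((hF.continuous_fderiv one_ne_zero).clm_apply continuous_const).integrable_of_hasCompactSupport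
      (hFc.fderiv_apply (𝕜 := ℝ) _)).integrableOn
  have heq : ∫ x in exterior Ω, fderiv ℝ F x a =
      (inner ℝ e a - s⁻¹) * (∫ x in exterior Ω,
        fderiv ℝ F x (e + ((0 : (ℝ ∙ e)ᗮ) : EuclideanSpace ℝ (Fin n))))
      + s⁻¹ * ∫ x in exterior Ω,
        fderiv ℝ F x (e + ((s • b : (ℝ ∙ e)ᗮ) : EuclideanSpace ℝ (Fin n))) := by
    conv_lhs => rw [hdec]
    simp_rw [map_add _ (_ • _) (_ • _), map_smul, smul_eq_mul]
    rw [integral_add ((hi _).const_mul _) ((hi _).const_mul _), integral_const_mul,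
      integral_const_mul]
  rw [heq]
  refine (enorm_add_le _ _).trans ?_
  rw [enorm_mul, enorm_mul, ENNReal.coe_add, add_mul, ENNReal.coe_mul, ENNReal.coe_mul, mul_assoc,
    mul_assoc]
  gcongr
  · exact le_rfl
  · exact h₁ F hF hFc hFs
  · exact le_rfl
  · exact h₂ F hF hFc hFs

/-- The surface measure of the part of the boundary that is a Lipschitz graph is finite. -/
theorem IsAboveGraph.surfaceMeasure_ball_lt_top (h : IsAboveGraph Ω p r e f)
    (hΩ : IsOpen Ω) (he : ‖e‖ = 1) (hf : LipschitzWith K f) :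
    surfaceMeasure Ω (Metric.ball p r) < ⊤ := by
  have := isAddHaarMeasure_orthogonal he
  let γ : (ℝ ∙ e)ᗮ → EuclideanSpace ℝ (Fin n) :=
    fun y => (y : EuclideanSpace ℝ (Fin n)) + f y • e
  have hγ : LipschitzWith (1 + K) γ := by
    refine LipschitzWith.of_dist_le_mul fun y y' => ?_
    have h1 : γ y - γ y' = ((y - y' : (ℝ ∙ e)ᗮ) : EuclideanSpace ℝ (Fin n))
        + (f y - f y') • e := by
      simp only [γ, Submodule.coe_sub]; module
    have h2 := hf.dist_le_mul y y'
    rw [Real.dist_eq, ← Real.norm_eq_abs] at h2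
    rw [dist_eq_norm, h1]
    refine (norm_add_le _ _).trans ?_
    rw [norm_smul, he, mul_one, NNReal.coe_add, NNReal.coe_one, add_mul, one_mul, dist_eq_norm]
    gcongr
    · exact le_rfl
    · rwa [dist_eq_norm] at h2
  rw [surfaceMeasure, Measure.restrict_apply measurableSet_ball]
  have hsub : Metric.ball p r ∩ frontier Ω ⊆
      γ '' Metric.closedBall ((ℝ ∙ e)ᗮ.orthogonalProjectionOnto p) r := by
    rintro x ⟨hx, hxf⟩
    rw [h.mem_frontier_iff hΩ he hf hx] at hxf
    refine ⟨(ℝ ∙ e)ᗮ.orthogonalProjectionOnto x, ?_, ?_⟩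
    · rw [Metric.mem_closedBall, dist_eq_norm, ← map_sub]
      refine ((ℝ ∙ e)ᗮ.norm_orthogonalProjectionOnto_apply_le _).trans ?_
      rw [← dist_eq_norm]
      exact (Metric.mem_ball.1 hx).le
    · simp only [γ]
      rw [← hxf]
      exact orthogonalProjectionOnto_add_inner_smul he x
  refine (measure_mono hsub).trans_lt ((hγ.hausdorffMeasure_image_le (one_le_dim he) _).trans_lt ?_)
  exact ENNReal.mul_lt_top (ENNReal.rpow_lt_top_of_nonneg (one_le_dim he) ENNReal.coe_ne_top)
    (isCompact_closedBall _ _).measure_lt_top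

end Graph

/-! ### Weak gradients -/

section WeakGradient

variable {n : ℕ} {U : Set (EuclideanSpace ℝ (Fin n))} {u v : EuclideanSpace ℝ (Fin n) → ℝ}
  {g k : EuclideanSpace ℝ (Fin n) → EuclideanSpace ℝ (Fin n)}

theorem integrableOn_smul_of_tsupport_subset {G : Type*} [NormedAddCommGroup G] [NormedSpace ℝ G]
    {g : EuclideanSpace ℝ (Fin n) → G} {ψ : EuclideanSpace ℝ (Fin n) → ℝ}
    (hg : LocallyIntegrableOn g U) (hψ : Continuous ψ) (hψc : HasCompactSupport ψ)
    (hψU : tsupport ψ ⊆ U) : IntegrableOn (fun x => ψ x • g x) U := by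
  have h1 : IntegrableOn (fun x => ψ x • g x) (tsupport ψ) :=
    (hg.integrableOn_compact_subset hψU hψc).continuousOn_smul hψ.continuousOn hψc
  have h2 : Function.support (fun x => ψ x • g x) ⊆ tsupport ψ := fun x hx =>
    subset_tsupport ψ fun h => hx (by simp [h])
  exact ((integrableOn_iff_integrable_of_support_subset h2).1 h1).integrableOn

theorem integrableOn_mul_vector_of_tsupport_subset {ψ : EuclideanSpace ℝ (Fin n) → ℝ}
    {F : EuclideanSpace ℝ (Fin n) → EuclideanSpace ℝ (Fin n)}
    (hu : LocallyIntegrableOn u U) (hF : Continuous F) (hψc : HasCompactSupport ψ)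
    (hψU : tsupport ψ ⊆ U) (hFψ : ∀ x, x ∉ tsupport ψ → F x = 0) :
    IntegrableOn (fun x => u x • F x) U := by
  have h1 : IntegrableOn (fun x => u x • F x) (tsupport ψ) :=
    (hu.integrableOn_compact_subset hψU hψc).smul_continuousOn hF.continuousOn hψc
  have h2 : Function.support (fun x => u x • F x) ⊆ tsupport ψ := fun x hx => by
    by_contra h
    exact hx (by simp [hFψ x h])
  exact ((integrableOn_iff_integrable_of_support_subset h2).1 h1).integrableOn

theorem continuous_gradient {ψ : EuclideanSpace ℝ (Fin n) → ℝ} (hψ : ContDiff ℝ 1 ψ) :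
    Continuous (gradient ψ) :=
  (InnerProductSpace.toDual ℝ (EuclideanSpace ℝ (Fin n))).symm.continuous.comp
    (hψ.continuous_fderiv one_ne_zero)

theorem gradient_of_notMem_tsupport {ψ : EuclideanSpace ℝ (Fin n) → ℝ}
    {x : EuclideanSpace ℝ (Fin n)} (hx : x ∉ tsupport ψ) : gradient ψ x = 0 := by
  rw [gradient, fderiv_of_notMem_tsupport (𝕜 := ℝ) hx, map_zero]

theorem integrableOn_smul_gradient {ψ : EuclideanSpace ℝ (Fin n) → ℝ}
    (hu : LocallyIntegrableOn u U) (hψ : ContDiff ℝ ∞ ψ) (hψc : HasCompactSupport ψ)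
    (hψU : tsupport ψ ⊆ U) : IntegrableOn (fun x => u x • gradient ψ x) U :=
  integrableOn_mul_vector_of_tsupport_subset hu (continuous_gradient (hψ.of_le (mod_cast le_top)))
    hψc hψU fun _ => gradient_of_notMem_tsupport

theorem IsWeakGradient.integral_fderiv (h : IsWeakGradient U u g)
    {ψ : EuclideanSpace ℝ (Fin n) → ℝ} (hψ : ContDiff ℝ ∞ ψ) (hψc : HasCompactSupport ψ)
    (hψU : tsupport ψ ⊆ U) (a : EuclideanSpace ℝ (Fin n)) :
    ∫ x in U, u x * fderiv ℝ ψ x a = -∫ x in U, ψ x * inner ℝ a (g x) := by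
  have h1 := congrArg (fun w => (inner ℝ a w : ℝ)) (h.integral_eq ψ hψ hψc hψU)
  simp only [inner_neg_right] at h1
  rw [← integral_inner (integrableOn_smul_gradient h.locallyIntegrable hψ hψc hψU),
    ← integral_inner (integrableOn_smul_of_tsupport_subset h.locallyIntegrable_grad
      hψ.continuous hψc hψU)] at h1
  simpa only [inner_smul_right, inner_gradient_right, conj_trivial] using h1

theorem IsWeakGradient.ae_eq (hU : IsOpen U) (h : IsWeakGradient U u g)
    (h' : IsWeakGradient U u k) : g =ᵐ[volume.restrict U] k := by
  have h1 := hU.ae_eq_zero_of_integral_contDiff_smul_eq_zero (μ := volume)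
    (f := g - k) (h.locallyIntegrable_grad.sub h'.locallyIntegrable_grad) ?_
  · rw [EventuallyEq, ae_restrict_iff' hU.measurableSet]
    filter_upwards [h1] with x hx hxU
    exact sub_eq_zero.1 (hx hxU)
  · intro ψ hψ hψc hψU
    have h2 := h.integral_eq ψ hψ hψc hψU
    rw [h'.integral_eq ψ hψ hψc hψU, neg_inj] at h2
    have h3 : ∫ x in U, ψ x • (g - k) x = 0 := by
      simp only [Pi.sub_apply, smul_sub]
      rw [integral_sub (integrableOn_smul_of_tsupport_subset h.locallyIntegrable_grad
        hψ.continuous hψc hψU) (integrableOn_smul_of_tsupport_subset h'.locallyIntegrable_grad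
        hψ.continuous hψc hψU), h2, sub_self]
    rw [← h3]
    refine (setIntegral_eq_integral_of_forall_compl_eq_zero fun x hx => ?_).symm
    rw [image_eq_zero_of_notMem_tsupport fun h => hx (hψU h), zero_smul]

theorem isWeakGradient_weakGradient (h : ∃ g, IsWeakGradient U u g) :
    IsWeakGradient U u (weakGradient U u) := by
  rw [weakGradient, dif_pos h]
  exact h.choose_spec

theorem IsWeakGradient.weakGradient_ae_eq (hU : IsOpen U) (h : IsWeakGradient U u g) :
    weakGradient U u =ᵐ[volume.restrict U] g :=
  (isWeakGradient_weakGradient ⟨g, h⟩).ae_eq hU h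

theorem IsWeakGradient.combination (h : IsWeakGradient U u g) (h' : IsWeakGradient U v k)
    (c d : ℝ) : IsWeakGradient U (fun x => c * u x + d * v x) (fun x => c • g x + d • k x) where
  locallyIntegrable := (h.locallyIntegrable.smul c).add (h'.locallyIntegrable.smul d)
  locallyIntegrable_grad := (h.locallyIntegrable_grad.smul c).add (h'.locallyIntegrable_grad.smul d)
  integral_eq ψ hψ hψc hψU := by
    have i1 := integrableOn_smul_gradient h.locallyIntegrable hψ hψc hψU
    have i2 := integrableOn_smul_gradient h'.locallyIntegrable hψ hψc hψU
    have i3 := integrableOn_smul_of_tsupport_subset h.locallyIntegrable_grad hψ.continuous hψc hψU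
    have i4 := integrableOn_smul_of_tsupport_subset h'.locallyIntegrable_grad hψ.continuous hψc hψU
    have e1 : ∀ x, (c * u x + d * v x) • gradient ψ x
        = c • (u x • gradient ψ x) + d • (v x • gradient ψ x) := fun x => by module
    have e2 : ∀ x, ψ x • (c • g x + d • k x) = c • (ψ x • g x) + d • (ψ x • k x) :=
      fun x => by module
    simp_rw [e1, e2]
    rw [integral_add (i1.fun_smul c) (i2.fun_smul d), integral_add (i3.fun_smul c) (i4.fun_smul d),
      integral_smul, integral_smul, integral_smul, integral_smul,
      h.integral_eq ψ hψ hψc hψU, h'.integral_eq ψ hψ hψc hψU]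
    module

end WeakGradient

/-- `L²` convergence may be integrated against an `L²` weight. -/
theorem tendsto_integral_smul_of_tendsto_eLpNorm {α G : Type*} [MeasurableSpace α] {μ : Measure α}
    [NormedAddCommGroup G] [NormedSpace ℝ G] {ψ : α → ℝ} {f : α → G} {F : ℕ → α → G}
    (hψ : MemLp ψ 2 μ) (hf : MemLp f 2 μ) (hF : ∀ k, AEStronglyMeasurable (F k) μ)
    (hlim : Tendsto (fun k => eLpNorm (fun x => F k x - f x) 2 μ) atTop (𝓝 0)) :
    Tendsto (fun k => ∫ x, ψ x • F k x ∂μ) atTop (𝓝 (∫ x, ψ x • f x ∂μ)) := by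
  have hFmem : ∀ᶠ k in atTop, MemLp (F k) 2 μ := by
    filter_upwards [hlim.eventually (gt_mem_nhds one_pos)] with k hk
    have h1 : MemLp (fun x => F k x - f x) 2 μ :=
      ⟨(hF k).sub hf.1, hk.trans ENNReal.one_lt_top⟩
    exact (h1.add hf).ae_eq (Eventually.of_forall fun x => by simp)
  have hint : ∀ {f : α → G}, MemLp f 2 μ → Integrable (fun x => ψ x • f x) μ := fun hf =>
    memLp_one_iff_integrable.1 (hf.smul hψ)
  refine tendsto_integral_of_L1' _ (hint hf).1 (hFmem.mono fun k hk => hint hk) ?_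
  have hb : Tendsto (fun k => eLpNorm ψ 2 μ * eLpNorm (fun x => F k x - f x) 2 μ) atTop (𝓝 0) := by
    simpa using ENNReal.Tendsto.const_mul hlim (Or.inr hψ.2.ne)
  refine tendsto_of_tendsto_of_tendsto_of_le_of_le tendsto_const_nhds hb (fun _ => bot_le)
    fun k => ?_
  have h2 : ((fun x => ψ x • F k x) - fun x => ψ x • f x) = ψ • (fun x => F k x - f x) := by
    ext x; simp [smul_sub]
  simp only [h2]
  exact eLpNorm_smul_le_mul_eLpNorm ((hF k).sub hf.1) hψ.1

/-! ### Vanishing trace and integration by parts -/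

section Trace

variable {n : ℕ} {Ω : Set (EuclideanSpace ℝ (Fin n))} {φ : EuclideanSpace ℝ (Fin n) → ℝ}
  {u w : EuclideanSpace ℝ (Fin n) → ℝ}

theorem isOpen_exterior : IsOpen (exterior Ω) := isClosed_closure.isOpen_compl

theorem two_le_sobolevExponent (hn : 3 ≤ n) : 2 ≤ ENNReal.ofReal (2 * n / (n - 2)) := by
  have h3 : (3 : ℝ) ≤ n := by exact_mod_cast hn
  rw [← ENNReal.ofReal_ofNat 2]
  refine ENNReal.ofReal_le_ofReal ?_
  rw [le_div_iff₀ (by linarith)]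
  linarith

theorem isFiniteMeasure_restrict_ball_inter (R : ℝ) (U : Set (EuclideanSpace ℝ (Fin n))) :
    IsFiniteMeasure (volume.restrict (Metric.ball (0 : EuclideanSpace ℝ (Fin n)) R ∩ U)) :=
  ⟨by
    rw [Measure.restrict_apply_univ]
    exact (measure_mono inter_subset_left).trans_lt measure_ball_lt_top⟩

theorem IsAdmissible.memLp_two (hn : 3 ≤ n) (hu : IsAdmissible (exterior Ω) u) (R : ℝ) :
    MemLp u 2 (volume.restrict (Metric.ball 0 R ∩ exterior Ω)) := by
  have := isFiniteMeasure_restrict_ball_inter R (exterior Ω)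
  exact (hu.memLp.mono_measure (Measure.restrict_mono inter_subset_right le_rfl)).mono_exponent
    (two_le_sobolevExponent hn)

theorem IsAdmissible.isWeakGradient (hu : IsAdmissible (exterior Ω) u) :
    IsWeakGradient (exterior Ω) u (weakGradient (exterior Ω) u) :=
  isWeakGradient_weakGradient hu.hasWeakGradient

theorem gradient_sub_of_contDiff {v v' : EuclideanSpace ℝ (Fin n) → ℝ} (hv : ContDiff ℝ ∞ v)
    (hv' : ContDiff ℝ ∞ v') (x : EuclideanSpace ℝ (Fin n)) :
    gradient (fun x => v x - v' x) x = gradient v x - gradient v' x := by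
  rw [gradient, fderiv_fun_sub (hv.differentiable (by simp) x) (hv'.differentiable (by simp) x),
    map_sub, gradient, gradient]

/-- The approximating sequences of two functions with the same trace `φ`, subtracted. -/
theorem exists_approx_sub (hφ : AEStronglyMeasurable φ (surfaceMeasure Ω))
    (hu : u ∈ admissibleWithTrace Ω φ) (hw : w ∈ admissibleWithTrace Ω φ) {R : ℝ}
    (hR : closure Ω ⊆ Metric.ball 0 R) :
    ∃ V : ℕ → EuclideanSpace ℝ (Fin n) → ℝ, (∀ k, ContDiff ℝ ∞ (V k)) ∧
      Tendsto (fun k => eLpNorm (fun x => V k x - (u x - w x)) 2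
        (volume.restrict (Metric.ball 0 R ∩ exterior Ω))) atTop (𝓝 0) ∧
      Tendsto (fun k => eLpNorm (fun x => gradient (V k) x -
        (weakGradient (exterior Ω) u x - weakGradient (exterior Ω) w x)) 2
        (volume.restrict (Metric.ball 0 R ∩ exterior Ω))) atTop (𝓝 0) ∧
      Tendsto (fun k => eLpNorm (V k) 2 (surfaceMeasure Ω)) atTop (𝓝 0) := by
  obtain ⟨v, hv, hv1, hv2, hv3⟩ := hu.2 R hR
  obtain ⟨v', hv', hv1', hv2', hv3'⟩ := hw.2 R hR
  have hμ : volume.restrict (Metric.ball 0 R ∩ exterior Ω) ≤ volume.restrict (exterior Ω) :=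
    Measure.restrict_mono inter_subset_right le_rfl
  have hsq : ∀ {G : Type} [NormedAddCommGroup G] {μ : Measure (EuclideanSpace ℝ (Fin n))}
      {a b c : ℕ → EuclideanSpace ℝ (Fin n) → G},
      (∀ k, c k = a k - b k) → (∀ k, AEStronglyMeasurable (a k) μ) →
      (∀ k, AEStronglyMeasurable (b k) μ) →
      Tendsto (fun k => eLpNorm (a k) 2 μ) atTop (𝓝 0) →
      Tendsto (fun k => eLpNorm (b k) 2 μ) atTop (𝓝 0) →
      Tendsto (fun k => eLpNorm (c k) 2 μ) atTop (𝓝 0) := by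
    intro G _ μ a b c hc ha hb hat hbt
    have h := hat.add hbt
    rw [add_zero] at h
    refine tendsto_of_tendsto_of_tendsto_of_le_of_le tendsto_const_nhds h (fun _ => bot_le)
      fun k => ?_
    simp only [hc]
    exact eLpNorm_sub_le (ha k) (hb k) (by norm_num)
  have hg : ∀ {v : EuclideanSpace ℝ (Fin n) → ℝ}, ContDiff ℝ ∞ v → Continuous (gradient v) :=
    fun h => continuous_gradient (h.of_le (mod_cast le_top))
  refine ⟨fun k x => v k x - v' k x, fun k => (hv k).sub (hv' k), ?_, ?_, ?_⟩
  · refine hsq (fun k => ?_) (fun k => ?_) (fun k => ?_) hv1 hv1'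
    · ext x; simp only [Pi.sub_apply]; ring
    · exact (hv k).continuous.aestronglyMeasurable.sub (hu.1.memLp.1.mono_measure hμ)
    · exact (hv' k).continuous.aestronglyMeasurable.sub (hw.1.memLp.1.mono_measure hμ)
  · refine hsq (fun k => ?_) (fun k => ?_) (fun k => ?_) hv2 hv2'
    · ext1 x; simp only [Pi.sub_apply, gradient_sub_of_contDiff (hv k) (hv' k)]; abel
    · exact (hg (hv k)).aestronglyMeasurable.sub (hu.1.memLp_grad.1.mono_measure hμ)
    · exact (hg (hv' k)).aestronglyMeasurable.sub (hw.1.memLp_grad.1.mono_measure hμ)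
  · refine hsq (fun k => ?_) (fun k => ?_) (fun k => ?_) hv3 hv3'
    · ext x; simp only [Pi.sub_apply]; ring
    · exact (hv k).continuous.aestronglyMeasurable.sub hφ
    · exact (hv' k).continuous.aestronglyMeasurable.sub hφ

/-- Near a boundary point, the difference of two functions with the same trace, extended by zero,
satisfies the integration by parts formula: for the smooth approximations the boundary terms tend
to zero. -/
theorem IsAboveGraph.integral_sub_mul_fderiv (hn : 3 ≤ n) (hΩ : IsOpen Ω)
    (hb : Bornology.IsBounded Ω) (hφ : AEStronglyMeasurable φ (surfaceMeasure Ω))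
    (hu : u ∈ admissibleWithTrace Ω φ) (hw : w ∈ admissibleWithTrace Ω φ)
    {p e : EuclideanSpace ℝ (Fin n)} {r : ℝ} {f : (ℝ ∙ e)ᗮ → ℝ} {K : NNReal}
    (h : IsAboveGraph Ω p r e f) (he : ‖e‖ = 1) (hf : LipschitzWith K f)
    {ψ : EuclideanSpace ℝ (Fin n) → ℝ} (hψ : ContDiff ℝ ∞ ψ) (hψc : HasCompactSupport ψ)
    (hψp : tsupport ψ ⊆ Metric.ball p r) (a : EuclideanSpace ℝ (Fin n)) :
    ∫ x in exterior Ω, (u x - w x) * fderiv ℝ ψ x a =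
      -∫ x in exterior Ω, ψ x *
        inner ℝ a (weakGradient (exterior Ω) u x - weakGradient (exterior Ω) w x) := by
  obtain ⟨R, hR⟩ : ∃ R, closure Ω ∪ Metric.ball p r ⊆ Metric.ball 0 R :=
    (hb.closure.union Metric.isBounded_ball).subset_ball 0
  obtain ⟨V, hV, hV1, hV2, hV3⟩ := exists_approx_sub hφ hu hw (subset_union_left.trans hR)
  obtain ⟨C, hC⟩ := h.enorm_integral_fderiv_le hΩ he hf a
  set U := exterior Ω with hU
  set G := fun x => weakGradient U u x - weakGradient U w x with hG
  have hUm : MeasurableSet U := isOpen_exterior.measurableSet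
  set μ := volume.restrict (Metric.ball 0 R ∩ U) with hμ
  have hψR : tsupport ψ ⊆ Metric.ball 0 R := hψp.trans (subset_union_right.trans hR)
  -- integrals of functions supported in the ball may be restricted to it
  have hres : ∀ F : EuclideanSpace ℝ (Fin n) → ℝ, (∀ x, x ∉ tsupport ψ → F x = 0) →
      ∫ x in U, F x = ∫ x, F x ∂μ := by
    intro F hF
    refine setIntegral_eq_of_subset_of_forall_sdiff_eq_zero hUm inter_subset_right
      fun x hx => hF x fun hx' => hx.2 ⟨hψR hx', hx.1⟩
  have hψ1 : ContDiff ℝ 1 ψ := hψ.of_le (mod_cast le_top)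
  have hψd : Continuous fun x => fderiv ℝ ψ x a :=
    (hψ1.continuous_fderiv one_ne_zero).clm_apply continuous_const
  have hmem : ∀ {F : EuclideanSpace ℝ (Fin n) → ℝ}, Continuous F → HasCompactSupport F →
      MemLp F 2 μ := fun hF hFc => (hF.memLp_of_hasCompactSupport hFc).restrict _
  have hμU : μ ≤ volume.restrict U := Measure.restrict_mono inter_subset_right le_rfl
  have hz2 : MemLp (fun x => u x - w x) 2 μ := (hu.1.memLp_two hn R).sub (hw.1.memLp_two hn R)
  have hG2 : MemLp G 2 μ := (hu.1.memLp_grad.sub hw.1.memLp_grad).mono_measure hμU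
  have hgc : ∀ k, Continuous (gradient (V k)) := fun k =>
    continuous_gradient ((hV k).of_le (mod_cast le_top))
  have lim1 := tendsto_integral_smul_of_tendsto_eLpNorm
    (hmem hψd (hψc.fderiv_apply (𝕜 := ℝ) a)) hz2
    (fun k => (hV k).continuous.aestronglyMeasurable) hV1
  have lim2 := tendsto_integral_smul_of_tendsto_eLpNorm (hmem hψ.continuous hψc) hG2
    (fun k => (hgc k).aestronglyMeasurable) hV2
  have lim2' := (continuous_const.inner continuous_id : Continuous fun y => inner ℝ a y).tendsto _
    |>.comp lim2
  have lim := lim1.add lim2'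
  -- the left-hand side is the integral of the derivative of `V k * ψ`
  have hk : ∀ k, ∫ x, fderiv ℝ ψ x a • V k x ∂μ + inner ℝ a (∫ x, ψ x • gradient (V k) x ∂μ)
      = ∫ x in U, fderiv ℝ (fun x => V k x * ψ x) x a := by
    intro k
    have i2 : Integrable (fun x => ψ x • gradient (V k) x) μ := by
      refine Integrable.restrict ((hψ.continuous.smul (hgc k)).integrable_of_hasCompactSupport ?_)
      exact hψc.smul_right
    have i1 : Integrable (fun x => fderiv ℝ ψ x a • V k x) μ := by
      refine Integrable.restrict ((hψd.smul (hV k).continuous).integrable_of_hasCompactSupport ?_)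
      exact (hψc.fderiv_apply (𝕜 := ℝ) a).smul_right
    have hd : ∀ x, fderiv ℝ (fun x => V k x * ψ x) x a
        = fderiv ℝ ψ x a • V k x + inner ℝ a (ψ x • gradient (V k) x) := by
      intro x
      rw [fderiv_fun_mul ((hV k).differentiable (by simp) x) (hψ.differentiable (by simp) x)]
      simp only [add_apply, smul_apply, smul_eq_mul,
        inner_smul_right, inner_gradient_right, conj_trivial]
      ring
    rw [hres, ← integral_inner i2, ← integral_add i1 (i2.const_inner a)]
    · simp_rw [hd]
    · intro x hx
      rw [hd, image_eq_zero_of_notMem_tsupport hx, fderiv_of_notMem_tsupport (𝕜 := ℝ) hx]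
      simp
  have hS : surfaceMeasure Ω (Metric.ball p r) < ⊤ := h.surfaceMeasure_ball_lt_top hΩ he hf
  have hψS : MemLp ψ 2 (surfaceMeasure Ω) := by
    have : IsFiniteMeasure ((surfaceMeasure Ω).restrict (Metric.ball p r)) :=
      ⟨by rwa [Measure.restrict_apply_univ]⟩
    obtain ⟨M, hM⟩ := hψc.exists_bound_of_continuous hψ.continuous
    have h1 : MemLp ψ 2 ((surfaceMeasure Ω).restrict (Metric.ball p r)) :=
      MemLp.of_bound hψ.continuous.aestronglyMeasurable M (Eventually.of_forall hM)
    rw [← memLp_indicator_iff_restrict measurableSet_ball] at h1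
    refine h1.ae_eq (Eventually.of_forall fun x => ?_)
    simp only [indicator]
    split_ifs with hx
    · rfl
    · exact (image_eq_zero_of_notMem_tsupport fun h => hx (hψp h)).symm
  have lim0 : Tendsto (fun k => ∫ x in U, fderiv ℝ (fun x => V k x * ψ x) x a) atTop (𝓝 0) := by
    have hb : Tendsto (fun k => C * (eLpNorm ψ 2 (surfaceMeasure Ω) *
        eLpNorm (V k) 2 (surfaceMeasure Ω))) atTop (𝓝 0) := by
      have := ENNReal.Tendsto.const_mul (a := (C : ℝ≥0∞))
        (ENNReal.Tendsto.const_mul hV3 (Or.inr hψS.2.ne)) (Or.inr ENNReal.coe_ne_top)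
      simpa using this
    rw [tendsto_zero_iff_enorm_tendsto_zero]
    refine tendsto_of_tendsto_of_tendsto_of_le_of_le tendsto_const_nhds hb (fun _ => bot_le)
      fun k => ?_
    have h1 : tsupport (fun x => V k x * ψ x) ⊆ tsupport ψ := tsupport_mul_subset_right
    refine (hC _ (((hV k).mul hψ).of_le (mod_cast le_top)) hψc.mul_left (h1.trans hψp)).trans ?_
    gcongr
    rw [← eLpNorm_one_eq_lintegral_enorm]
    refine le_trans (le_of_eq ?_) (eLpNorm_smul_le_mul_eLpNorm (r := 1)
      (hV k).continuous.aestronglyMeasurable hψS.1)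
    congr 1
    ext x
    simp [mul_comm]
  have hfin := tendsto_nhds_unique (lim.congr hk) lim0
  have i2 : Integrable (fun x => ψ x • G x) μ := memLp_one_iff_integrable.1
    (hG2.smul (hmem hψ.continuous hψc))
  rw [hres _ fun x hx => by rw [fderiv_of_notMem_tsupport (𝕜 := ℝ) hx]; simp,
    hres _ fun x hx => by rw [image_eq_zero_of_notMem_tsupport hx]; simp]
  rw [← integral_inner i2] at hfin
  simp only [inner_smul_right, smul_eq_mul] at hfin
  rw [eq_neg_iff_add_eq_zero, ← hfin]
  congr 1
  exact integral_congr_ae (Eventually.of_forall fun x => mul_comm _ _)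

end Trace

/-! ### Extension by zero of differences -/

section Lipschitz

variable {n : ℕ} {Ω : Set (EuclideanSpace ℝ (Fin n))} {φ : EuclideanSpace ℝ (Fin n) → ℝ}
  {u w : EuclideanSpace ℝ (Fin n) → ℝ}

/-- A function `z` on `U` satisfying the integration by parts formula against all test functions in a
ball, whether or not they vanish on `∂U`, has a Lipschitz extension by zero, as far as it is
continuous. -/
theorem abs_indicator_sub_le_of_weak_identity {U : Set (EuclideanSpace ℝ (Fin n))} (hU : IsOpen U)
    {z : EuclideanSpace ℝ (Fin n) → ℝ} {G : EuclideanSpace ℝ (Fin n) → EuclideanSpace ℝ (Fin n)}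
    {p : EuclideanSpace ℝ (Fin n)} {r L : ℝ} (hL : 0 ≤ L)
    (hz : IntegrableOn (U.indicator z) (Metric.ball p r))
    (hG : ∀ᵐ x ∂(volume.restrict U), ‖G x‖ ≤ L)
    (hweak : ∀ ψ : EuclideanSpace ℝ (Fin n) → ℝ, ContDiff ℝ ∞ ψ → HasCompactSupport ψ →
      tsupport ψ ⊆ Metric.ball p r → ∀ a,
      ∫ x in U, z x * fderiv ℝ ψ x a = -∫ x in U, ψ x * inner ℝ a (G x))
    {x y : EuclideanSpace ℝ (Fin n)} (hx : x ∈ Metric.ball p r) (hy : y ∈ Metric.ball p r)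
    (hzx : ContinuousAt (U.indicator z) x) (hzy : ContinuousAt (U.indicator z) y) :
    |U.indicator z x - U.indicator z y| ≤ L * ‖x - y‖ := by
  refine abs_sub_le_of_integral_mul_fderiv_le hL hz (fun ψ hψ hψc hψp a => ?_) hx hy hzx hzy
  have h1 : ∫ x in Metric.ball p r, U.indicator z x * fderiv ℝ ψ x a
      = ∫ x in U, z x * fderiv ℝ ψ x a := by
    rw [setIntegral_eq_integral_of_forall_compl_eq_zero, ← integral_indicator hU.measurableSet]
    · congr 1
      ext x
      simp only [indicator]
      split_ifs <;> simp
    · intro x hx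
      rw [fderiv_of_notMem_tsupport (𝕜 := ℝ) fun h => hx (hψp h)]
      simp
  have hψi : Integrable (fun x => |ψ x|) := (hψ.continuous.integrable_of_hasCompactSupport hψc).abs
  rw [h1, hweak ψ hψ hψc hψp a, abs_neg]
  calc |∫ x in U, ψ x * inner ℝ a (G x)| ≤ ∫ x in U, L * ‖a‖ * |ψ x| := by
        rw [← Real.norm_eq_abs]
        refine norm_integral_le_of_norm_le (hψi.const_mul _).integrableOn ?_
        filter_upwards [hG] with x hx
        rw [norm_mul, Real.norm_eq_abs, mul_comm]
        gcongr
        refine (norm_inner_le_norm _ _).trans ?_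
        rw [mul_comm]
        gcongr
    _ = L * ‖a‖ * ∫ x in U, |ψ x| := integral_const_mul _ _
    _ ≤ _ := mul_le_mul_of_nonneg_left
        (setIntegral_le_integral hψi (Eventually.of_forall fun x => abs_nonneg _)) (by positivity)

theorem IsAdmissible.continuousOn (hu : IsAdmissible (exterior Ω) u) :
    ContinuousOn u (exterior Ω) := hu.locallyLipschitz.continuousOn

theorem IsAdmissible.integrableOn_ball_inter (hn : 3 ≤ n) (hu : IsAdmissible (exterior Ω) u)
    (p : EuclideanSpace ℝ (Fin n)) (r : ℝ) : IntegrableOn u (Metric.ball p r ∩ exterior Ω) := by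
  obtain ⟨R, hR⟩ : ∃ R, Metric.ball p r ⊆ Metric.ball 0 R := Metric.isBounded_ball.subset_ball 0
  have h := hu.memLp_two hn R
  have := isFiniteMeasure_restrict_ball_inter R (exterior Ω)
  have h1 : IntegrableOn u (Metric.ball 0 R ∩ exterior Ω) := h.integrable (by norm_num)
  exact h1.mono_set (inter_subset_inter_left _ hR)

theorem integrableOn_ball_indicator {z : EuclideanSpace ℝ (Fin n) → ℝ}
    {p : EuclideanSpace ℝ (Fin n)} {r : ℝ}
    (hz : IntegrableOn z (Metric.ball p r ∩ exterior Ω)) :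
    IntegrableOn ((exterior Ω).indicator z) (Metric.ball p r) := by
  rw [IntegrableOn, integrable_indicator_iff isOpen_exterior.measurableSet, IntegrableOn,
    Measure.restrict_restrict isOpen_exterior.measurableSet, inter_comm]
  exact hz

theorem continuousAt_indicator_of_mem {z : EuclideanSpace ℝ (Fin n) → ℝ}
    (hz : ContinuousOn z (exterior Ω)) {x : EuclideanSpace ℝ (Fin n)} (hx : x ∈ exterior Ω) :
    ContinuousAt ((exterior Ω).indicator z) x := by
  refine (hz.continuousAt (isOpen_exterior.mem_nhds hx)).congr ?_
  filter_upwards [isOpen_exterior.mem_nhds hx] with y hy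
  exact (indicator_of_mem hy z).symm

theorem disjoint_exterior : Disjoint Ω (exterior Ω) :=
  disjoint_compl_right.mono_left subset_closure

theorem continuousAt_indicator_of_mem_interior {z : EuclideanSpace ℝ (Fin n) → ℝ}
    (hΩ : IsOpen Ω) {x : EuclideanSpace ℝ (Fin n)} (hx : x ∈ Ω) :
    ContinuousAt ((exterior Ω).indicator z) x := by
  refine (continuousAt_const (y := (0 : ℝ))).congr ?_
  filter_upwards [hΩ.mem_nhds hx] with y hy
  exact (indicator_of_notMem (disjoint_left.1 disjoint_exterior hy) z).symm

/-- An admissible function is `1`-Lipschitz on the balls contained in the exterior domain. -/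
theorem IsAdmissible.abs_sub_le (hn : 3 ≤ n) (hu : IsAdmissible (exterior Ω) u)
    {p : EuclideanSpace ℝ (Fin n)} {r : ℝ} (hp : Metric.ball p r ⊆ exterior Ω)
    {x y : EuclideanSpace ℝ (Fin n)} (hx : x ∈ Metric.ball p r) (hy : y ∈ Metric.ball p r) :
    |u x - u y| ≤ 1 * ‖x - y‖ := by
  have h := abs_indicator_sub_le_of_weak_identity isOpen_exterior zero_le_one
    (integrableOn_ball_indicator (hu.integrableOn_ball_inter hn p r)) hu.grad_le_one
    (fun ψ hψ hψc hψp a => hu.isWeakGradient.integral_fderiv hψ hψc (hψp.trans hp) a) hx hy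
    (continuousAt_indicator_of_mem hu.continuousOn (hp hx))
    (continuousAt_indicator_of_mem hu.continuousOn (hp hy))
  rwa [indicator_of_mem (hp hx), indicator_of_mem (hp hy)] at h

/-- The difference of two admissible functions with the same trace, extended by zero, satisfies the
integration by parts formula near every point of the space. -/
theorem exists_ball_weak_identity (hn : 3 ≤ n) (hΩ : IsLipschitzOpen Ω)
    (hb : Bornology.IsBounded Ω) (hφ : AEStronglyMeasurable φ (surfaceMeasure Ω))
    (hu : u ∈ admissibleWithTrace Ω φ) (hw : w ∈ admissibleWithTrace Ω φ)
    (p : EuclideanSpace ℝ (Fin n)) :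
    ∃ r > 0, ∀ ψ : EuclideanSpace ℝ (Fin n) → ℝ, ContDiff ℝ ∞ ψ → HasCompactSupport ψ →
      tsupport ψ ⊆ Metric.ball p r → ∀ a,
      ∫ x in exterior Ω, (u x - w x) * fderiv ℝ ψ x a = -∫ x in exterior Ω, ψ x *
        inner ℝ a (weakGradient (exterior Ω) u x - weakGradient (exterior Ω) w x) := by
  by_cases hpU : p ∈ exterior Ω
  · obtain ⟨r, hr, hball⟩ := Metric.isOpen_iff.1 isOpen_exterior p hpU
    refine ⟨r, hr, fun ψ hψ hψc hψp a => ?_⟩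
    have h := (hu.1.isWeakGradient.combination hw.1.isWeakGradient 1 (-1)).integral_fderiv hψ hψc
      (hψp.trans hball) a
    simpa [sub_eq_add_neg] using h
  by_cases hpΩ : p ∈ Ω
  · obtain ⟨r, hr, hball⟩ := Metric.isOpen_iff.1 hΩ.1 p hpΩ
    refine ⟨r, hr, fun ψ hψ hψc hψp a => ?_⟩
    have h0 : ∀ x ∈ exterior Ω, x ∉ tsupport ψ := fun x hx hx' =>
      disjoint_left.1 disjoint_exterior (hball (hψp hx')) hx
    rw [setIntegral_eq_zero_of_forall_eq_zero, setIntegral_eq_zero_of_forall_eq_zero, neg_zero]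
    · intro x hx
      rw [image_eq_zero_of_notMem_tsupport (h0 x hx), zero_mul]
    · intro x hx
      rw [fderiv_of_notMem_tsupport (𝕜 := ℝ) (h0 x hx)]
      simp
  · have hpf : p ∈ frontier Ω := by
      rw [hΩ.1.frontier_eq]
      exact ⟨not_notMem.1 hpU, hpΩ⟩
    obtain ⟨r, hr, e, he, f, ⟨K, hf⟩, h⟩ := hΩ.2 p hpf
    exact ⟨r, hr, fun ψ hψ hψc hψp a => IsAboveGraph.integral_sub_mul_fderiv hn hΩ.1 hb hφ hu hw h
      he hf hψ hψc hψp a⟩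

/-- The difference of two admissible functions with the same trace, extended by zero, is
`2`-Lipschitz on the whole space. -/
theorem lipschitzWith_indicator_sub (hn : 3 ≤ n) (hΩ : IsLipschitzOpen Ω)
    (hb : Bornology.IsBounded Ω) (hφ : AEStronglyMeasurable φ (surfaceMeasure Ω))
    (hu : u ∈ admissibleWithTrace Ω φ) (hw : w ∈ admissibleWithTrace Ω φ) :
    LipschitzWith 2 ((exterior Ω).indicator fun x => u x - w x) := by
  set z := (exterior Ω).indicator fun x => u x - w x with hz
  have hzc : ContinuousOn (fun x => u x - w x) (exterior Ω) :=
    hu.1.continuousOn.sub hw.1.continuousOn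
  have hz0 : ∀ x ∈ closure Ω, z x = 0 := fun x hx =>
    indicator_of_notMem (fun h : x ∈ exterior Ω => h hx) _
  have hG : ∀ᵐ x ∂(volume.restrict (exterior Ω)),
      ‖weakGradient (exterior Ω) u x - weakGradient (exterior Ω) w x‖ ≤ 2 := by
    filter_upwards [hu.1.grad_le_one, hw.1.grad_le_one] with x h1 h2
    linarith [norm_sub_le (weakGradient (exterior Ω) u x) (weakGradient (exterior Ω) w x)]
  refine LipschitzWith.of_dist_le_mul fun x y => ?_
  rw [Real.dist_eq, dist_eq_norm, NNReal.coe_ofNat]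
  refine abs_sub_le_of_locally_on_segment x y fun p _ => ?_
  obtain ⟨r, hr, hweak⟩ := exists_ball_weak_identity hn hΩ hb hφ hu hw p
  refine ⟨r, hr, ?_⟩
  have hcont : ∀ a ∈ Metric.ball p r, ∀ b ∈ Metric.ball p r, ContinuousAt z a → ContinuousAt z b →
      |z a - z b| ≤ 2 * ‖a - b‖ := fun a ha b hb' hza hzb =>
    abs_indicator_sub_le_of_weak_identity isOpen_exterior zero_le_two
      (integrableOn_ball_indicator ((hu.1.integrableOn_ball_inter hn p r).sub
        (hw.1.integrableOn_ball_inter hn p r))) hG hweak ha hb' hza hzb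
  -- continuity of `z` on `∂Ω` is not known beforehand; there, approach the point from inside `Ω`
  have hmix : ∀ a ∈ Metric.ball p r, ∀ b ∈ Metric.ball p r, a ∈ exterior Ω → b ∈ closure Ω →
      |z a| ≤ 2 * ‖a - b‖ := by
    intro a ha b hb' haU hbΩ
    have h1 : b ∈ closure (Metric.ball p r ∩ Ω) :=
      Metric.isOpen_ball.inter_closure ⟨hb', hbΩ⟩
    have h2 : IsClosed {b | |z a| ≤ 2 * ‖a - b‖} := isClosed_le continuous_const (by fun_prop)
    refine closure_minimal (fun c hc => ?_) h2 h1
    have h3 := hcont a ha c hc.1 (continuousAt_indicator_of_mem hzc haU)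
      (continuousAt_indicator_of_mem_interior hΩ.1 hc.2)
    rwa [hz0 c (subset_closure hc.2), sub_zero] at h3
  intro a ha b hb'
  by_cases haU : a ∈ exterior Ω <;> by_cases hbU : b ∈ exterior Ω
  · exact hcont a ha b hb' (continuousAt_indicator_of_mem hzc haU)
      (continuousAt_indicator_of_mem hzc hbU)
  · rw [hz0 b (not_notMem.1 hbU), sub_zero]
    exact hmix a ha b hb' haU (not_notMem.1 hbU)
  · rw [hz0 a (not_notMem.1 haU), zero_sub, abs_neg, norm_sub_rev]
    exact hmix b hb' a ha hbU (not_notMem.1 haU)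
  · rw [hz0 a (not_notMem.1 haU), hz0 b (not_notMem.1 hbU)]
    simp

end Lipschitz

/-! ### Boundedness of admissible functions -/

section Bounded

variable {n : ℕ} {Ω : Set (EuclideanSpace ℝ (Fin n))} {u : EuclideanSpace ℝ (Fin n) → ℝ}

/-- A function that is `L`-Lipschitz on a ball of radius `δ` is bounded at its centre in terms of `L δ`
and its `L^q` norm. -/
theorem exists_abs_le_add_eLpNorm (n : ℕ) {q : ℝ≥0∞} (hq0 : q ≠ 0) (hq : q ≠ ⊤) {δ : ℝ}
    (hδ : 0 < δ) : ∃ C : ℝ, 0 ≤ C ∧ ∀ (S : Set (EuclideanSpace ℝ (Fin n)))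
      (w : EuclideanSpace ℝ (Fin n) → ℝ) (y : EuclideanSpace ℝ (Fin n)) (L : ℝ), 0 ≤ L →
      Metric.ball y δ ⊆ S → (∀ x ∈ Metric.ball y δ, |w x - w y| ≤ L * ‖x - y‖) →
      eLpNorm w q (volume.restrict S) ≠ ⊤ →
      |w y| ≤ L * δ + C * (eLpNorm w q (volume.restrict S)).toReal := by
  set V : ℝ := (volume (Metric.ball (0 : EuclideanSpace ℝ (Fin n)) δ)).toReal with hV
  have hVpos : 0 < V :=
    ENNReal.toReal_pos (Metric.measure_ball_pos _ _ hδ).ne' measure_ball_lt_top.ne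
  have hVq : 0 < V ^ (1 / q.toReal) := Real.rpow_pos_of_pos hVpos _
  refine ⟨(V ^ (1 / q.toReal))⁻¹, by positivity, fun S w y L hL hS hlip hfin => ?_⟩
  set c : ℝ := max (|w y| - L * δ) 0 with hc
  have h1 : eLpNorm (fun _ : EuclideanSpace ℝ (Fin n) => c) q (volume.restrict (Metric.ball y δ))
      ≤ eLpNorm w q (volume.restrict S) := by
    refine le_trans (eLpNorm_mono_ae ?_) (eLpNorm_mono_measure w (Measure.restrict_mono hS le_rfl))
    rw [ae_restrict_iff' measurableSet_ball]
    refine Eventually.of_forall fun x hx => ?_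
    rw [Real.norm_eq_abs, Real.norm_eq_abs, abs_of_nonneg (le_max_right _ _)]
    refine max_le ?_ (abs_nonneg _)
    have h2 := hlip x hx
    have h3 : ‖x - y‖ ≤ δ := by rw [← dist_eq_norm]; exact (Metric.mem_ball.1 hx).le
    have h4 := abs_sub_abs_le_abs_sub (w y) (w x)
    rw [abs_sub_comm] at h4
    nlinarith
  rw [eLpNorm_const' _ hq0 hq, Measure.restrict_apply_univ,
    Measure.addHaar_ball_center volume y δ] at h1
  have h2 := ENNReal.toReal_mono hfin h1
  rw [ENNReal.toReal_mul, ← ENNReal.toReal_rpow, toReal_enorm, Real.norm_eq_abs,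
    abs_of_nonneg (le_max_right _ _), ← hV] at h2
  have h3 : |w y| - L * δ ≤ c := le_max_left _ _
  have h4 : c ≤ (V ^ (1 / q.toReal))⁻¹ * (eLpNorm w q (volume.restrict S)).toReal := by
    rw [← div_eq_inv_mul, le_div_iff₀ hVq]
    exact h2
  linarith

theorem sobolevExponent_ne_zero (hn : 3 ≤ n) : ENNReal.ofReal (2 * n / (n - 2)) ≠ 0 :=
  (lt_of_lt_of_le (by norm_num) (two_le_sobolevExponent hn)).ne'

/-- Near a boundary point, `u` is compared with its values a fixed distance further down, on balls
contained in the exterior of `Ω`. -/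
theorem IsAdmissible.exists_bound_near_frontier (hn : 3 ≤ n)
    (hu : IsAdmissible (exterior Ω) u) {p e : EuclideanSpace ℝ (Fin n)} {r : ℝ}
    {f : (ℝ ∙ e)ᗮ → ℝ} {K : NNReal} (hr : 0 < r)
    (h : IsAboveGraph Ω p r e f) (he : ‖e‖ = 1) (hf : LipschitzWith K f) :
    ∃ M, ∀ x ∈ Metric.ball p (r / 2), x ∈ exterior Ω → |u x| ≤ M := by
  set δ : ℝ := r / (4 * (1 + K)) with hδ
  have hK : (0 : ℝ) ≤ K := K.2
  have hδ0 : 0 < δ := by positivity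
  have hδK : δ * (1 + K) = r / 4 := by rw [hδ]; field_simp
  have hδr : δ ≤ r / 4 := by nlinarith
  obtain ⟨C, hC, hbd⟩ := exists_abs_le_add_eLpNorm n (sobolevExponent_ne_zero hn)
    ENNReal.ofReal_ne_top hδ0
  refine ⟨r / 4 + (1 * δ + C * (eLpNorm u (ENNReal.ofReal (2 * n / (n - 2)))
    (volume.restrict (exterior Ω))).toReal), fun x hx hxU => ?_⟩
  have hxp : dist x p < r / 2 := hx
  have hxr : x ∈ Metric.ball p r := Metric.ball_subset_ball (by linarith) hx
  have hxlt := (h.mem_exterior_iff he hf hxr).1 hxU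
  -- moving downwards from `x` stays in the exterior of `Ω`
  have hP : ∀ t : ℝ, (ℝ ∙ e)ᗮ.orthogonalProjectionOnto (x - t • e)
      = (ℝ ∙ e)ᗮ.orthogonalProjectionOnto x := by
    intro t
    conv_lhs => rw [← orthogonalProjectionOnto_add_inner_smul he x, add_sub_assoc, ← sub_smul,
      orthogonalProjectionOnto_coe_add_smul]
  have hI : ∀ t : ℝ, inner ℝ e (x - t • e) = (inner ℝ e x - t : ℝ) := by
    intro t
    rw [inner_sub_right, inner_smul_right, real_inner_self_eq_norm_sq, he]
    ring
  have hdist : ∀ t : ℝ, 0 ≤ t → dist (x - t • e) p < r / 2 + t := by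
    intro t ht
    have h1 : dist (x - t • e) x = t := by
      rw [dist_eq_norm, sub_sub_cancel_left, norm_neg, norm_smul, he, mul_one, Real.norm_eq_abs,
        abs_of_nonneg ht]
    linarith [dist_triangle (x - t • e) x p]
  set y := x - (r / 4) • e with hy
  have hyU : Metric.ball y δ ⊆ exterior Ω := by
    intro q hq
    rw [Metric.mem_ball] at hq
    have hqr : q ∈ Metric.ball p r := by
      rw [Metric.mem_ball]
      linarith [dist_triangle q y p, hdist (r / 4) (by linarith)]
    rw [h.mem_exterior_iff he hf hqr]
    have h1 : inner ℝ e q ≤ inner ℝ e y + δ := by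
      have h2 := (real_inner_le_norm e (q - y))
      rw [inner_sub_right, he, one_mul, ← dist_eq_norm] at h2
      linarith
    have h3 : f ((ℝ ∙ e)ᗮ.orthogonalProjectionOnto y) -
        f ((ℝ ∙ e)ᗮ.orthogonalProjectionOnto q) ≤ K * δ := by
      have h4 := hf.dist_le_mul ((ℝ ∙ e)ᗮ.orthogonalProjectionOnto y)
        ((ℝ ∙ e)ᗮ.orthogonalProjectionOnto q)
      have h5 : dist ((ℝ ∙ e)ᗮ.orthogonalProjectionOnto y)
          ((ℝ ∙ e)ᗮ.orthogonalProjectionOnto q) ≤ δ := by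
        rw [dist_eq_norm, ← map_sub]
        refine ((ℝ ∙ e)ᗮ.norm_orthogonalProjectionOnto_apply_le _).trans ?_
        rw [← dist_eq_norm, dist_comm]
        exact hq.le
      rw [Real.dist_eq] at h4
      calc _ ≤ _ := le_abs_self _
        _ ≤ _ := h4
        _ ≤ _ := by gcongr
    rw [hy, hP] at h3
    rw [hy, hI] at h1
    nlinarith
  have hseg : |u x - u y| ≤ 1 * ‖x - y‖ := by
    refine abs_sub_le_of_locally_on_segment x y fun q hq => ?_
    obtain ⟨t, ht0, ht1, rfl⟩ : ∃ t : ℝ, 0 ≤ t ∧ t ≤ r / 4 ∧ x - t • e = q := by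
      rw [segment_eq_image'] at hq
      obtain ⟨s, hs, rfl⟩ := hq
      refine ⟨s * (r / 4), mul_nonneg hs.1 (by linarith), by nlinarith [hs.2], ?_⟩
      simp only [hy]
      module
    have hqU : x - t • e ∈ exterior Ω := by
      rw [h.mem_exterior_iff he hf (Metric.mem_ball.2 (by linarith [hdist t ht0])), hP, hI]
      linarith
    obtain ⟨ρ, hρ, hball⟩ := Metric.isOpen_iff.1 isOpen_exterior _ hqU
    exact ⟨ρ, hρ, fun a ha b hb => hu.abs_sub_le hn hball ha hb⟩
  have hxy : ‖x - y‖ = r / 4 := by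
    rw [hy, sub_sub_cancel, norm_smul, he, mul_one, Real.norm_eq_abs, abs_of_pos (by linarith)]
  have h6 := hbd _ u y 1 zero_le_one hyU
    (fun q hq => hu.abs_sub_le hn hyU hq (Metric.mem_ball_self hδ0)) hu.memLp.2.ne
  have h7 := abs_sub_abs_le_abs_sub (u x) (u y)
  linarith

/-- An admissible function is bounded. -/
theorem IsAdmissible.exists_bound (hn : 3 ≤ n) (hΩ : IsLipschitzOpen Ω)
    (hb : Bornology.IsBounded Ω) (hu : IsAdmissible (exterior Ω) u) :
    ∃ M, ∀ x ∈ exterior Ω, |u x| ≤ M := by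
  have hcomp : IsCompact (closure Ω) := hb.isCompact_closure
  -- near the closure of `Ω`
  obtain ⟨V, hV, hΩV, M₁, hM₁⟩ : ∃ V, IsOpen V ∧ closure Ω ⊆ V ∧
      ∃ M, ∀ x ∈ V, x ∈ exterior Ω → |u x| ≤ M := by
    refine hcomp.induction_on
      (p := fun S => ∃ V, IsOpen V ∧ S ⊆ V ∧ ∃ M, ∀ x ∈ V, x ∈ exterior Ω → |u x| ≤ M)
      ⟨∅, isOpen_empty, subset_rfl, 0, by simp⟩ ?_ ?_ ?_
    · rintro s t hst ⟨V, hV, htV, hM⟩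
      exact ⟨V, hV, hst.trans htV, hM⟩
    · rintro s t ⟨V, hV, hsV, M, hM⟩ ⟨V', hV', htV', M', hM'⟩
      refine ⟨V ∪ V', hV.union hV', union_subset_union hsV htV', max M M', ?_⟩
      rintro x (hx | hx) hxU
      · exact (hM x hx hxU).trans (le_max_left _ _)
      · exact (hM' x hx hxU).trans (le_max_right _ _)
    · intro p hp
      by_cases hpΩ : p ∈ Ω
      · exact ⟨Ω, mem_nhdsWithin_of_mem_nhds (hΩ.1.mem_nhds hpΩ), Ω, hΩ.1, subset_rfl, 0,
          fun x hx hxU => absurd hxU (disjoint_left.1 disjoint_exterior hx)⟩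
      · have hpf : p ∈ frontier Ω := by
          rw [hΩ.1.frontier_eq]
          exact ⟨hp, hpΩ⟩
        obtain ⟨r, hr, e, he, f, ⟨K, hf⟩, h⟩ := hΩ.2 p hpf
        exact ⟨_, mem_nhdsWithin_of_mem_nhds (Metric.ball_mem_nhds p (half_pos hr)), _,
          Metric.isOpen_ball, subset_rfl, hu.exists_bound_near_frontier hn hr h he hf⟩
  -- away from the closure of `Ω`
  obtain ⟨δ, hδ, hδV⟩ := hcomp.exists_thickening_subset_open hV hΩV
  obtain ⟨C, hC, hbd⟩ := exists_abs_le_add_eLpNorm n (sobolevExponent_ne_zero hn)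
    ENNReal.ofReal_ne_top hδ
  refine ⟨max M₁ (1 * δ + C * (eLpNorm u (ENNReal.ofReal (2 * n / (n - 2)))
    (volume.restrict (exterior Ω))).toReal), fun x hxU => ?_⟩
  by_cases hxV : x ∈ V
  · exact (hM₁ x hxV hxU).trans (le_max_left _ _)
  · refine le_trans ?_ (le_max_right _ _)
    have hball : Metric.ball x δ ⊆ exterior Ω := by
      intro y hy hyΩ
      exact hxV (hδV (Metric.mem_thickening_iff.2 ⟨y, hyΩ, by rw [dist_comm]; exact hy⟩))
    exact hbd _ u x 1 zero_le_one hball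
      (fun y hy => hu.abs_sub_le hn hball hy (Metric.mem_ball_self hδ)) hu.memLp.2.ne

end Bounded

/-! ### The Sobolev inequality for Lipschitz functions -/

section Sobolev

variable {n : ℕ} {L : NNReal} {z : EuclideanSpace ℝ (Fin n) → ℝ}

/-- The mollifications of a Lipschitz function are differentiated under the integral sign. -/
theorem hasFDerivAt_mollifier_convolution (hz : LipschitzWith L z) (k : ℕ)
    (x : EuclideanSpace ℝ (Fin n)) :
    HasFDerivAt (convolution ((mollifier (EuclideanSpace ℝ (Fin n)) k).normed volume) z
        (ContinuousLinearMap.lsmul ℝ ℝ) volume)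
      (convolution ((mollifier (EuclideanSpace ℝ (Fin n)) k).normed volume) (fderiv ℝ z)
        (ContinuousLinearMap.lsmul ℝ ℝ) volume x) x := by
  set ρ := (mollifier (EuclideanSpace ℝ (Fin n)) k).normed volume with hρ
  have hρc : HasCompactSupport ρ := (mollifier _ k).hasCompactSupport_normed
  have hρs : ContDiff ℝ 1 ρ := (mollifier _ k).contDiff_normed
  obtain ⟨f', hf', hf'a⟩ := exists_hasFDerivAt_convolution hρc hρs
    (hz.continuous.locallyIntegrable (μ := volume)) x
  suffices heq : convolution ρ (fderiv ℝ z) (ContinuousLinearMap.lsmul ℝ ℝ) volume x = f' by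
    rw [heq]
    exact hf'
  ext1 a
  rw [hf'a, convolution_eq_swap]
  set ψ : EuclideanSpace ℝ (Fin n) → ℝ := fun s => ρ (x - s) with hψ
  have hψs : ContDiff ℝ 1 ψ := hρs.comp (contDiff_const.sub contDiff_id)
  have hψc : HasCompactSupport ψ :=
    hρc.comp_homeomorph (Homeomorph.subLeft x)
  obtain ⟨D, hD⟩ := hψs.lipschitzWith_of_hasCompactSupport hψc one_ne_zero
  have hbd : LocallyIntegrable (fderiv ℝ z) := by
    refine (memLp_top_of_bound (measurable_fderiv ℝ z).aestronglyMeasurable L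
      (Eventually.of_forall fun x => norm_fderiv_le_of_lipschitz ℝ hz)).locallyIntegrable le_top
  have hint : Integrable (fun s => (ContinuousLinearMap.lsmul ℝ ℝ) (ρ (x - s)) (fderiv ℝ z s)) := by
    exact hbd.integrable_smul_left_of_hasCompactSupport hψs.continuous hψc
  rw [ContinuousLinearMap.integral_apply hint]
  have key := hz.integral_lineDeriv_mul_eq (μ := volume) hD hψc a
  calc ∫ s, (ContinuousLinearMap.lsmul ℝ ℝ (ρ (x - s)) (fderiv ℝ z s)) a
      = ∫ s, lineDeriv ℝ z s a * ψ s := by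
        refine integral_congr_ae ?_
        filter_upwards [hz.ae_differentiableAt (μ := volume)] with s hs
        rw [hs.lineDeriv_eq_fderiv]
        simp [hψ, mul_comm]
    _ = ∫ s, lineDeriv ℝ ψ s (-a) * z s := key
    _ = -∫ s, z s * fderiv ℝ ψ s a := by
        rw [← integral_neg]
        refine integral_congr_ae (Eventually.of_forall fun s => ?_)
        simp only [(hψs.differentiable one_ne_zero s).lineDeriv_eq_fderiv, map_neg]
        ring

theorem tendsto_eLpNorm_two_of_dominated {α G : Type*} [MeasurableSpace α] {μ : Measure α}
    [NormedAddCommGroup G] {F : ℕ → α → G} {f : α → G} {b : α → ℝ}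
    (hF : ∀ k, AEStronglyMeasurable (F k) μ) (hb : MemLp b 2 μ)
    (hFb : ∀ k, ∀ᵐ x ∂μ, ‖F k x‖ ≤ b x) (hlim : ∀ᵐ x ∂μ, Tendsto (fun k => F k x) atTop (𝓝 (f x))) :
    Tendsto (fun k => eLpNorm (F k) 2 μ) atTop (𝓝 (eLpNorm f 2 μ)) := by
  simp_rw [eLpNorm_eq_lintegral_rpow_enorm_toReal (p := 2) two_ne_zero ENNReal.ofNat_ne_top]
  refine (ENNReal.continuous_rpow_const.tendsto _).comp ?_
  refine tendsto_lintegral_of_dominated_convergence' (fun x => ‖b x‖ₑ ^ (2 : ℝ≥0∞).toReal)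
    (fun k => (hF k).enorm.pow_const _) (fun k => ?_) ?_ ?_
  · filter_upwards [hFb k] with x hx
    gcongr
    rw [enorm_le_iff_norm_le]
    exact hx.trans (le_abs_self _)
  · exact (lintegral_rpow_enorm_lt_top_of_eLpNorm_lt_top two_ne_zero ENNReal.ofNat_ne_top hb.2).ne
  · filter_upwards [hlim] with x hx
    exact (ENNReal.continuous_rpow_const.tendsto _).comp hx.enorm

/-- The Sobolev inequality for Lipschitz functions with compact support, by mollification. -/
theorem eLpNorm_le_of_lipschitz_compactSupport (hn : 3 ≤ n) (hz : LipschitzWith L z)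
    (hzc : HasCompactSupport z) :
    eLpNorm z (ENNReal.ofReal (2 * n / (n - 2))) volume ≤
      SNormLESNormFDerivOfEqConst ℝ (volume : Measure (EuclideanSpace ℝ (Fin n))) 2 *
        eLpNorm (fderiv ℝ z) 2 volume := by
  have h3 : (3 : ℝ) ≤ n := by exact_mod_cast hn
  set C := SNormLESNormFDerivOfEqConst ℝ (volume : Measure (EuclideanSpace ℝ (Fin n))) 2
  set φ : ℕ → ContDiffBump (0 : EuclideanSpace ℝ (Fin n)) := mollifier _
  set Z : ℕ → EuclideanSpace ℝ (Fin n) → ℝ := fun k => convolution ((φ k).normed volume) z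
        (ContinuousLinearMap.lsmul ℝ ℝ) volume with hZ
  have hZd : ∀ k x, HasFDerivAt (Z k) _ x := fun k x => hasFDerivAt_mollifier_convolution hz k x
  have hZs : ∀ k, ContDiff ℝ 1 (Z k) := fun k =>
    HasCompactSupport.contDiff_convolution_left _ (φ k).hasCompactSupport_normed
      (φ k).contDiff_normed hz.continuous.locallyIntegrable
  have hZc : ∀ k, HasCompactSupport (Z k) := fun k =>
    HasCompactSupport.convolution _ (φ k).hasCompactSupport_normed hzc
  have hZlim : ∀ x, Tendsto (fun k => Z k x) atTop (𝓝 (z x)) := fun x =>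
    ContDiffBump.convolution_tendsto_right (g := fun _ => z) (k := fun _ => x) (x₀ := x)
      tendsto_mollifier_rOut (Eventually.of_forall fun _ => hz.continuous.aestronglyMeasurable)
      ((hz.continuous.tendsto x).comp tendsto_snd) tendsto_const_nhds
  have hbd : LocallyIntegrable (fderiv ℝ z) :=
    (memLp_top_of_bound (measurable_fderiv ℝ z).aestronglyMeasurable L
      (Eventually.of_forall fun x => norm_fderiv_le_of_lipschitz ℝ hz)).locallyIntegrable le_top
  have hdlim : ∀ᵐ x, Tendsto (fun k => fderiv ℝ (Z k) x) atTop (𝓝 (fderiv ℝ z x)) := by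
    have h1 := ContDiffBump.ae_convolution_tendsto_right_of_locallyIntegrable (φ := φ) (K := 2)
      tendsto_mollifier_rOut (Eventually.of_forall fun k => by
        simp only [φ, mollifier]; rw [mul_one_div]) hbd
    filter_upwards [h1] with x hx
    exact hx.congr fun k => ((hZd k x).fderiv).symm
  have hgns : ∀ k, eLpNorm (Z k) (ENNReal.ofReal (2 * n / (n - 2))) volume ≤
      C * eLpNorm (fderiv ℝ (Z k)) 2 volume := fun k => by
    refine eLpNorm_le_eLpNorm_fderiv_of_eq volume (hZs k) (hZc k) (p := 2)
      (p' := (2 * n / (n - 2) : ℝ).toNNReal) one_le_two ?_ ?_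
    · rw [finrank_euclideanSpace_fin]; omega
    · rw [finrank_euclideanSpace_fin, NNReal.coe_inv, Real.coe_toNNReal _
        (div_nonneg (by positivity) (by linarith))]
      have : (n : ℝ) - 2 ≠ 0 := by linarith
      have : (n : ℝ) ≠ 0 := by linarith
      push_cast
      field_simp
  -- the derivatives of the mollifications are bounded, with supports in a fixed compact set
  have hZlip : ∀ k, ∀ x, ‖fderiv ℝ (Z k) x‖ ≤ L := by
    intro k x
    rw [(hZd k x).fderiv, convolution_def]
    refine (norm_integral_le_of_norm_le (g := fun t => L * (φ k).normed volume t)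
      ((φ k).integrable_normed.const_mul _) (Eventually.of_forall fun t => ?_)).trans ?_
    · rw [ContinuousLinearMap.lsmul_apply, norm_smul, Real.norm_eq_abs,
        abs_of_nonneg ((φ k).nonneg_normed _), mul_comm]
      exact mul_le_mul_of_nonneg_right (norm_fderiv_le_of_lipschitz ℝ hz) ((φ k).nonneg_normed _)
    · rw [integral_const_mul, (φ k).integral_normed, mul_one]
  obtain ⟨R, hR⟩ : ∃ R, tsupport z ⊆ Metric.closedBall 0 R := hzc.isBounded.subset_closedBall 0
  have hZsupp : ∀ k, ∀ x ∉ Metric.closedBall (0 : EuclideanSpace ℝ (Fin n)) (R + 1),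
      fderiv ℝ (Z k) x = 0 := by
    intro k x hx
    refine fderiv_of_notMem_tsupport (𝕜 := ℝ) fun h => hx ?_
    refine closure_minimal ?_ Metric.isClosed_closedBall h
    refine (support_convolution_subset _).trans ?_
    rintro _ ⟨a, ha, b, hb, rfl⟩
    rw [ContDiffBump.support_normed_eq, mem_ball_zero_iff] at ha
    have h1 := hR (subset_tsupport z hb)
    rw [mem_closedBall_zero_iff] at h1 ⊢
    have h2 : (φ k).rOut ≤ 1 := by
      simp only [φ, mollifier]
      rw [div_le_one (by positivity)]
      have : (0 : ℝ) ≤ k := k.cast_nonneg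
      linarith
    linarith [norm_add_le a b]
  have hlim2 : Tendsto (fun k => eLpNorm (fderiv ℝ (Z k)) 2 volume) atTop
      (𝓝 (eLpNorm (fderiv ℝ z) 2 volume)) := by
    refine tendsto_eLpNorm_two_of_dominated (b := (Metric.closedBall 0 (R + 1)).indicator
      fun _ => (L : ℝ)) (fun k => (measurable_fderiv ℝ (Z k)).aestronglyMeasurable) ?_
      (fun k => Eventually.of_forall fun x => ?_) hdlim
    · exact memLp_indicator_const _ measurableSet_closedBall _
        (Or.inr measure_closedBall_lt_top.ne)
    · by_cases hx : x ∈ Metric.closedBall (0 : EuclideanSpace ℝ (Fin n)) (R + 1)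
      · rw [indicator_of_mem hx]; exact hZlip k x
      · rw [indicator_of_notMem hx, hZsupp k x hx, norm_zero]
  have hfatou := Lp.eLpNorm_lim_le_liminf_eLpNorm (p := ENNReal.ofReal (2 * n / (n - 2)))
    (μ := volume) (fun k => (hZs k).continuous.aestronglyMeasurable) z
    (Eventually.of_forall hZlim)
  refine hfatou.trans ?_
  have hlim3 := ENNReal.Tendsto.const_mul (a := (C : ℝ≥0∞)) hlim2 (Or.inr ENNReal.coe_ne_top)
  rw [← hlim3.liminf_eq]
  exact liminf_le_liminf (Eventually.of_forall hgns)

/-- A Lipschitz function in `L^q` tends to zero at infinity. -/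
theorem exists_compact_abs_le {q : ℝ≥0∞} (hq0 : q ≠ 0) (hq : q ≠ ⊤) (hz : LipschitzWith L z)
    (hzq : MemLp z q volume) {ε : ℝ} (hε : 0 < ε) :
    ∃ K, IsCompact K ∧ ∀ x ∉ K, |z x| ≤ ε := by
  have hL : (0 : ℝ) ≤ L := L.2
  set δ : ℝ := ε / (2 * (L + 1)) with hδ
  have hδ0 : 0 < δ := by positivity
  have hLδ : L * δ ≤ ε / 2 := by
    rw [hδ, ← mul_div_assoc, div_le_div_iff₀ (by positivity) (by norm_num)]
    nlinarith
  obtain ⟨C, hC, hbd⟩ := exists_abs_le_add_eLpNorm n hq0 hq hδ0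
  obtain ⟨g, hgc, hg, -, -⟩ := hzq.exists_hasCompactSupport_eLpNorm_sub_le hq
    (ε := ENNReal.ofReal (ε / (2 * (C + 1)))) (by
      rw [ne_eq, ENNReal.ofReal_eq_zero, not_le]; positivity)
  refine ⟨Metric.cthickening δ (tsupport g), hgc.isCompact.cthickening, fun x hx => ?_⟩
  have hball : Metric.ball x δ ⊆ (tsupport g)ᶜ := by
    intro y hy hyg
    exact hx (Metric.thickening_subset_cthickening _ _
      (Metric.mem_thickening_iff.2 ⟨y, hyg, by rw [dist_comm]; exact hy⟩))
  have h1 : eLpNorm z q (volume.restrict (tsupport g)ᶜ) ≤ ENNReal.ofReal (ε / (2 * (C + 1))) := by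
    have h0 : eLpNorm z q (volume.restrict (tsupport g)ᶜ)
        = eLpNorm (z - g) q (volume.restrict (tsupport g)ᶜ) := eLpNorm_congr_ae ?_
    · rw [h0]
      exact (eLpNorm_mono_measure _ Measure.restrict_le_self).trans hg
    filter_upwards [ae_restrict_mem hgc.isCompact.isClosed.measurableSet.compl] with y hy
    rw [Pi.sub_apply, image_eq_zero_of_notMem_tsupport hy, sub_zero]
  have h2 := hbd _ z x L hL hball (fun y _ => by
    rw [← Real.dist_eq, ← dist_eq_norm]; exact hz.dist_le_mul y x)
    (h1.trans_lt ENNReal.ofReal_lt_top).ne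
  have h3 : (eLpNorm z q (volume.restrict (tsupport g)ᶜ)).toReal ≤ ε / (2 * (C + 1)) :=
    ENNReal.toReal_le_of_le_ofReal (by positivity) h1
  have h4 : C * (ε / (2 * (C + 1))) ≤ ε / 2 := by
    rw [← mul_div_assoc, div_le_div_iff₀ (by positivity) (by norm_num)]
    nlinarith
  nlinarith

/-- Soft thresholding at level `ε`, with values `0` on `[-ε, ε]`. -/
noncomputable def softThreshold (ε t : ℝ) : ℝ := t - max (-ε) (min t ε)

theorem abs_softThreshold_sub_le {ε : ℝ} (hε : 0 ≤ ε) (s t : ℝ) :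
    |softThreshold ε s - softThreshold ε t| ≤ |s - t| := by
  unfold softThreshold
  rcases max_cases (-ε) (min s ε) with h1 | h1 <;> rcases max_cases (-ε) (min t ε) with h2 | h2 <;>
  rcases min_cases s ε with h3 | h3 <;> rcases min_cases t ε with h4 | h4 <;>
  rcases abs_cases (s - t) with h5 | h5 <;> rw [abs_le] <;> constructor <;> linarith

theorem softThreshold_eq_zero {ε t : ℝ} (h : |t| ≤ ε) : softThreshold ε t = 0 := by
  rw [abs_le] at h
  rw [softThreshold, min_eq_left h.2, max_eq_right h.1, sub_self]

theorem abs_softThreshold_sub_self_le {ε : ℝ} (hε : 0 ≤ ε) (t : ℝ) :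
    |softThreshold ε t - t| ≤ ε := by
  rw [softThreshold, sub_sub_cancel_left, abs_neg, abs_le]
  exact ⟨le_max_left _ _, max_le (by linarith) (min_le_right _ _)⟩

/-- Composing with a contraction does not increase the derivative. -/
theorem norm_fderiv_comp_le {T : ℝ → ℝ} (hT : ∀ s t, |T s - T t| ≤ |s - t|)
    {x : EuclideanSpace ℝ (Fin n)} (hx : DifferentiableAt ℝ z x) :
    ‖fderiv ℝ (fun y => T (z y)) x‖ ≤ ‖fderiv ℝ z x‖ := by
  refine le_of_forall_pos_le_add fun η hη => ?_
  refine norm_fderiv_le_of_lip' ℝ (by positivity) ?_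
  filter_upwards [hx.hasFDerivAt.isLittleO.def hη] with y hy
  have h1 : ‖z y - z x‖ ≤ ‖z y - z x - fderiv ℝ z x (y - x)‖ + ‖fderiv ℝ z x (y - x)‖ := by
    have := norm_add_le (z y - z x - fderiv ℝ z x (y - x)) (fderiv ℝ z x (y - x))
    rwa [sub_add_cancel] at this
  have h2 := (fderiv ℝ z x).le_opNorm (y - x)
  have h3 := hT (z y) (z x)
  rw [← Real.norm_eq_abs, ← Real.norm_eq_abs] at h3
  linarith

/-- The Sobolev inequality for Lipschitz functions in `L^{2^*}`. -/
theorem eLpNorm_le_of_lipschitz (hn : 3 ≤ n) (hz : LipschitzWith L z)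
    (hzq : MemLp z (ENNReal.ofReal (2 * n / (n - 2))) volume) :
    eLpNorm z (ENNReal.ofReal (2 * n / (n - 2))) volume ≤
      SNormLESNormFDerivOfEqConst ℝ (volume : Measure (EuclideanSpace ℝ (Fin n))) 2 *
        eLpNorm (fderiv ℝ z) 2 volume := by
  set ε : ℕ → ℝ := fun k => 1 / (k + 1) with hε
  have hε0 : ∀ k, 0 < ε k := fun k => by positivity
  have hεlim : Tendsto ε atTop (𝓝 0) := tendsto_one_div_add_atTop_nhds_zero_nat
  set Z : ℕ → EuclideanSpace ℝ (Fin n) → ℝ := fun k x => softThreshold (ε k) (z x) with hZ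
  have hZlip : ∀ k, LipschitzWith L (Z k) := fun k => LipschitzWith.of_dist_le_mul fun x y => by
    rw [Real.dist_eq]
    refine (abs_softThreshold_sub_le (hε0 k).le _ _).trans ?_
    rw [← Real.dist_eq]
    exact hz.dist_le_mul x y
  have hZc : ∀ k, HasCompactSupport (Z k) := fun k => by
    obtain ⟨K, hK, h⟩ := exists_compact_abs_le (sobolevExponent_ne_zero hn)
      ENNReal.ofReal_ne_top hz hzq (hε0 k)
    refine HasCompactSupport.of_support_subset_isCompact hK fun x hx => ?_
    by_contra hxK
    exact hx (softThreshold_eq_zero (h x hxK))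
  have hZlim : ∀ x, Tendsto (fun k => Z k x) atTop (𝓝 (z x)) := fun x => by
    rw [tendsto_iff_dist_tendsto_zero]
    exact squeeze_zero (fun _ => dist_nonneg)
      (fun k => abs_softThreshold_sub_self_le (hε0 k).le _) hεlim
  refine (Lp.eLpNorm_lim_le_liminf_eLpNorm
    (fun k => (hZlip k).continuous.aestronglyMeasurable) z (Eventually.of_forall hZlim)).trans ?_
  refine liminf_le_of_frequently_le' (Frequently.of_forall fun k => ?_)
  refine (eLpNorm_le_of_lipschitz_compactSupport hn (hZlip k) (hZc k)).trans ?_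
  gcongr
  refine eLpNorm_mono_ae ?_
  filter_upwards [hz.ae_differentiableAt (μ := volume)] with x hx
  exact norm_fderiv_comp_le (abs_softThreshold_sub_le (hε0 k).le) hx

/-- The derivative of a Lipschitz function vanishes almost everywhere on its zero set. -/
theorem ae_fderiv_eq_zero_of_eq_zero (hn : 3 ≤ n) (hz : LipschitzWith L z) :
    ∀ᵐ x, z x = 0 → fderiv ℝ z x = 0 := by
  have : Nonempty (Fin n) := ⟨⟨0, by omega⟩⟩
  obtain ⟨e, he⟩ := exists_ne (0 : EuclideanSpace ℝ (Fin n))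
  set s : Set (EuclideanSpace ℝ (Fin n)) := {x | z x = 0 ∧ DifferentiableAt ℝ z x} with hs
  have hsm : MeasurableSet s :=
    (hz.continuous.measurable (measurableSet_singleton 0)).inter
      (measurableSet_of_differentiableAt ℝ z)
  -- on its zero set, the vector field `z • e` is approximated by the zero map with constant `0`
  have happ : ApproximatesLinearOn (fun x => z x • e)
      (0 : EuclideanSpace ℝ (Fin n) →L[ℝ] EuclideanSpace ℝ (Fin n)) s 0 := by
    intro x hx y hy
    simp [hx.1, hy.1]
  have h := happ.norm_fderiv_sub_le volume hsm (fun x => (fderiv ℝ z x).smulRight e)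
    fun x hx => (hx.2.hasFDerivAt.smul_const e).hasFDerivWithinAt
  rw [ae_restrict_iff' hsm] at h
  filter_upwards [h, hz.ae_differentiableAt (μ := volume)] with x hx hxd hx0
  have h1 := hx ⟨hx0, hxd⟩
  rw [sub_zero, nonpos_iff_eq_zero, nnnorm_eq_zero] at h1
  ext a
  have h2 := congrArg (fun A : EuclideanSpace ℝ (Fin n) →L[ℝ] EuclideanSpace ℝ (Fin n) => A a) h1
  simpa [he] using h2

theorem norm_gradient_eq (x : EuclideanSpace ℝ (Fin n)) : ‖gradient z x‖ = ‖fderiv ℝ z x‖ := by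
  rw [gradient, LinearIsometryEquiv.norm_map]

theorem locallyIntegrable_gradient (hz : LipschitzWith L z) : LocallyIntegrable (gradient z) := by
  refine (memLp_top_of_bound ?_ L (Eventually.of_forall fun x => ?_)).locallyIntegrable le_top
  · exact ((InnerProductSpace.toDual ℝ (EuclideanSpace ℝ (Fin n))).symm.continuous.measurable.comp
      (measurable_fderiv ℝ z)).aestronglyMeasurable
  · rw [norm_gradient_eq]
    exact norm_fderiv_le_of_lipschitz ℝ hz

/-- The classical gradient of a Lipschitz function is its weak gradient. -/
theorem isWeakGradient_gradient (hz : LipschitzWith L z) (U : Set (EuclideanSpace ℝ (Fin n))) :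
    IsWeakGradient U z (gradient z) where
  locallyIntegrable := hz.continuous.locallyIntegrable.locallyIntegrableOn U
  locallyIntegrable_grad := (locallyIntegrable_gradient hz).locallyIntegrableOn U
  integral_eq ψ hψ hψc hψU := by
    have hψ1 : ContDiff ℝ 1 ψ := hψ.of_le (mod_cast le_top)
    obtain ⟨D, hD⟩ := hψ1.lipschitzWith_of_hasCompactSupport hψc one_ne_zero
    rw [setIntegral_eq_integral_of_forall_compl_eq_zero fun x hx => by
        rw [gradient_of_notMem_tsupport fun h => hx (hψU h), smul_zero],
      setIntegral_eq_integral_of_forall_compl_eq_zero fun x hx => by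
        rw [image_eq_zero_of_notMem_tsupport fun h => hx (hψU h), zero_smul]]
    refine ext_inner_left ℝ fun a => ?_
    have i1 : Integrable fun x => z x • gradient ψ x := by
      have := integrableOn_smul_gradient (U := univ)
        (hz.continuous.locallyIntegrable.locallyIntegrableOn _)
        hψ hψc (subset_univ _)
      rwa [integrableOn_univ] at this
    have i2 : Integrable fun x => ψ x • gradient z x := by
      have := integrableOn_smul_of_tsupport_subset (U := univ)
        ((locallyIntegrable_gradient hz).locallyIntegrableOn _)
        hψ.continuous hψc (subset_univ _)
      rwa [integrableOn_univ] at this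
    rw [inner_neg_right, ← integral_inner i1, ← integral_inner i2]
    simp only [inner_smul_right, inner_gradient_right, conj_trivial]
    have key := hz.integral_lineDeriv_mul_eq (μ := volume) hD hψc a
    rw [← neg_inj, neg_neg, ← integral_neg]
    calc ∫ x, -(z x * fderiv ℝ ψ x a) = ∫ x, lineDeriv ℝ ψ x (-a) * z x := by
          refine integral_congr_ae (Eventually.of_forall fun s => ?_)
          simp only [(hψ1.differentiable one_ne_zero s).lineDeriv_eq_fderiv, map_neg]
          ring
      _ = ∫ x, lineDeriv ℝ z x a * ψ x := key.symm
      _ = _ := by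
          refine integral_congr_ae ?_
          filter_upwards [hz.ae_differentiableAt (μ := volume)] with s hs
          rw [hs.lineDeriv_eq_fderiv, mul_comm]

/-- The Sobolev inequality for a Lipschitz function vanishing outside an open set, in terms of its
weak gradient there. -/
theorem eLpNorm_le_weakGradient (hn : 3 ≤ n) {U : Set (EuclideanSpace ℝ (Fin n))} (hU : IsOpen U)
    (hz : LipschitzWith L z) (hzU : ∀ x ∉ U, z x = 0)
    (hzq : MemLp z (ENNReal.ofReal (2 * n / (n - 2))) volume)
    {G : EuclideanSpace ℝ (Fin n) → EuclideanSpace ℝ (Fin n)} (hG : IsWeakGradient U z G) :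
    eLpNorm z (ENNReal.ofReal (2 * n / (n - 2))) volume ≤
      SNormLESNormFDerivOfEqConst ℝ (volume : Measure (EuclideanSpace ℝ (Fin n))) 2 *
        eLpNorm G 2 (volume.restrict U) := by
  refine (eLpNorm_le_of_lipschitz hn hz hzq).trans ?_
  gcongr
  rw [← eLpNorm_indicator_eq_eLpNorm_restrict hU.measurableSet]
  refine eLpNorm_mono_ae ?_
  have h1 := (isWeakGradient_gradient hz U).ae_eq hU hG
  rw [EventuallyEq, ae_restrict_iff' hU.measurableSet] at h1
  filter_upwards [ae_fderiv_eq_zero_of_eq_zero hn hz, h1] with x hx0 hxG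
  by_cases hx : x ∈ U
  · rw [indicator_of_mem hx, ← hxG hx, norm_gradient_eq]
  · rw [hx0 (hzU x hx), norm_zero]
    exact norm_nonneg _

end Sobolev

/-! ### The dominating weight and the energy densities -/

section Decomposition

variable {α : Type*} [MeasurableSpace α] {μ : Measure α}

theorem holderTriple_sobolev {n : ℕ} (hn : 3 ≤ n) :
    ENNReal.HolderTriple (ENNReal.ofReal (2 * n / (n + 2)))
      (ENNReal.ofReal (2 * n / (n - 2))) 1 := by
  have h3 : (3 : ℝ) ≤ n := by exact_mod_cast hn
  have h1 : (0 : ℝ) < n - 2 := by linarith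
  have h2 : (0 : ℝ) < n := by linarith
  refine ⟨?_⟩
  rw [← ENNReal.ofReal_inv_of_pos (by positivity), ← ENNReal.ofReal_inv_of_pos (by positivity),
    ← ENNReal.ofReal_add (by positivity) (by positivity), inv_one, ENNReal.ofReal_eq_one]
  field_simp
  ring

/-- For `1 ≤ s ≤ p` a function in `L^s` is the sum of an integrable function and a function with
arbitrarily small `L^p` norm: cut at a small height. -/
theorem exists_integrable_add_small {s p : ℝ} (hs : 1 ≤ s) (hsp : s ≤ p) {h : α → ℝ}
    (hh : MemLp h (ENNReal.ofReal s) μ) {ε : ℝ≥0∞} (hε : ε ≠ 0) :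
    ∃ a b : α → ℝ, (∀ x, h x = a x + b x) ∧ Integrable a μ ∧
      AEStronglyMeasurable b μ ∧ eLpNorm b (ENNReal.ofReal p) μ ≤ ε := by
  have hs0 : 0 < s := by linarith
  have hp0 : 0 < p := by linarith
  have hhi : Integrable (fun x => ‖h x‖ ^ s) μ := by
    have := hh.integrable_norm_rpow (by simpa using hs0) ENNReal.ofReal_ne_top
    rwa [ENNReal.toReal_ofReal hs0.le] at this
  set δ : ℕ → ℝ := fun k => 1 / (k + 1) with hδ
  have hδ0 : ∀ k, 0 < δ k := fun k => by positivity
  have hδ1 : ∀ k, δ k ≤ 1 := fun k => by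
    rw [hδ, div_le_one (by positivity)]
    have : (0 : ℝ) ≤ k := k.cast_nonneg
    linarith
  have hδlim : Tendsto δ atTop (𝓝 0) := tendsto_one_div_add_atTop_nhds_zero_nat
  let b : ℕ → α → ℝ := fun k x => max (-δ k) (min (h x) (δ k))
  have hbδ : ∀ k x, |b k x| ≤ δ k := fun k x => abs_le.2
    ⟨le_max_left _ _, max_le (by linarith [hδ0 k]) (min_le_right _ _)⟩
  have hbh : ∀ k x, |b k x| ≤ |h x| := fun k x => by
    simp only [b]
    have := hδ0 k
    rcases max_cases (-δ k) (min (h x) (δ k)) with h1 | h1 <;>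
    rcases min_cases (h x) (δ k) with h3 | h3 <;>
    rcases abs_cases (h x) with h5 | h5 <;> rw [abs_le] <;> constructor <;> linarith
  have hbm : ∀ k, AEStronglyMeasurable (b k) μ := fun k =>
    (Continuous.comp_aestronglyMeasurable
      (g := fun t : ℝ => max (-δ k) (min t (δ k))) (by fun_prop) hh.1)
  have hblim : Tendsto (fun k => eLpNorm (b k) (ENNReal.ofReal p) μ) atTop (𝓝 0) := by
    have hp0' : ENNReal.ofReal p ≠ 0 := by simpa using hp0
    simp_rw [eLpNorm_eq_lintegral_rpow_enorm_toReal hp0' ENNReal.ofReal_ne_top,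
      ENNReal.toReal_ofReal hp0.le]
    have h0 : (0 : ℝ≥0∞) = (∫⁻ _ : α, 0 ∂μ) ^ (1 / p) := by
      rw [lintegral_zero, ENNReal.zero_rpow_of_pos (by positivity)]
    rw [h0]
    refine (ENNReal.continuous_rpow_const.tendsto _).comp ?_
    refine tendsto_lintegral_of_dominated_convergence' (fun x => ‖‖h x‖ ^ s‖ₑ)
      (fun k => (hbm k).enorm.pow_const _) (fun k => Eventually.of_forall fun x => ?_)
      hhi.2.ne (Eventually.of_forall fun x => ?_)
    · change ‖b k x‖ₑ ^ p ≤ ‖‖h x‖ ^ s‖ₑ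
      rw [Real.enorm_eq_ofReal (r := ‖h x‖ ^ s) (by positivity), ← ofReal_norm,
        ENNReal.ofReal_rpow_of_nonneg (norm_nonneg _) hp0.le]
      refine ENNReal.ofReal_le_ofReal ?_
      calc ‖b k x‖ ^ p ≤ ‖b k x‖ ^ s :=
            Real.rpow_le_rpow_of_exponent_ge_of_imp (norm_nonneg _) ((hbδ k x).trans (hδ1 k)) hsp
              (fun _ h => absurd h hp0.ne')
        _ ≤ ‖h x‖ ^ s := Real.rpow_le_rpow (norm_nonneg _) (hbh k x) hs0.le
    · have h1 : Tendsto (fun k => b k x) atTop (𝓝 0) :=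
        squeeze_zero_norm (fun k => hbδ k x) hδlim
      have h2 := (ENNReal.continuous_rpow_const (y := p)).tendsto 0 |>.comp
        (tendsto_zero_iff_enorm_tendsto_zero.1 h1)
      rwa [ENNReal.zero_rpow_of_pos hp0] at h2
  obtain ⟨k, hk⟩ := (hblim.eventually (gt_mem_nhds (pos_iff_ne_zero.2 hε))).exists
  refine ⟨fun x => softThreshold (δ k) (h x), b k, fun x => by simp [softThreshold, b], ?_, hbm k,
    hk.le⟩
  refine (hhi.const_mul (δ k ^ (1 - s))).mono' ?_ (Eventually.of_forall fun x => ?_)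
  · exact (Continuous.comp_aestronglyMeasurable
      (g := fun t : ℝ => t - max (-δ k) (min t (δ k))) (by fun_prop) hh.1)
  · by_cases hx : |h x| ≤ δ k
    · rw [softThreshold_eq_zero hx, norm_zero]
      have := hδ0 k
      positivity
    · push Not at hx
      have h1 := abs_softThreshold_sub_le (hδ0 k).le (h x) 0
      rw [softThreshold_eq_zero (t := 0) (by simpa using (hδ0 k).le), sub_zero, sub_zero] at h1
      have hpos : 0 < |h x| := (hδ0 k).trans hx
      calc ‖softThreshold (δ k) (h x)‖ ≤ |h x| := h1
        _ = |h x| ^ (1 - s) * |h x| ^ s := by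
          rw [← Real.rpow_add hpos, sub_add_cancel, Real.rpow_one]
        _ ≤ δ k ^ (1 - s) * ‖h x‖ ^ s := by
          rw [Real.norm_eq_abs]
          gcongr ?_ * _
          exact Real.rpow_le_rpow_of_nonpos (hδ0 k) hx.le (by linarith)

/-- The weight `h` against a function of `L^q`: all but an integrable part of `h` is small. -/
theorem exists_lintegral_mul_le {s p q : ℝ} (hs : 1 ≤ s) (hsp : s ≤ p)
    [ENNReal.HolderTriple (ENNReal.ofReal p) (ENNReal.ofReal q) 1] {h : α → ℝ}
    (hh : MemLp h (ENNReal.ofReal s) μ) {ε : ℝ≥0∞} (hε : ε ≠ 0) :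
    ∃ a : α → ℝ, Integrable a μ ∧ ∀ v : α → ℝ, AEStronglyMeasurable v μ →
      ∫⁻ x, ‖h x * v x‖ₑ ∂μ ≤
        ∫⁻ x, ‖a x * v x‖ₑ ∂μ + ε * eLpNorm v (ENNReal.ofReal q) μ := by
  obtain ⟨a, b, hab, ha, hbm, hb⟩ := exists_integrable_add_small hs hsp hh hε
  refine ⟨a, ha, fun v hv => ?_⟩
  calc ∫⁻ x, ‖h x * v x‖ₑ ∂μ ≤ ∫⁻ x, (‖a x * v x‖ₑ + ‖b x * v x‖ₑ) ∂μ := by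
        refine lintegral_mono fun x => ?_
        rw [hab, add_mul]
        exact enorm_add_le _ _
    _ = ∫⁻ x, ‖a x * v x‖ₑ ∂μ + ∫⁻ x, ‖b x * v x‖ₑ ∂μ :=
        lintegral_add_left' (ha.1.mul hv).enorm _
    _ ≤ _ := by
        gcongr
        have h1 := eLpNorm_smul_le_mul_eLpNorm (p := ENNReal.ofReal p) (q := ENNReal.ofReal q)
          (r := 1) hv hbm
        rw [eLpNorm_one_eq_lintegral_enorm] at h1
        exact h1.trans (by gcongr)

theorem integrable_mul_of_bounded {s p q : ℝ} (hs : 1 ≤ s) (hsp : s ≤ p)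
    [ENNReal.HolderTriple (ENNReal.ofReal p) (ENNReal.ofReal q) 1] {h v : α → ℝ}
    (hh : MemLp h (ENNReal.ofReal s) μ) (hv : MemLp v (ENNReal.ofReal q) μ) {M : ℝ}
    (hM : ∀ᵐ x ∂μ, |v x| ≤ M) : Integrable (fun x => h x * v x) μ := by
  obtain ⟨a, ha, hbd⟩ := exists_lintegral_mul_le (q := q) hs hsp hh one_ne_zero
  refine ⟨hh.1.mul hv.1, (hbd v hv.1).trans_lt (ENNReal.add_lt_top.2 ⟨?_, ?_⟩)⟩
  · exact (ha.mul_bdd (c := M) hv.1 hM).2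
  · exact ENNReal.mul_lt_top ENNReal.one_lt_top hv.2

end Decomposition

section Nemytskii

variable {n : ℕ} {U : Set (EuclideanSpace ℝ (Fin n))} {H : EuclideanSpace ℝ (Fin n) → ℝ → ℝ}

/-- The primitive of a Carathéodory function, composed with a measurable function, is measurable. -/
theorem IsCaratheodory.aemeasurable_G (hH : IsCaratheodory U H)
    {v : EuclideanSpace ℝ (Fin n) → ℝ} (hv : AEMeasurable v (volume.restrict U)) :
    AEMeasurable (fun x => G H x (v x)) (volume.restrict U) := by
  set μ := volume.restrict U
  -- off a null set, `H x` is continuous and given by fixed measurable functions at rational times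
  have hgood : ∀ᵐ x ∂μ, Continuous (H x) ∧ ∀ q : ℚ, H x q = (hH.measurable q).mk _ x := by
    refine hH.continuous.and (ae_all_iff.2 fun q => (hH.measurable q).ae_eq_mk)
  obtain ⟨N, hN, hNm, hN0⟩ := exists_measurable_superset_of_null (ae_iff.1 hgood)
  have hNgood : ∀ x ∉ N, Continuous (H x) ∧ ∀ q : ℚ, H x q = (hH.measurable q).mk _ x :=
    fun x hx => by
      by_contra h
      exact hx (hN h)
  let H' : ℝ → EuclideanSpace ℝ (Fin n) → ℝ := fun t => Nᶜ.indicator fun x => H x t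
  have hH'c : ∀ x, Continuous fun t => H' t x := by
    intro x
    by_cases hx : x ∈ N
    · simp only [H', indicator_of_notMem (show x ∉ Nᶜ from not_not.2 hx)]
      exact continuous_const
    · simp only [H', indicator_of_mem (show x ∈ Nᶜ from hx)]
      exact (hNgood x hx).1
  have hH'q : ∀ q : ℚ, Measurable (H' q) := by
    intro q
    have : H' q = Nᶜ.indicator ((hH.measurable q).mk _) := by
      ext x
      by_cases hx : x ∈ N
      · simp [H', hx]
      · simp [H', hx, (hNgood x hx).2 q]
    rw [this]
    exact (hH.measurable q).measurable_mk.indicator hNm.compl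
  have hH'm : ∀ t, Measurable (H' t) := by
    intro t
    obtain ⟨r, hr⟩ : ∃ r : ℕ → ℚ, Tendsto (fun k => (r k : ℝ)) atTop (𝓝 t) := by
      obtain ⟨y, hy, hyt⟩ := mem_closure_iff_seq_limit.1 (Rat.denseRange_cast t : t ∈ closure _)
      choose r hr using hy
      exact ⟨r, by simpa only [hr] using hyt⟩
    refine measurable_of_tendsto_metrizable (fun k => hH'q (r k)) ?_
    rw [tendsto_pi_nhds]
    intro x
    exact ((hH'c x).tendsto t).comp hr
  have hjoint : Measurable (Function.uncurry H') :=
    measurable_uncurry_of_continuous_of_measurable hH'c hH'm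
  let G' : ℝ → EuclideanSpace ℝ (Fin n) → ℝ := fun t x => n * ∫ s in (0 : ℝ)..t, H' s x
  have hG'c : ∀ x, Continuous fun t => G' t x := fun x =>
    continuous_const.mul (intervalIntegral.continuous_primitive
      (fun a b => (hH'c x).intervalIntegrable a b) 0)
  have hG'm : ∀ t, Measurable (G' t) := by
    intro t
    have hswap : StronglyMeasurable (Function.uncurry fun x s => H' s x) :=
      (hjoint.comp measurable_swap).stronglyMeasurable
    simp only [G', intervalIntegral]
    exact ((hswap.integral_prod_right.sub hswap.integral_prod_right).measurable).const_mul _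
  have hGjoint : Measurable (Function.uncurry G') :=
    measurable_uncurry_of_continuous_of_measurable hG'c hG'm
  have h1 : AEMeasurable (fun x => G' (v x) x) μ :=
    hGjoint.comp_aemeasurable (hv.prodMk aemeasurable_id)
  refine h1.congr ?_
  have hNae : ∀ᵐ x ∂μ, x ∉ N := measure_eq_zero_iff_ae_notMem.1 hN0
  filter_upwards [hNae] with x hx
  simp only [G', G, H', indicator_of_mem (show x ∈ Nᶜ from hx)]

theorem abs_G_sub_le {x : EuclideanSpace ℝ (Fin n)} {c : ℝ} (hc : Continuous (H x))
    (hb : ∀ t, n * |H x t| ≤ c) (s t : ℝ) : |G H x t - G H x s| ≤ c * |t - s| := by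
  rw [G, G, ← mul_sub, intervalIntegral.integral_interval_sub_left
    (hc.intervalIntegrable _ _) (hc.intervalIntegrable _ _), ← intervalIntegral.integral_const_mul,
    ← Real.norm_eq_abs]
  refine intervalIntegral.norm_integral_le_of_norm_le_const fun y _ => ?_
  rw [norm_mul, Real.norm_eq_abs, Real.norm_eq_abs, abs_of_nonneg (by positivity)]
  exact hb y

theorem G_zero (x : EuclideanSpace ℝ (Fin n)) : G H x 0 = 0 := by
  simp [G]

end Nemytskii

section Density

variable {E : Type*} [NormedAddCommGroup E] [InnerProductSpace ℝ E]

theorem sq_div_two_le_density {a : ℝ} (ha : a ^ 2 ≤ 1) : a ^ 2 / 2 ≤ 1 - √(1 - a ^ 2) := by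
  have h1 : √(1 - a ^ 2) ≤ 1 - a ^ 2 / 2 :=
    Real.sqrt_le_iff.2 ⟨by linarith, by nlinarith [sq_nonneg (a ^ 2)]⟩
  linarith

theorem density_le_sq {a : ℝ} (ha : a ^ 2 ≤ 1) : 1 - √(1 - a ^ 2) ≤ a ^ 2 := by
  have h1 : 1 - a ^ 2 ≤ √(1 - a ^ 2) :=
    Real.le_sqrt_of_sq_le (by nlinarith [sq_nonneg (a ^ 2), sq_nonneg a])
  linarith

/-- Uniform convexity of the density `1 - √(1 - |a|²)` on the unit ball. -/
theorem density_midpoint_le {a b : E} (ha : ‖a‖ ≤ 1) (hb : ‖b‖ ≤ 1) :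
    1 - √(1 - ‖(1 / 2 : ℝ) • a + (1 / 2 : ℝ) • b‖ ^ 2) ≤
      ((1 - √(1 - ‖a‖ ^ 2)) + (1 - √(1 - ‖b‖ ^ 2))) / 2 - ‖a - b‖ ^ 2 / 8 := by
  have hpar := parallelogram_law_with_norm ℝ a b
  have hm : ‖(1 / 2 : ℝ) • a + (1 / 2 : ℝ) • b‖ ^ 2
      = (‖a‖ ^ 2 + ‖b‖ ^ 2) / 2 - ‖a - b‖ ^ 2 / 4 := by
    rw [← smul_add, norm_smul, mul_pow]
    norm_num
    linarith
  have ha2 : 0 ≤ 1 - ‖a‖ ^ 2 := by nlinarith [norm_nonneg a]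
  have hb2 : 0 ≤ 1 - ‖b‖ ^ 2 := by nlinarith [norm_nonneg b]
  set A := √(1 - ‖a‖ ^ 2) with hA
  set B := √(1 - ‖b‖ ^ 2) with hB
  have hA2 : A ^ 2 = 1 - ‖a‖ ^ 2 := Real.sq_sqrt ha2
  have hB2 : B ^ 2 = 1 - ‖b‖ ^ 2 := Real.sq_sqrt hb2
  have hA0 : 0 ≤ A := Real.sqrt_nonneg _
  have hB0 : 0 ≤ B := Real.sqrt_nonneg _
  have hA1 : A ≤ 1 := by nlinarith [sq_nonneg ‖a‖]
  have hB1 : B ≤ 1 := by nlinarith [sq_nonneg ‖b‖]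
  have hd : ‖a - b‖ ^ 2 ≤ 2 * (2 - A ^ 2 - B ^ 2) := by nlinarith [sq_nonneg ‖a + b‖]
  set d := ‖a - b‖ ^ 2 with hdd
  have hd0 : 0 ≤ d := sq_nonneg _
  -- after squaring, the two sides differ by `(A - B)² / 4 + d (1 / 4 - (A + B) / 8 - d / 64)`
  have hkey : (A + B) / 2 + d / 8 ≤ √(1 - ‖(1 / 2 : ℝ) • a + (1 / 2 : ℝ) • b‖ ^ 2) := by
    refine Real.le_sqrt_of_sq_le ?_
    rw [hm]
    have h1 : 0 ≤ 6 - 4 * A - 4 * B + A ^ 2 + B ^ 2 := by nlinarith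
    have h2 : 0 ≤ d * ((1 / 4 - (A + B) / 8) - d / 64) := by
      refine mul_nonneg hd0 ?_
      linarith
    nlinarith [sq_nonneg (A - B)]
  linarith

end Density

/-! ### Square-integrable fields and midpoints -/

section LTwo

variable {α G : Type*} [MeasurableSpace α] {μ : Measure α} [NormedAddCommGroup G]

theorem toReal_eLpNorm_two_sq {f : α → G} (hf : MemLp f 2 μ) :
    (eLpNorm f 2 μ).toReal ^ 2 = ∫ x, ‖f x‖ ^ 2 ∂μ := by
  rw [hf.eLpNorm_eq_integral_rpow_norm two_ne_zero ENNReal.ofNat_ne_top, ENNReal.toReal_ofReal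
    (Real.rpow_nonneg (integral_nonneg fun _ => by positivity) _), ← Real.rpow_natCast,
    ← Real.rpow_mul (integral_nonneg fun _ => by positivity)]
  simp

/-- Completeness of `L²`, in terms of functions. -/
theorem exists_tendsto_eLpNorm_of_integral_sq_le [CompleteSpace G] {F : ℕ → α → G}
    (hF : ∀ k, MemLp (F k) 2 μ) {η : ℕ → ℝ} (hη : Tendsto η atTop (𝓝 0))
    (h : ∀ k l, ∫ x, ‖F k x - F l x‖ ^ 2 ∂μ ≤ η k + η l) :
    ∃ g : α → G, MemLp g 2 μ ∧
      Tendsto (fun k => eLpNorm (fun x => F k x - g x) 2 μ) atTop (𝓝 0) := by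
  have hc : CauchySeq fun k => (hF k).toLp (F k) := by
    rw [Metric.cauchySeq_iff]
    intro ε hε
    obtain ⟨N, hN⟩ := eventually_atTop.1
      (hη.eventually (gt_mem_nhds (show (0 : ℝ) < ε ^ 2 / 2 by positivity)))
    refine ⟨N, fun k hk l hl => ?_⟩
    rw [dist_eq_norm, ← MemLp.toLp_sub, Lp.norm_toLp]
    have h1 := toReal_eLpNorm_two_sq ((hF k).sub (hF l))
    have h2 := h k l
    simp only [Pi.sub_apply] at h1
    refine lt_of_pow_lt_pow_left₀ 2 hε.le ?_
    rw [h1]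
    linarith [hN k hk, hN l hl]
  obtain ⟨g, hg⟩ := cauchySeq_tendsto_of_complete hc
  refine ⟨g, Lp.memLp g, ?_⟩
  rw [Lp.tendsto_Lp_iff_tendsto_eLpNorm'] at hg
  refine hg.congr fun k => eLpNorm_congr_ae ?_
  filter_upwards [(hF k).coeFn_toLp] with x hx
  rw [Pi.sub_apply, hx]

theorem tendsto_eLpNorm_of_triangle {p : ℝ≥0∞} (hp : 1 ≤ p) {a b c : ℕ → α → G}
    (hc : ∀ k x, c k x = a k x + b k x) (ha : ∀ k, AEStronglyMeasurable (a k) μ)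
    (hb : ∀ k, AEStronglyMeasurable (b k) μ)
    (hat : Tendsto (fun k => eLpNorm (a k) p μ) atTop (𝓝 0))
    (hbt : Tendsto (fun k => eLpNorm (b k) p μ) atTop (𝓝 0)) :
    Tendsto (fun k => eLpNorm (c k) p μ) atTop (𝓝 0) := by
  have h := hat.add hbt
  rw [add_zero] at h
  refine tendsto_of_tendsto_of_tendsto_of_le_of_le tendsto_const_nhds h (fun _ => bot_le)
    fun k => ?_
  have : c k = a k + b k := funext (hc k)
  simp only [this]
  exact eLpNorm_add_le (ha k) (hb k) hp

end LTwo

/-- A bounded sequence of functions with a common Lipschitz constant has a subsequence that converges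
pointwise. -/
theorem exists_subseq_tendsto_of_lipschitz {X : Type*} [PseudoMetricSpace X]
    [TopologicalSpace.SeparableSpace X] [Nonempty X] {L : NNReal} {M : ℝ} {f : ℕ → X → ℝ}
    (hf : ∀ k, LipschitzWith L (f k)) (hM : ∀ k x, |f k x| ≤ M) :
    ∃ σ : ℕ → ℕ, StrictMono σ ∧ ∃ g : X → ℝ, LipschitzWith L g ∧ (∀ x, |g x| ≤ M) ∧
      ∀ x, Tendsto (fun k => f (σ k) x) atTop (𝓝 (g x)) := by
  set d := TopologicalSpace.denseSeq X
  have hcomp : IsCompact (pi univ fun _ : ℕ => Icc (-M) M) :=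
    isCompact_univ_pi fun _ => isCompact_Icc
  obtain ⟨a, -, σ, hσ, ha⟩ := hcomp.tendsto_subseq (x := fun k i => f k (d i))
    fun k i _ => abs_le.1 (hM k (d i))
  rw [tendsto_pi_nhds] at ha
  have hlim : ∀ x, ∃ y, Tendsto (fun k => f (σ k) x) atTop (𝓝 y) := by
    intro x
    refine cauchySeq_tendsto_of_complete ?_
    rw [Metric.cauchySeq_iff]
    intro ε hε
    have hη : 0 < ε / (3 * (L + 1)) := by positivity
    obtain ⟨i, hi⟩ := (TopologicalSpace.denseRange_denseSeq X).exists_dist_lt x hη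
    have hLi : L * dist x (d i) < ε / 3 := by
      have h1 : (L + 1 : ℝ) * (ε / (3 * (L + 1))) = ε / 3 := by field_simp
      have h2 : (0 : ℝ) ≤ L := L.2
      nlinarith [dist_nonneg (x := x) (y := d i)]
    obtain ⟨N, hN⟩ := Metric.cauchySeq_iff.1 (ha i).cauchySeq (ε / 3) (by positivity)
    refine ⟨N, fun k hk l hl => ?_⟩
    have h1 := (hf (σ k)).dist_le_mul x (d i)
    have h2 := (hf (σ l)).dist_le_mul (d i) x
    rw [dist_comm (d i) x] at h2
    have h3 : dist (f (σ k) (d i)) (f (σ l) (d i)) < ε / 3 := hN k hk l hl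
    linarith [dist_triangle4 (f (σ k) x) (f (σ k) (d i)) (f (σ l) (d i)) (f (σ l) x)]
  choose g hg using hlim
  refine ⟨σ, hσ, g, LipschitzWith.of_dist_le_mul fun x y => ?_, fun x => ?_, hg⟩
  · exact le_of_tendsto ((hg x).dist (hg y)) (Eventually.of_forall fun k =>
      (hf (σ k)).dist_le_mul x y)
  · exact le_of_tendsto (hg x).abs (Eventually.of_forall fun k => hM _ x)

section Functional

variable {n : ℕ} {Ω : Set (EuclideanSpace ℝ (Fin n))} {φ : EuclideanSpace ℝ (Fin n) → ℝ}
  {H : EuclideanSpace ℝ (Fin n) → ℝ → ℝ} {u v : EuclideanSpace ℝ (Fin n) → ℝ}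

theorem aestronglyMeasurable_areaDensity {U : Set (EuclideanSpace ℝ (Fin n))}
    (hu : AEStronglyMeasurable (weakGradient U u) (volume.restrict U)) :
    AEStronglyMeasurable (areaDensity U u) (volume.restrict U) :=
  Continuous.comp_aestronglyMeasurable
    (g := fun a : EuclideanSpace ℝ (Fin n) => 1 - √(1 - ‖a‖ ^ 2)) (by fun_prop) hu

theorem IsAdmissible.integrable_sq (hu : IsAdmissible (exterior Ω) u) :
    IntegrableOn (fun x => ‖weakGradient (exterior Ω) u x‖ ^ 2) (exterior Ω) :=
  (memLp_two_iff_integrable_sq_norm hu.memLp_grad.1).1 hu.memLp_grad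

theorem IsAdmissible.integrableOn_areaDensity (hu : IsAdmissible (exterior Ω) u) :
    IntegrableOn (areaDensity (exterior Ω) u) (exterior Ω) := by
  refine hu.integrable_sq.mono' (aestronglyMeasurable_areaDensity hu.memLp_grad.1) ?_
  filter_upwards [hu.grad_le_one] with x hx
  have h1 : ‖weakGradient (exterior Ω) u x‖ ^ 2 ≤ 1 := by
    nlinarith [norm_nonneg (weakGradient (exterior Ω) u x)]
  have h2 := sq_div_two_le_density h1
  rw [areaDensity, Real.norm_eq_abs, abs_of_nonneg (le_trans (by positivity) h2)]
  exact density_le_sq h1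

theorem IsAdmissible.sq_div_two_le_integral (hu : IsAdmissible (exterior Ω) u) :
    (eLpNorm (weakGradient (exterior Ω) u) 2 (volume.restrict (exterior Ω))).toReal ^ 2 / 2 ≤
      ∫ x in exterior Ω, areaDensity (exterior Ω) u x := by
  rw [toReal_eLpNorm_two_sq hu.memLp_grad, ← integral_div]
  refine integral_mono_ae (hu.integrable_sq.div_const 2) hu.integrableOn_areaDensity ?_
  filter_upwards [hu.grad_le_one] with x hx
  exact sq_div_two_le_density (by nlinarith [norm_nonneg (weakGradient (exterior Ω) u x)])

/-- The lower order term is integrable on bounded functions of `L^{2^*}`. -/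
theorem integrableOn_G (hn : 3 ≤ n) {U : Set (EuclideanSpace ℝ (Fin n))}
    (hU : MeasurableSet U) (hcar : IsCaratheodory U H) (hdom : IsDominated U H)
    (hv : MemLp v (ENNReal.ofReal (2 * n / (n - 2))) (volume.restrict U)) {M : ℝ}
    (hM : ∀ x ∈ U, |v x| ≤ M) : IntegrableOn (fun x => G H x (v x)) U := by
  obtain ⟨s, h, hs, hh, -, hb⟩ := hdom
  have := holderTriple_sobolev hn
  have h1 := integrable_mul_of_bounded hs.1 hs.2 hh hv
    ((ae_restrict_mem hU).mono fun x hx => hM x hx)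
  refine h1.mono (hcar.aemeasurable_G hv.1.aemeasurable).aestronglyMeasurable ?_
  filter_upwards [hb, hcar.continuous] with x hx hc
  have h2 := abs_G_sub_le hc hx 0 (v x)
  rw [G_zero, sub_zero, sub_zero] at h2
  rw [norm_mul, Real.norm_eq_abs, Real.norm_eq_abs, Real.norm_eq_abs]
  exact h2.trans (by gcongr; exact le_abs_self _)

/-- The admissible class is closed under midpoints. -/
theorem midpoint_mem (hu : u ∈ admissibleWithTrace Ω φ) (hv : v ∈ admissibleWithTrace Ω φ)
    (hφ : AEStronglyMeasurable φ (surfaceMeasure Ω)) :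
    (fun x => (1 / 2 : ℝ) * u x + (1 / 2 : ℝ) * v x) ∈ admissibleWithTrace Ω φ ∧
    weakGradient (exterior Ω) (fun x => (1 / 2 : ℝ) * u x + (1 / 2 : ℝ) * v x)
      =ᵐ[volume.restrict (exterior Ω)] fun x => (1 / 2 : ℝ) • weakGradient (exterior Ω) u x
        + (1 / 2 : ℝ) • weakGradient (exterior Ω) v x := by
  have hw := hu.1.isWeakGradient.combination hv.1.isWeakGradient (1 / 2) (1 / 2)
  have hae := hw.weakGradient_ae_eq isOpen_exterior
  have hlip : ∀ {u : EuclideanSpace ℝ (Fin n) → ℝ}, LocallyLipschitzOn (exterior Ω) u →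
      LocallyLipschitzOn (exterior Ω) fun x => (1 / 2 : ℝ) * u x := by
    intro u hu x hx
    obtain ⟨K, t, ht, h⟩ := hu hx
    exact ⟨_, t, ht, (lipschitzWith_smul (1 / 2 : ℝ)).comp_lipschitzOnWith h⟩
  have hμ : ∀ R, volume.restrict (Metric.ball 0 R ∩ exterior Ω) ≤ volume.restrict (exterior Ω) :=
    fun R => Measure.restrict_mono inter_subset_right le_rfl
  refine ⟨⟨⟨(hlip hu.1.locallyLipschitz).add (hlip hv.1.locallyLipschitz),
    (hu.1.memLp.const_mul _).add (hv.1.memLp.const_mul _), ⟨_, hw⟩, ?_, ?_⟩, fun R hR => ?_⟩, hae⟩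
  · exact ((hu.1.memLp_grad.const_smul (1 / 2 : ℝ)).add
      (hv.1.memLp_grad.const_smul (1 / 2 : ℝ))).ae_eq hae.symm
  · filter_upwards [hae, hu.1.grad_le_one, hv.1.grad_le_one] with x h1 h2 h3
    rw [h1]
    refine (norm_add_le _ _).trans ?_
    rw [norm_smul, norm_smul]
    norm_num
    linarith
  · obtain ⟨a, ha, ha1, ha2, ha3⟩ := hu.2 R hR
    obtain ⟨b, hb, hb1, hb2, hb3⟩ := hv.2 R hR
    have hg : ∀ {v : EuclideanSpace ℝ (Fin n) → ℝ}, ContDiff ℝ ∞ v → Continuous (gradient v) :=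
      fun h => continuous_gradient (h.of_le (mod_cast le_top))
    have hhalf : ∀ {G : Type} [NormedAddCommGroup G] [NormedSpace ℝ G]
        {μ : Measure (EuclideanSpace ℝ (Fin n))} {f : ℕ → EuclideanSpace ℝ (Fin n) → G},
        Tendsto (fun k => eLpNorm (f k) 2 μ) atTop (𝓝 0) →
        Tendsto (fun k => eLpNorm (fun x => (1 / 2 : ℝ) • f k x) 2 μ) atTop (𝓝 0) := by
      intro G _ _ μ f hf
      have h1 := ENNReal.Tendsto.const_mul (a := ‖(1 / 2 : ℝ)‖ₑ) hf (Or.inr enorm_ne_top)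
      rw [mul_zero] at h1
      exact h1.congr fun k => (eLpNorm_const_smul (1 / 2 : ℝ) (f k) 2 μ).symm
    have hgrad : ∀ k x, gradient (fun x => (1 / 2 : ℝ) * a k x + (1 / 2 : ℝ) * b k x) x
        = (1 / 2 : ℝ) • gradient (a k) x + (1 / 2 : ℝ) • gradient (b k) x := by
      intro k x
      have da := (ha k).differentiable (by simp) x
      have db := (hb k).differentiable (by simp) x
      rw [gradient, fderiv_fun_add (da.const_mul _) (db.const_mul _), fderiv_const_mul da,
        fderiv_const_mul db, map_add, map_smulₛₗ, map_smulₛₗ, gradient, gradient]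
      simp
    refine ⟨fun k x => (1 / 2 : ℝ) * a k x + (1 / 2 : ℝ) * b k x,
      fun k => (contDiff_const.mul (ha k)).add (contDiff_const.mul (hb k)), ?_, ?_, ?_⟩
    · refine tendsto_eLpNorm_of_triangle one_le_two (fun k x => ?_) (fun k => ?_) (fun k => ?_)
        (hhalf ha1) (hhalf hb1)
      · simp only [smul_eq_mul]; ring
      · exact ((ha k).continuous.aestronglyMeasurable.sub
          (hu.1.memLp.1.mono_measure (hμ R))).const_smul (1 / 2 : ℝ)
      · exact ((hb k).continuous.aestronglyMeasurable.sub
          (hv.1.memLp.1.mono_measure (hμ R))).const_smul (1 / 2 : ℝ)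
    · refine (tendsto_eLpNorm_of_triangle one_le_two
        (c := fun k x => gradient (fun x => (1 / 2 : ℝ) * a k x + (1 / 2 : ℝ) * b k x) x -
          ((1 / 2 : ℝ) • weakGradient (exterior Ω) u x
            + (1 / 2 : ℝ) • weakGradient (exterior Ω) v x))
        (fun k x => ?_) (fun k => ?_) (fun k => ?_)
        (hhalf ha2) (hhalf hb2)).congr fun k => eLpNorm_congr_ae ?_
      · rw [hgrad]; module
      · exact ((hg (ha k)).aestronglyMeasurable.sub
          (hu.1.memLp_grad.1.mono_measure (hμ R))).const_smul (1 / 2 : ℝ)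
      · exact ((hg (hb k)).aestronglyMeasurable.sub
          (hv.1.memLp_grad.1.mono_measure (hμ R))).const_smul (1 / 2 : ℝ)
      · filter_upwards [ae_mono (hμ R) hae] with x hx
        rw [hx]
    · refine tendsto_eLpNorm_of_triangle one_le_two (fun k x => ?_) (fun k => ?_) (fun k => ?_)
        (hhalf ha3) (hhalf hb3)
      · simp only [smul_eq_mul]; ring
      · exact ((ha k).continuous.aestronglyMeasurable.sub hφ).const_smul (1 / 2 : ℝ)
      · exact ((hb k).continuous.aestronglyMeasurable.sub hφ).const_smul (1 / 2 : ℝ)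

/-- The area term is uniformly convex. -/
theorem integral_areaDensity_midpoint_le (hu : u ∈ admissibleWithTrace Ω φ)
    (hv : v ∈ admissibleWithTrace Ω φ) (hφ : AEStronglyMeasurable φ (surfaceMeasure Ω)) :
    ∫ x in exterior Ω, areaDensity (exterior Ω)
        (fun x => (1 / 2 : ℝ) * u x + (1 / 2 : ℝ) * v x) x ≤
      ((∫ x in exterior Ω, areaDensity (exterior Ω) u x) +
        ∫ x in exterior Ω, areaDensity (exterior Ω) v x) / 2 -
      (∫ x in exterior Ω,
        ‖weakGradient (exterior Ω) u x - weakGradient (exterior Ω) v x‖ ^ 2) / 8 := by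
  obtain ⟨hm, hae⟩ := midpoint_mem hu hv hφ
  have i1 := hu.1.integrableOn_areaDensity
  have i2 := hv.1.integrableOn_areaDensity
  have i3 : IntegrableOn (fun x => ‖weakGradient (exterior Ω) u x -
      weakGradient (exterior Ω) v x‖ ^ 2) (exterior Ω) :=
    (memLp_two_iff_integrable_sq_norm (hu.1.memLp_grad.sub hv.1.memLp_grad).1).1
      (hu.1.memLp_grad.sub hv.1.memLp_grad)
  have i12 : IntegrableOn (fun x => areaDensity (exterior Ω) u x + areaDensity (exterior Ω) v x)
      (exterior Ω) := i1.add i2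
  rw [← integral_add i1 i2, ← integral_div, ← integral_div,
    ← integral_sub (i12.div_const 2) (i3.div_const 8)]
  refine integral_mono_ae hm.1.integrableOn_areaDensity
    ((i12.div_const 2).sub (i3.div_const 8)) ?_
  filter_upwards [hae, hu.1.grad_le_one, hv.1.grad_le_one] with x h1 h2 h3
  simp only [areaDensity, h1]
  exact density_midpoint_le h2 h3

end Functional

/-! ### Closedness of the class and uniform bounds -/

section Closedness

variable {n : ℕ} {Ω : Set (EuclideanSpace ℝ (Fin n))} {φ : EuclideanSpace ℝ (Fin n) → ℝ}

/-- Weak gradients pass to the limit under bounded pointwise convergence of the functions and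
`L²` convergence of the gradients. -/
theorem isWeakGradient_of_tendsto {U : Set (EuclideanSpace ℝ (Fin n))} (hU : IsOpen U)
    {u : ℕ → EuclideanSpace ℝ (Fin n) → ℝ}
    {k : ℕ → EuclideanSpace ℝ (Fin n) → EuclideanSpace ℝ (Fin n)}
    (hu : ∀ i, IsWeakGradient U (u i) (k i)) {v : EuclideanSpace ℝ (Fin n) → ℝ}
    (hv : LocallyIntegrableOn v U) (hlim : ∀ x ∈ U, Tendsto (fun i => u i x) atTop (𝓝 (v x)))
    {M : ℝ} (hM : ∀ i, ∀ x ∈ U, |u i x - v x| ≤ M)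
    {g : EuclideanSpace ℝ (Fin n) → EuclideanSpace ℝ (Fin n)}
    (hg : MemLp g 2 (volume.restrict U))
    (hgl : Tendsto (fun i => eLpNorm (fun x => k i x - g x) 2 (volume.restrict U)) atTop (𝓝 0))
    (hk : ∀ i, AEStronglyMeasurable (k i) (volume.restrict U)) :
    IsWeakGradient U v g where
  locallyIntegrable := hv
  locallyIntegrable_grad :=
    locallyIntegrableOn_of_locallyIntegrable_restrict (hg.locallyIntegrable one_le_two)
  integral_eq ψ hψ hψc hψU := by
    have hψ2 : MemLp ψ 2 (volume.restrict U) :=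
      (hψ.continuous.memLp_of_hasCompactSupport hψc).restrict U
    have lim1 := (tendsto_integral_smul_of_tendsto_eLpNorm hψ2 hg hk hgl).neg
    have hb : LocallyIntegrableOn (fun x => |v x| + M) U :=
      hv.norm.add ((locallyIntegrable_const M).locallyIntegrableOn U)
    have lim2 : Tendsto (fun i => ∫ x in U, u i x • gradient ψ x) atTop
        (𝓝 (∫ x in U, v x • gradient ψ x)) := by
      refine tendsto_integral_of_dominated_convergence
        (fun x => ‖(|v x| + M) • gradient ψ x‖)
        (fun i => (integrableOn_smul_gradient (hu i).locallyIntegrable hψ hψc hψU).1)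
        (integrableOn_smul_gradient hb hψ hψc hψU).norm (fun i => ?_) ?_
      · filter_upwards [ae_restrict_mem hU.measurableSet] with x hx
        rw [norm_smul, norm_smul, Real.norm_eq_abs, Real.norm_eq_abs]
        refine mul_le_mul_of_nonneg_right ?_ (norm_nonneg _)
        have h1 := abs_sub_abs_le_abs_sub (u i x) (v x)
        have h2 : |u i x| ≤ |v x| + M := by linarith [hM i x hx]
        exact h2.trans (le_abs_self _)
      · filter_upwards [ae_restrict_mem hU.measurableSet] with x hx
        exact (hlim x hx).smul_const _
    refine tendsto_nhds_unique lim2 (lim1.congr fun i => ?_)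
    exact ((hu i).integral_eq ψ hψ hψc hψU).symm

/-- The trace condition passes to the limit under convergence in `W^{1,2}` on bounded sets. -/
theorem hasTrace_of_tendsto {u : ℕ → EuclideanSpace ℝ (Fin n) → ℝ}
    {v : EuclideanSpace ℝ (Fin n) → ℝ} (hu : ∀ i, HasTrace Ω (u i) φ)
    (hum : ∀ i, AEStronglyMeasurable (u i) (volume.restrict (exterior Ω)))
    (hvm : AEStronglyMeasurable v (volume.restrict (exterior Ω)))
    (hgm : ∀ i, AEStronglyMeasurable (weakGradient (exterior Ω) (u i))
      (volume.restrict (exterior Ω)))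
    (hvgm : AEStronglyMeasurable (weakGradient (exterior Ω) v) (volume.restrict (exterior Ω)))
    (h1 : ∀ R, Tendsto (fun i => eLpNorm (fun x => u i x - v x) 2
      (volume.restrict (Metric.ball 0 R ∩ exterior Ω))) atTop (𝓝 0))
    (h2 : Tendsto (fun i => eLpNorm (fun x => weakGradient (exterior Ω) (u i) x -
      weakGradient (exterior Ω) v x) 2 (volume.restrict (exterior Ω))) atTop (𝓝 0)) :
    HasTrace Ω v φ := by
  intro R hR
  have hμ : volume.restrict (Metric.ball 0 R ∩ exterior Ω) ≤ volume.restrict (exterior Ω) :=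
    Measure.restrict_mono inter_subset_right le_rfl
  have hstep : ∀ i : ℕ, ∃ f : EuclideanSpace ℝ (Fin n) → ℝ, ContDiff ℝ ∞ f ∧
      eLpNorm (fun x => f x - u i x) 2 (volume.restrict (Metric.ball 0 R ∩ exterior Ω))
        < ((i : ℝ≥0∞) + 1)⁻¹ ∧
      eLpNorm (fun x => gradient f x - weakGradient (exterior Ω) (u i) x) 2
        (volume.restrict (Metric.ball 0 R ∩ exterior Ω)) < ((i : ℝ≥0∞) + 1)⁻¹ ∧
      eLpNorm (fun x => f x - φ x) 2 (surfaceMeasure Ω) < ((i : ℝ≥0∞) + 1)⁻¹ := by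
    intro i
    obtain ⟨f, hf, hf1, hf2, hf3⟩ := hu i R hR
    have hpos : (0 : ℝ≥0∞) < ((i : ℝ≥0∞) + 1)⁻¹ :=
      ENNReal.inv_pos.2 (ENNReal.add_ne_top.2 ⟨ENNReal.natCast_ne_top i, ENNReal.one_ne_top⟩)
    obtain ⟨j, hj1, hj2, hj3⟩ := ((hf1.eventually (gt_mem_nhds hpos)).and
      ((hf2.eventually (gt_mem_nhds hpos)).and (hf3.eventually (gt_mem_nhds hpos)))).exists
    exact ⟨f j, hf j, hj1, hj2, hj3⟩
  choose f hf hf1 hf2 hf3 using hstep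
  have hinv : Tendsto (fun i : ℕ => ((i : ℝ≥0∞) + 1)⁻¹) atTop (𝓝 0) := by
    have := (tendsto_add_atTop_iff_nat 1).2 ENNReal.tendsto_inv_nat_nhds_zero
    simpa using this
  have hsq : ∀ {a : ℕ → ℝ≥0∞}, (∀ i, a i < ((i : ℝ≥0∞) + 1)⁻¹) → Tendsto a atTop (𝓝 0) :=
    fun ha => tendsto_of_tendsto_of_tendsto_of_le_of_le tendsto_const_nhds hinv
      (fun _ => bot_le) fun i => (ha i).le
  have hg : ∀ i, Continuous (gradient (f i)) :=
    fun i => continuous_gradient ((hf i).of_le (mod_cast le_top))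
  refine ⟨f, hf, ?_, ?_, hsq hf3⟩
  · refine tendsto_eLpNorm_of_triangle one_le_two (fun i x => ?_) (fun i => ?_) (fun i => ?_)
      (hsq hf1) (h1 R)
    · ring
    · exact (hf i).continuous.aestronglyMeasurable.sub ((hum i).mono_measure hμ)
    · exact ((hum i).sub hvm).mono_measure hμ
  · refine tendsto_eLpNorm_of_triangle one_le_two (fun i x => ?_) (fun i => ?_) (fun i => ?_)
      (hsq hf2) (tendsto_of_tendsto_of_tendsto_of_le_of_le tendsto_const_nhds h2
        (fun _ => bot_le) fun i => eLpNorm_mono_measure _ hμ)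
    · abel
    · exact (hg i).aestronglyMeasurable.sub ((hgm i).mono_measure hμ)
    · exact ((hgm i).sub hvgm).mono_measure hμ

/-- Closedness of the admissible class. -/
theorem mem_admissibleWithTrace_of_tendsto (hn : 3 ≤ n)
    {u : ℕ → EuclideanSpace ℝ (Fin n) → ℝ} (hu : ∀ i, u i ∈ admissibleWithTrace Ω φ)
    {v : EuclideanSpace ℝ (Fin n) → ℝ} (hvl : LocallyLipschitzOn (exterior Ω) v)
    (hv : MemLp v (ENNReal.ofReal (2 * n / (n - 2))) (volume.restrict (exterior Ω)))
    (hlim : ∀ x ∈ exterior Ω, Tendsto (fun i => u i x) atTop (𝓝 (v x)))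
    {M : ℝ} (hM : ∀ i, ∀ x ∈ exterior Ω, |u i x - v x| ≤ M)
    {g : EuclideanSpace ℝ (Fin n) → EuclideanSpace ℝ (Fin n)}
    (hg : MemLp g 2 (volume.restrict (exterior Ω)))
    (hgl : Tendsto (fun i => eLpNorm (fun x => weakGradient (exterior Ω) (u i) x - g x) 2
      (volume.restrict (exterior Ω))) atTop (𝓝 0))
    (hgae : ∀ᵐ x ∂(volume.restrict (exterior Ω)),
      Tendsto (fun i => weakGradient (exterior Ω) (u i) x) atTop (𝓝 (g x))) :
    v ∈ admissibleWithTrace Ω φ ∧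
      weakGradient (exterior Ω) v =ᵐ[volume.restrict (exterior Ω)] g := by
  have hq1 : 1 ≤ ENNReal.ofReal (2 * n / (n - 2)) :=
    one_le_two.trans (two_le_sobolevExponent hn)
  have hwg : IsWeakGradient (exterior Ω) v g :=
    isWeakGradient_of_tendsto isOpen_exterior (fun i => (hu i).1.isWeakGradient)
      (locallyIntegrableOn_of_locallyIntegrable_restrict (hv.locallyIntegrable hq1)) hlim hM hg hgl
      fun i => (hu i).1.memLp_grad.1
  have hae := hwg.weakGradient_ae_eq isOpen_exterior
  have hle : ∀ᵐ x ∂(volume.restrict (exterior Ω)), ‖g x‖ ≤ 1 := by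
    filter_upwards [hgae, ae_all_iff.2 fun i => (hu i).1.grad_le_one] with x hx h1
    exact le_of_tendsto hx.norm (Eventually.of_forall h1)
  have hgmem := hg.ae_eq hae.symm
  refine ⟨⟨⟨hvl, hv, ⟨g, hwg⟩, hgmem, ?_⟩, ?_⟩, hae⟩
  · filter_upwards [hae, hle] with x h1 h2
    rwa [h1]
  · refine hasTrace_of_tendsto (fun i => (hu i).2) (fun i => (hu i).1.memLp.1) hv.1
      (fun i => (hu i).1.memLp_grad.1) hgmem.1 (fun R => ?_) (hgl.congr fun i => ?_)
    · have hμ : volume.restrict (Metric.ball 0 R ∩ exterior Ω) ≤ volume.restrict (exterior Ω) :=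
        Measure.restrict_mono inter_subset_right le_rfl
      have := isFiniteMeasure_restrict_ball_inter R (exterior Ω)
      have hm : MeasurableSet (Metric.ball 0 R ∩ exterior Ω) :=
        measurableSet_ball.inter isOpen_exterior.measurableSet
      have h0 := tendsto_eLpNorm_two_of_dominated
        (μ := volume.restrict (Metric.ball 0 R ∩ exterior Ω))
        (F := fun i x => u i x - v x) (f := fun _ => (0 : ℝ)) (b := fun _ => M)
        (fun i => ((hu i).1.memLp.1.sub hv.1).mono_measure hμ) (memLp_const M)
        (fun i => (ae_restrict_mem hm).mono fun x hx => hM i x hx.2)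
        ((ae_restrict_mem hm).mono fun x hx => by
          simpa using (hlim x hx.2).sub_const (v x))
      rwa [eLpNorm_zero'] at h0
    · refine eLpNorm_congr_ae ?_
      filter_upwards [hae] with x hx
      rw [hx]

end Closedness

section LowerOrder

variable {n : ℕ} {Ω : Set (EuclideanSpace ℝ (Fin n))} {φ : EuclideanSpace ℝ (Fin n) → ℝ}
  {H : EuclideanSpace ℝ (Fin n) → ℝ → ℝ} {u w : EuclideanSpace ℝ (Fin n) → ℝ}

theorem enorm_integral_G_sub_le {U : Set (EuclideanSpace ℝ (Fin n))} (hcar : IsCaratheodory U H)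
    {h : EuclideanSpace ℝ (Fin n) → ℝ}
    (hb : ∀ᵐ x ∂(volume.restrict U), ∀ t, n * |H x t| ≤ h x)
    (hu : IntegrableOn (fun x => G H x (u x)) U) (hw : IntegrableOn (fun x => G H x (w x)) U) :
    ‖(∫ x in U, G H x (u x)) - ∫ x in U, G H x (w x)‖ₑ ≤ ∫⁻ x in U, ‖h x * (u x - w x)‖ₑ := by
  rw [← integral_sub hu hw]
  refine (enorm_integral_le_lintegral_enorm _).trans (lintegral_mono_ae ?_)
  filter_upwards [hb, hcar.continuous] with x hx hc
  rw [enorm_le_iff_norm_le, norm_mul, Real.norm_eq_abs, Real.norm_eq_abs, Real.norm_eq_abs]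
  exact (abs_G_sub_le hc hx (w x) (u x)).trans (by gcongr; exact le_abs_self _)

/-- Bounds for the difference of two admissible functions with the same trace. -/
theorem exists_bounds (hn : 3 ≤ n) (hΩ : IsLipschitzOpen Ω)
    (hb : Bornology.IsBounded Ω) (hφ : AEStronglyMeasurable φ (surfaceMeasure Ω))
    (hw : w ∈ admissibleWithTrace Ω φ) :
    ∃ C₁ C₂ : ℝ, 0 ≤ C₁ ∧ 0 ≤ C₂ ∧ ∀ u ∈ admissibleWithTrace Ω φ,
      MemLp ((exterior Ω).indicator fun x => u x - w x)
        (ENNReal.ofReal (2 * n / (n - 2))) volume ∧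
      (eLpNorm ((exterior Ω).indicator fun x => u x - w x)
        (ENNReal.ofReal (2 * n / (n - 2))) volume).toReal ≤ C₁ *
        ((eLpNorm (weakGradient (exterior Ω) u) 2 (volume.restrict (exterior Ω))).toReal +
          (eLpNorm (weakGradient (exterior Ω) w) 2 (volume.restrict (exterior Ω))).toReal) ∧
      ∀ x, |(exterior Ω).indicator (fun x => u x - w x) x| ≤ 2 + C₂ *
        (eLpNorm ((exterior Ω).indicator fun x => u x - w x)
          (ENNReal.ofReal (2 * n / (n - 2))) volume).toReal := by
  obtain ⟨C₂, hC₂, hbd⟩ := exists_abs_le_add_eLpNorm n (sobolevExponent_ne_zero hn)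
    ENNReal.ofReal_ne_top one_pos
  set C := SNormLESNormFDerivOfEqConst ℝ (volume : Measure (EuclideanSpace ℝ (Fin n))) 2
  refine ⟨C, C₂, C.2, hC₂, fun u hu => ?_⟩
  have hlip := lipschitzWith_indicator_sub hn hΩ hb hφ hu hw
  set z := (exterior Ω).indicator fun x => u x - w x with hz
  have hzq : MemLp z (ENNReal.ofReal (2 * n / (n - 2))) volume := by
    rw [hz, memLp_indicator_iff_restrict isOpen_exterior.measurableSet]
    exact hu.1.memLp.sub hw.1.memLp
  refine ⟨hzq, ?_, fun x => ?_⟩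
  · have hwg : IsWeakGradient (exterior Ω) z
        fun x => weakGradient (exterior Ω) u x - weakGradient (exterior Ω) w x := by
      have h0 := hu.1.isWeakGradient.combination hw.1.isWeakGradient 1 (-1)
      have heq : ∀ x ∈ exterior Ω, z x = 1 * u x + -1 * w x := fun x hx => by
        rw [hz, indicator_of_mem hx]; ring
      refine ⟨hlip.continuous.locallyIntegrable.locallyIntegrableOn _, ?_, fun ψ hψ hψc hψU => ?_⟩
      · simpa [sub_eq_add_neg] using h0.locallyIntegrable_grad
      · have h1 := h0.integral_eq ψ hψ hψc hψU
        rw [setIntegral_congr_fun isOpen_exterior.measurableSet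
          (fun x hx => by simp only [heq x hx] :
            EqOn (fun x => z x • gradient ψ x) (fun x => (1 * u x + -1 * w x) • gradient ψ x)
              (exterior Ω)), h1]
        simp [sub_eq_add_neg]
    have h2 := eLpNorm_le_weakGradient hn isOpen_exterior hlip
      (fun x hx => indicator_of_notMem hx _) hzq hwg
    have h3 : eLpNorm (fun x => weakGradient (exterior Ω) u x - weakGradient (exterior Ω) w x) 2
        (volume.restrict (exterior Ω)) ≤
        eLpNorm (weakGradient (exterior Ω) u) 2 (volume.restrict (exterior Ω)) +
          eLpNorm (weakGradient (exterior Ω) w) 2 (volume.restrict (exterior Ω)) :=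
      eLpNorm_sub_le hu.1.memLp_grad.1 hw.1.memLp_grad.1 one_le_two
    have h4 : eLpNorm z (ENNReal.ofReal (2 * n / (n - 2))) volume ≤ C *
        (eLpNorm (weakGradient (exterior Ω) u) 2 (volume.restrict (exterior Ω)) +
          eLpNorm (weakGradient (exterior Ω) w) 2 (volume.restrict (exterior Ω))) :=
      h2.trans (by gcongr)
    have hfin : eLpNorm (weakGradient (exterior Ω) u) 2 (volume.restrict (exterior Ω)) +
        eLpNorm (weakGradient (exterior Ω) w) 2 (volume.restrict (exterior Ω)) ≠ ⊤ :=
      ENNReal.add_ne_top.2 ⟨hu.1.memLp_grad.2.ne, hw.1.memLp_grad.2.ne⟩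
    have h5 := ENNReal.toReal_mono (ENNReal.mul_ne_top ENNReal.coe_ne_top hfin) h4
    rwa [ENNReal.toReal_mul, ENNReal.toReal_add hu.1.memLp_grad.2.ne hw.1.memLp_grad.2.ne,
      ENNReal.coe_toReal] at h5
  · have h1 := hbd univ z x 2 zero_le_two (subset_univ _) (fun y _ => by
      rw [← Real.dist_eq, ← dist_eq_norm]; exact hlip.dist_le_mul y x)
      (by rw [Measure.restrict_univ]; exact hzq.2.ne)
    rwa [mul_one, Measure.restrict_univ] at h1

/-- The lower order term is continuous along bounded sequences that converge pointwise. -/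
theorem tendsto_lintegral_mul_sub {α : Type*} [MeasurableSpace α] {μ : Measure α} {s p q : ℝ}
    (hs : 1 ≤ s) (hsp : s ≤ p)
    [ENNReal.HolderTriple (ENNReal.ofReal p) (ENNReal.ofReal q) 1] {h : α → ℝ}
    (hh : MemLp h (ENNReal.ofReal s) μ) {d : ℕ → α → ℝ} (hd : ∀ k, AEStronglyMeasurable (d k) μ)
    {M : ℝ} (hM : ∀ k, ∀ᵐ x ∂μ, |d k x| ≤ M) {B : ℝ≥0∞} (hB : B ≠ ⊤)
    (hdB : ∀ k, eLpNorm (d k) (ENNReal.ofReal q) μ ≤ B)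
    (hlim : ∀ᵐ x ∂μ, Tendsto (fun k => d k x) atTop (𝓝 0)) :
    Tendsto (fun k => ∫⁻ x, ‖h x * d k x‖ₑ ∂μ) atTop (𝓝 0) := by
  rw [ENNReal.tendsto_nhds_zero]
  intro ε hε
  obtain ⟨η, hη, hηB⟩ := ENNReal.exists_nnreal_pos_mul_lt hB (ENNReal.half_pos hε.ne').ne'
  obtain ⟨a, ha, hbd⟩ := exists_lintegral_mul_le (q := q) hs hsp hh
    (ε := η) (by simpa using hη.ne')
  have h1 : Tendsto (fun k => ∫⁻ x, ‖a x * d k x‖ₑ ∂μ) atTop (𝓝 (∫⁻ _ : α, 0 ∂μ)) := by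
    refine tendsto_lintegral_of_dominated_convergence' (fun x => ‖a x * M‖ₑ)
      (fun k => (ha.1.mul (hd k)).enorm) (fun k => ?_) (ha.mul_const M).2.ne ?_
    · filter_upwards [hM k] with x hx
      rw [enorm_le_iff_norm_le, norm_mul, norm_mul]
      gcongr
      exact hx.trans (le_abs_self _)
    · filter_upwards [hlim] with x hx
      have := (hx.const_mul (a x)).enorm
      simpa using this
  rw [lintegral_zero] at h1
  filter_upwards [ENNReal.tendsto_nhds_zero.1 h1 _ (ENNReal.half_pos hε.ne')] with k hk
  refine (hbd (d k) (hd k)).trans ?_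
  rw [← ENNReal.add_halves ε]
  exact add_le_add hk ((mul_le_mul_right (hdB k) _).trans hηB.le)

end LowerOrder

/-! ### Coercivity and existence of a minimizer -/

section Existence

variable {n : ℕ} {Ω : Set (EuclideanSpace ℝ (Fin n))} {φ : EuclideanSpace ℝ (Fin n) → ℝ}
  {H : EuclideanSpace ℝ (Fin n) → ℝ → ℝ} {u w : EuclideanSpace ℝ (Fin n) → ℝ}

/-- A finite union of bounded Lipschitz domains with disjoint closures is Lipschitz. -/
theorem isLipschitzOpen_iUnion {m : ℕ} {D : Fin m → Set (EuclideanSpace ℝ (Fin n))}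
    (hD : ∀ i, IsBoundedLipschitzDomain (D i))
    (hdisj : ∀ i j, i ≠ j → Disjoint (closure (D i)) (closure (D j))) :
    IsLipschitzOpen (⋃ i, D i) := by
  have hopen : IsOpen (⋃ i, D i) := isOpen_iUnion fun i => (hD i).lipschitz.1
  refine ⟨hopen, fun p hp => ?_⟩
  rw [hopen.frontier_eq, closure_iUnion_of_finite] at hp
  obtain ⟨i, hi⟩ := mem_iUnion.1 hp.1
  have hpf : p ∈ frontier (D i) := by
    rw [(hD i).lipschitz.1.frontier_eq]
    exact ⟨hi, fun h => hp.2 (mem_iUnion.2 ⟨i, h⟩)⟩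
  obtain ⟨r, hr, e, he, f, hf, h⟩ := (hD i).lipschitz.2 p hpf
  -- the other components stay away from `p`
  have hcl : IsClosed (⋃ j : {j : Fin m // j ≠ i}, closure (D j)) :=
    isClosed_iUnion_of_finite fun j => isClosed_closure
  have hpc : p ∈ (⋃ j : {j : Fin m // j ≠ i}, closure (D j))ᶜ := by
    intro hpj
    obtain ⟨j, hj⟩ := mem_iUnion.1 hpj
    exact disjoint_left.1 (hdisj j i j.2) hj hi
  obtain ⟨r', hr', hball⟩ := Metric.isOpen_iff.1 hcl.isOpen_compl p hpc
  refine ⟨min r r', lt_min hr hr', e, he, f, hf, fun x hx => ?_⟩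
  rw [← h x (Metric.ball_subset_ball (min_le_left _ _) hx), mem_iUnion]
  refine ⟨?_, fun hxi => ⟨i, hxi⟩⟩
  rintro ⟨j, hj⟩
  by_contra hxi
  have hji : j ≠ i := fun hji => hxi (hji ▸ hj)
  exact hball (Metric.ball_subset_ball (min_le_right _ _) hx)
    (mem_iUnion.2 ⟨⟨j, hji⟩, subset_closure hj⟩)

theorem abs_integral_G_sub_le {U : Set (EuclideanSpace ℝ (Fin n))} (hcar : IsCaratheodory U H)
    {h : EuclideanSpace ℝ (Fin n) → ℝ}
    (hb : ∀ᵐ x ∂(volume.restrict U), ∀ t, n * |H x t| ≤ h x)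
    (hu : IntegrableOn (fun x => G H x (u x)) U) (hw : IntegrableOn (fun x => G H x (w x)) U)
    (hi : IntegrableOn (fun x => h x * (u x - w x)) U) :
    |(∫ x in U, G H x (u x)) - ∫ x in U, G H x (w x)| ≤ ∫ x in U, ‖h x * (u x - w x)‖ := by
  rw [integral_norm_eq_lintegral_enorm hi.1, ← Real.norm_eq_abs, ← toReal_enorm]
  exact ENNReal.toReal_mono hi.2.ne (enorm_integral_G_sub_le hcar hb hu hw)

/-- The functional controls the `L²` norm of the gradient, since the lower order term grows at most
linearly in it. -/
theorem exists_coercive (hn : 3 ≤ n) (hΩ : IsLipschitzOpen Ω) (hb : Bornology.IsBounded Ω)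
    (hcar : IsCaratheodory (exterior Ω) H) (hdom : IsDominated (exterior Ω) H)
    (hφ : AEStronglyMeasurable φ (surfaceMeasure Ω)) (hw : w ∈ admissibleWithTrace Ω φ)
    (hG : ∀ u ∈ admissibleWithTrace Ω φ, IntegrableOn (fun x => G H x (u x)) (exterior Ω)) :
    ∃ A B : ℝ, 0 ≤ B ∧ ∀ u ∈ admissibleWithTrace Ω φ,
      (eLpNorm (weakGradient (exterior Ω) u) 2 (volume.restrict (exterior Ω))).toReal ^ 2 / 2 ≤
        energy (exterior Ω) H u + A + B *
          (eLpNorm (weakGradient (exterior Ω) u) 2 (volume.restrict (exterior Ω))).toReal := by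
  obtain ⟨s, h, hs, hh, -, hbd⟩ := hdom
  have := holderTriple_sobolev hn
  obtain ⟨C₁, C₂, hC₁, hC₂, hbounds⟩ := exists_bounds hn hΩ hb hφ hw
  obtain ⟨a, ha, hle⟩ := exists_lintegral_mul_le (q := 2 * n / (n - 2)) hs.1 hs.2 hh one_ne_zero
  set μ := volume.restrict (exterior Ω) with hμ
  set Nw := (eLpNorm (weakGradient (exterior Ω) w) 2 μ).toReal with hNw
  set α := (∫⁻ x, ‖a x‖ₑ ∂μ).toReal with hα
  have hα0 : 0 ≤ α := ENNReal.toReal_nonneg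
  set B := (α * C₂ + 1) * C₁ with hB
  have hB0 : 0 ≤ B := by positivity
  refine ⟨|∫ x in exterior Ω, G H x (w x)| + 2 * α + B * Nw, B, hB0, fun u hu => ?_⟩
  obtain ⟨hzq, hzN, hzM⟩ := hbounds u hu
  set z := (exterior Ω).indicator fun x => u x - w x with hz
  set Z := (eLpNorm z (ENNReal.ofReal (2 * n / (n - 2))) volume).toReal with hZ
  set N := (eLpNorm (weakGradient (exterior Ω) u) 2 μ).toReal with hN
  have hZ0 : 0 ≤ Z := ENNReal.toReal_nonneg
  have hdM : ∀ᵐ x ∂μ, ‖u x - w x‖ₑ ≤ ENNReal.ofReal (2 + C₂ * Z) := by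
    filter_upwards [ae_restrict_mem isOpen_exterior.measurableSet] with x hx
    have h1 := hzM x
    rw [hz, indicator_of_mem hx] at h1
    rw [Real.enorm_eq_ofReal_abs]
    exact ENNReal.ofReal_le_ofReal h1
  have hdq : eLpNorm (fun x => u x - w x) (ENNReal.ofReal (2 * n / (n - 2))) μ
      = ENNReal.ofReal Z := by
    rw [hZ, ENNReal.ofReal_toReal hzq.2.ne, hz,
      eLpNorm_indicator_eq_eLpNorm_restrict isOpen_exterior.measurableSet]
  have h1 : ‖(∫ x in exterior Ω, G H x (u x)) - ∫ x in exterior Ω, G H x (w x)‖ₑ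
      ≤ ENNReal.ofReal (α * (2 + C₂ * Z) + Z) := by
    refine (enorm_integral_G_sub_le hcar hbd (hG u hu) (hG w hw)).trans
      ((hle (fun x => u x - w x) (hu.1.memLp.1.sub hw.1.memLp.1)).trans ?_)
    rw [one_mul, hdq, ENNReal.ofReal_add (by positivity) hZ0]
    gcongr
    calc ∫⁻ x, ‖a x * (u x - w x)‖ₑ ∂μ ≤ ∫⁻ x, ‖a x‖ₑ * ENNReal.ofReal (2 + C₂ * Z) ∂μ := by
          refine lintegral_mono_ae ?_
          filter_upwards [hdM] with x hx
          rw [enorm_mul]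
          gcongr
      _ = ENNReal.ofReal (α * (2 + C₂ * Z)) := by
          rw [lintegral_mul_const' _ _ ENNReal.ofReal_ne_top, ENNReal.ofReal_mul hα0, hα,
            ENNReal.ofReal_toReal ha.2.ne]
  have h2 := ENNReal.toReal_le_of_le_ofReal (by positivity) h1
  rw [toReal_enorm, Real.norm_eq_abs] at h2
  have h3 := hu.1.sq_div_two_le_integral
  have h4 := (abs_le.1 h2).1
  have h5 := neg_abs_le (∫ x in exterior Ω, G H x (w x))
  have h6 : (α * C₂ + 1) * Z ≤ (α * C₂ + 1) * (C₁ * (N + Nw)) := by gcongr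
  rw [energy]
  nlinarith

/-- Fatou's lemma for real integrals. -/
theorem integral_le_of_tendsto {α : Type*} [MeasurableSpace α] {μ : Measure α} {F : ℕ → α → ℝ}
    {f : α → ℝ} {c : ℝ} (hF : ∀ k, Integrable (F k) μ) (hF0 : ∀ k, 0 ≤ᵐ[μ] F k)
    (hf : Integrable f μ) (hlim : ∀ᵐ x ∂μ, Tendsto (fun k => F k x) atTop (𝓝 (f x)))
    (hc : Tendsto (fun k => ∫ x, F k x ∂μ) atTop (𝓝 c)) : ∫ x, f x ∂μ ≤ c := by
  have hf0 : 0 ≤ᵐ[μ] f := by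
    filter_upwards [hlim, ae_all_iff.2 hF0] with x hx h0
    exact ge_of_tendsto' hx h0
  have hc0 : 0 ≤ c := ge_of_tendsto' hc fun k => integral_nonneg_of_ae (hF0 k)
  rw [← ENNReal.ofReal_le_ofReal_iff hc0, ofReal_integral_eq_lintegral_ofReal hf hf0]
  have h1 : Tendsto (fun k => ∫⁻ x, ENNReal.ofReal (F k x) ∂μ) atTop (𝓝 (ENNReal.ofReal c)) := by
    refine ((ENNReal.continuous_ofReal.tendsto c).comp hc).congr fun k => ?_
    exact ofReal_integral_eq_lintegral_ofReal (hF k) (hF0 k)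
  rw [← h1.liminf_eq]
  refine le_trans (lintegral_mono_ae ?_)
    (lintegral_liminf_le' fun k => (hF k).1.aemeasurable.ennreal_ofReal)
  filter_upwards [hlim] with x hx
  exact (((ENNReal.continuous_ofReal.tendsto _).comp hx).liminf_eq).ge

theorem integrableOn_G_of_mem (hn : 3 ≤ n) (hΩ : IsLipschitzOpen Ω) (hb : Bornology.IsBounded Ω)
    (hcar : IsCaratheodory (exterior Ω) H) (hdom : IsDominated (exterior Ω) H)
    (hu : u ∈ admissibleWithTrace Ω φ) : IntegrableOn (fun x => G H x (u x)) (exterior Ω) := by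
  obtain ⟨M, hM⟩ := hu.1.exists_bound hn hΩ hb
  exact integrableOn_G hn isOpen_exterior.measurableSet hcar hdom hu.1.memLp hM

/-- Existence of a minimizer. A minimizing sequence converges pointwise along a subsequence, so the
lower order term converges; uniform convexity of the area term then makes the gradients converge
strongly in `L²`. -/
theorem exists_minimizer (hn : 3 ≤ n) (hΩ : IsLipschitzOpen Ω) (hb : Bornology.IsBounded Ω)
    (hcar : IsCaratheodory (exterior Ω) H) (hdom : IsDominated (exterior Ω) H)
    (hφ : AEStronglyMeasurable φ (surfaceMeasure Ω)) (hw : w ∈ admissibleWithTrace Ω φ) :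
    ∃ u ∈ admissibleWithTrace Ω φ, ∀ v ∈ admissibleWithTrace Ω φ,
      energy (exterior Ω) H u ≤ energy (exterior Ω) H v := by
  have hUm : MeasurableSet (exterior Ω) := isOpen_exterior.measurableSet
  have hG : ∀ u ∈ admissibleWithTrace Ω φ, IntegrableOn (fun x => G H x (u x)) (exterior Ω) :=
    fun u hu => integrableOn_G_of_mem hn hΩ hb hcar hdom hu
  obtain ⟨A, B, hB, hcoer⟩ := exists_coercive hn hΩ hb hcar hdom hφ hw hG
  obtain ⟨C₁, C₂, hC₁, hC₂, hbounds⟩ := exists_bounds hn hΩ hb hφ hw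
  obtain ⟨s, h, hs, hh, -, hbd⟩ := id hdom
  have := holderTriple_sobolev hn
  set μ := volume.restrict (exterior Ω) with hμ
  set q := ENNReal.ofReal (2 * n / (n - 2)) with hq
  let N : (EuclideanSpace ℝ (Fin n) → ℝ) → ℝ :=
    fun u => (eLpNorm (weakGradient (exterior Ω) u) 2 μ).toReal
  -- a minimizing sequence
  have hbelow : BddBelow (energy (exterior Ω) H '' admissibleWithTrace Ω φ) := by
    refine ⟨-A - B ^ 2 / 2, ?_⟩
    rintro _ ⟨u, hu, rfl⟩
    have h1 := hcoer u hu
    change N u ^ 2 / 2 ≤ _ + _ + B * N u at h1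
    nlinarith [sq_nonneg (N u - B)]
  obtain ⟨E₀, -, hE₀, hE₀mem⟩ := exists_seq_tendsto_sInf ⟨_, mem_image_of_mem _ hw⟩ hbelow
  set I := sInf (energy (exterior Ω) H '' admissibleWithTrace Ω φ) with hI
  choose u₀ hu₀ hu₀E using hE₀mem
  have hImin : ∀ v ∈ admissibleWithTrace Ω φ, I ≤ energy (exterior Ω) H v := fun v hv =>
    csInf_le hbelow (mem_image_of_mem _ hv)
  -- its gradients are bounded in `L²`
  obtain ⟨N₁, hN₁⟩ : ∃ N₁, ∀ k, N (u₀ k) ≤ N₁ := by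
    obtain ⟨E₁, hE₁⟩ := hE₀.bddAbove_range
    refine ⟨2 * B + 2 * |E₁ + A| + 1, fun k => ?_⟩
    have h1 := hcoer _ (hu₀ k)
    rw [hu₀E] at h1
    change N (u₀ k) ^ 2 / 2 ≤ _ + _ + B * N (u₀ k) at h1
    have h2 : E₀ k ≤ E₁ := hE₁ (mem_range_self k)
    have h3 := le_abs_self (E₁ + A)
    have h4 := abs_nonneg (E₁ + A)
    by_contra! h5
    nlinarith
  set Z₁ := C₁ * (N₁ + N w) with hZ₁
  set M := 2 + C₂ * Z₁ with hM
  let z₀ : ℕ → EuclideanSpace ℝ (Fin n) → ℝ := fun k =>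
    (exterior Ω).indicator fun x => u₀ k x - w x
  have hz₀q : ∀ k, (eLpNorm (z₀ k) q volume).toReal ≤ Z₁ := fun k =>
    (hbounds _ (hu₀ k)).2.1.trans (by
      refine mul_le_mul_of_nonneg_left ?_ hC₁
      exact add_le_add (hN₁ k) le_rfl)
  have hz₀e : ∀ k, eLpNorm (z₀ k) q volume ≤ ENNReal.ofReal Z₁ := fun k =>
    ENNReal.le_ofReal_iff_toReal_le (hbounds _ (hu₀ k)).1.2.ne
      (ENNReal.toReal_nonneg.trans (hz₀q k)) |>.2 (hz₀q k)
  have hz₀M : ∀ k x, |z₀ k x| ≤ M := fun k x =>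
    ((hbounds _ (hu₀ k)).2.2 x).trans (by
      have := mul_le_mul_of_nonneg_left (hz₀q k) hC₂
      simp only [z₀] at this
      linarith)
  -- a pointwise convergent subsequence
  obtain ⟨σ, hσ, z, hzlip, hzM, hzlim⟩ := exists_subseq_tendsto_of_lipschitz
    (fun k => lipschitzWith_indicator_sub hn hΩ hb hφ (hu₀ k) hw) hz₀M
  have hzq : eLpNorm z q volume ≤ ENNReal.ofReal Z₁ :=
    (Lp.eLpNorm_lim_le_liminf_eLpNorm (fun k => (hbounds _ (hu₀ (σ k))).1.1) z
      (Eventually.of_forall hzlim)).trans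
      (liminf_le_of_frequently_le' (Frequently.of_forall fun k => hz₀e (σ k)))
  have hzmem : MemLp z q volume :=
    ⟨hzlip.continuous.aestronglyMeasurable, hzq.trans_lt ENNReal.ofReal_lt_top⟩
  let u₁ : ℕ → EuclideanSpace ℝ (Fin n) → ℝ := fun k => u₀ (σ k)
  have hu₁ : ∀ k, u₁ k ∈ admissibleWithTrace Ω φ := fun k => hu₀ (σ k)
  let v : EuclideanSpace ℝ (Fin n) → ℝ := fun x => w x + z x
  have hvmem : MemLp v q μ := hw.1.memLp.add (hzmem.restrict _)
  have hdiff : ∀ k, ∀ x ∈ exterior Ω, u₁ k x - v x = z₀ (σ k) x - z x := fun k x hx => by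
    simp only [z₀, u₁, v, indicator_of_mem hx]
    ring
  have hdiffM : ∀ k, ∀ x ∈ exterior Ω, |u₁ k x - v x| ≤ 2 * M := fun k x hx => by
    rw [hdiff k x hx]
    have h1 := abs_le.1 (hz₀M (σ k) x)
    have h2 := abs_le.1 (hzM x)
    exact abs_le.2 ⟨by linarith, by linarith⟩
  have hdifflim : ∀ x ∈ exterior Ω, Tendsto (fun k => u₁ k x - v x) atTop (𝓝 0) := fun x hx => by
    simp_rw [hdiff _ x hx]
    simpa using (hzlim x).sub_const (z x)
  have hdiffmem : ∀ k, MemLp (fun x => u₁ k x - v x) q μ := fun k =>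
    (hu₁ k).1.memLp.sub hvmem
  have hdiffq : ∀ k, eLpNorm (fun x => u₁ k x - v x) q μ ≤
      ENNReal.ofReal Z₁ + ENNReal.ofReal Z₁ := fun k => by
    have h1 : eLpNorm (fun x => u₁ k x - v x) q μ = eLpNorm (z₀ (σ k) - z) q μ :=
      eLpNorm_congr_ae ((ae_restrict_mem hUm).mono fun x hx => hdiff k x hx)
    rw [h1]
    refine (eLpNorm_mono_measure _ Measure.restrict_le_self).trans
      ((eLpNorm_sub_le (hbounds _ (hu₀ (σ k))).1.1 hzmem.1
        (one_le_two.trans (two_le_sobolevExponent hn))).trans (add_le_add (hz₀e _) hzq))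
  have hi : ∀ k, Integrable (fun x => h x * (u₁ k x - v x)) μ := fun k =>
    integrable_mul_of_bounded hs.1 hs.2 hh (hdiffmem k)
      ((ae_restrict_mem hUm).mono fun x hx => hdiffM k x hx)
  -- the lower order term converges
  obtain ⟨M', hM'⟩ := hw.1.exists_bound hn hΩ hb
  have hGv : IntegrableOn (fun x => G H x (v x)) (exterior Ω) :=
    integrableOn_G hn hUm hcar hdom hvmem (M := M' + M) fun x hx =>
      (abs_add_le _ _).trans (add_le_add (hM' x hx) (hzM x))
  set Gv := ∫ x in exterior Ω, G H x (v x) with hGvdef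
  let ε : ℕ → ℝ := fun k => ∫ x, ‖h x * (u₁ k x - v x)‖ ∂μ
  have hε : Tendsto ε atTop (𝓝 0) := by
    have h1 := tendsto_lintegral_mul_sub hs.1 hs.2 hh (fun k => (hdiffmem k).1)
      (fun k => (ae_restrict_mem hUm).mono fun x hx => hdiffM k x hx)
      (ENNReal.add_ne_top.2 ⟨ENNReal.ofReal_ne_top, ENNReal.ofReal_ne_top⟩) hdiffq
      ((ae_restrict_mem hUm).mono fun x hx => hdifflim x hx)
    have h2 := (ENNReal.tendsto_toReal ENNReal.zero_ne_top).comp h1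
    rw [ENNReal.toReal_zero] at h2
    exact h2.congr fun k => (integral_norm_eq_lintegral_enorm (hi k).1).symm
  have hGε : ∀ k, |(∫ x in exterior Ω, G H x (u₁ k x)) - Gv| ≤ ε k := fun k =>
    abs_integral_G_sub_le hcar hbd (hG _ (hu₁ k)) hGv (hi k)
  have hE₁ : Tendsto (fun k => energy (exterior Ω) H (u₁ k)) atTop (𝓝 I) := by
    refine (hE₀.comp hσ.tendsto_atTop).congr fun k => ?_
    exact (hu₀E (σ k)).symm
  -- the gradients form a Cauchy sequence, by comparing the midpoints with the infimum
  have hcauchy : ∀ k l, ∫ x, ‖weakGradient (exterior Ω) (u₁ k) x -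
      weakGradient (exterior Ω) (u₁ l) x‖ ^ 2 ∂μ ≤
      (4 * (energy (exterior Ω) H (u₁ k) - I) + 8 * ε k) +
        (4 * (energy (exterior Ω) H (u₁ l) - I) + 8 * ε l) := by
    intro k l
    have hmid := (midpoint_mem (hu₁ k) (hu₁ l) hφ).1
    have h1 := integral_areaDensity_midpoint_le (hu₁ k) (hu₁ l) hφ
    have h2 := hImin _ hmid
    have himid : Integrable (fun x => h x * ((1 / 2 : ℝ) * u₁ k x + (1 / 2 : ℝ) * u₁ l x - v x))
        μ := by
      refine (((hi k).const_mul (1 / 2)).add ((hi l).const_mul (1 / 2))).congr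
        (Eventually.of_forall fun x => ?_)
      simp only [Pi.add_apply]
      ring
    have h3 := abs_integral_G_sub_le hcar hbd (hG _ hmid) hGv himid
    have h4 : ∫ x, ‖h x * ((1 / 2 : ℝ) * u₁ k x + (1 / 2 : ℝ) * u₁ l x - v x)‖ ∂μ
        ≤ (1 / 2) * ε k + (1 / 2) * ε l := by
      rw [← integral_const_mul, ← integral_const_mul,
        ← integral_add ((hi k).norm.const_mul _) ((hi l).norm.const_mul _)]
      refine integral_mono himid.norm
        (((hi k).norm.const_mul _).add ((hi l).norm.const_mul _)) fun x => ?_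
      have h5 : h x * ((1 / 2 : ℝ) * u₁ k x + (1 / 2 : ℝ) * u₁ l x - v x)
          = (1 / 2) * (h x * (u₁ k x - v x)) + (1 / 2) * (h x * (u₁ l x - v x)) := by ring
      simp only [h5]
      refine (norm_add_le _ _).trans (le_of_eq ?_)
      rw [norm_mul, norm_mul (1 / 2 : ℝ)]
      norm_num
    have h6 := (abs_le.1 (h3.trans h4)).2
    have h7 := (abs_le.1 (hGε k)).1
    have h8 := (abs_le.1 (hGε l)).1
    simp only [energy] at h2 ⊢
    linarith
  have hη : Tendsto (fun k => 4 * (energy (exterior Ω) H (u₁ k) - I) + 8 * ε k) atTop (𝓝 0) := by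
    have := ((hE₁.sub_const I).const_mul 4).add (hε.const_mul 8)
    simpa using this
  obtain ⟨g, hg, hglim⟩ := exists_tendsto_eLpNorm_of_integral_sq_le
    (fun k => (hu₁ k).1.memLp_grad) hη hcauchy
  obtain ⟨τ, hτ, hτae⟩ := (tendstoInMeasure_of_tendsto_eLpNorm two_ne_zero
    (fun k => (hu₁ k).1.memLp_grad.1) hg.1 hglim).exists_seq_tendsto_ae
  -- the limit is admissible
  have hvl : LocallyLipschitzOn (exterior Ω) v :=
    hw.1.locallyLipschitz.add hzlip.locallyLipschitz.locallyLipschitzOn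
  obtain ⟨hv, hvg⟩ := mem_admissibleWithTrace_of_tendsto hn (u := fun k => u₁ (τ k))
    (fun k => hu₁ (τ k)) hvl hvmem
    (fun x hx => by
      have := ((hdifflim x hx).comp hτ.tendsto_atTop).add_const (v x)
      simpa [Function.comp_def] using this)
    (fun k x hx => hdiffM (τ k) x hx) hg (hglim.comp hτ.tendsto_atTop) hτae
  refine ⟨v, hv, fun v' hv' => le_trans ?_ (hImin v' hv')⟩
  -- the area term is lower semicontinuous
  have harea : ∫ x in exterior Ω, areaDensity (exterior Ω) v x ≤ I - Gv := by
    refine integral_le_of_tendsto (F := fun k => areaDensity (exterior Ω) (u₁ (τ k)))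
      (fun k => (hu₁ (τ k)).1.integrableOn_areaDensity) (fun k => ?_)
      hv.1.integrableOn_areaDensity ?_ ?_
    · filter_upwards with x
      have : √(1 - ‖weakGradient (exterior Ω) (u₁ (τ k)) x‖ ^ 2) ≤ 1 := by
        refine Real.sqrt_le_iff.2 ⟨zero_le_one, ?_⟩
        linarith [sq_nonneg ‖weakGradient (exterior Ω) (u₁ (τ k)) x‖]
      change 0 ≤ 1 - √(1 - ‖weakGradient (exterior Ω) (u₁ (τ k)) x‖ ^ 2)
      linarith
    · filter_upwards [hτae, hvg] with x hx hxg
      simp only [areaDensity, hxg]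
      have hc : Continuous fun a : EuclideanSpace ℝ (Fin n) => 1 - √(1 - ‖a‖ ^ 2) := by fun_prop
      exact (hc.tendsto _).comp hx
    · have hGlim : Tendsto (fun k => ∫ x in exterior Ω, G H x (u₁ k x)) atTop (𝓝 Gv) := by
        rw [tendsto_iff_dist_tendsto_zero]
        exact squeeze_zero (fun _ => dist_nonneg) (fun k => hGε k) hε
      refine ((hE₁.sub hGlim).comp hτ.tendsto_atTop).congr fun k => ?_
      simp only [Function.comp, energy]
      ring
  rw [energy]
  linarith

end Existence

end ExteriorBI

theorem proposition3p2 (n : ℕ) (hn : 3 ≤ n) (m : ℕ) (hm : 1 ≤ m)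
    (D : Fin m → Set (EuclideanSpace ℝ (Fin n)))
    (hD : ∀ i, ExteriorBI.IsBoundedLipschitzDomain (D i))
    (hdisj : ∀ i j, i ≠ j → Disjoint (closure (D i)) (closure (D j)))
    (Ω : Set (EuclideanSpace ℝ (Fin n))) (hΩ : Ω = ⋃ i, D i)
    (H : EuclideanSpace ℝ (Fin n) → ℝ → ℝ)
    (hcar : ExteriorBI.IsCaratheodory (ExteriorBI.exterior Ω) H)
    (hdom : ExteriorBI.IsDominated (ExteriorBI.exterior Ω) H)
    (φ : EuclideanSpace ℝ (Fin n) → ℝ)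
    (hφ : MemLp φ 2 (ExteriorBI.surfaceMeasure Ω))
    (hw : ∃ w, ExteriorBI.IsAdmissible (ExteriorBI.exterior Ω) w ∧ ExteriorBI.HasTrace Ω w φ) :
    (∀ v ∈ ExteriorBI.admissibleWithTrace Ω φ,
      IntegrableOn (ExteriorBI.areaDensity (ExteriorBI.exterior Ω) v) (ExteriorBI.exterior Ω) ∧
      IntegrableOn (fun x => ExteriorBI.G H x (v x)) (ExteriorBI.exterior Ω)) ∧
    ∃ u ∈ ExteriorBI.admissibleWithTrace Ω φ,
      ∀ v ∈ ExteriorBI.admissibleWithTrace Ω φ,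
        ExteriorBI.energy (ExteriorBI.exterior Ω) H u ≤
          ExteriorBI.energy (ExteriorBI.exterior Ω) H v := by
  have hlip : ExteriorBI.IsLipschitzOpen Ω := hΩ ▸ ExteriorBI.isLipschitzOpen_iUnion hD hdisj
  have hb : Bornology.IsBounded Ω := hΩ ▸ Bornology.isBounded_iUnion.2 fun i => (hD i).bounded
  obtain ⟨w, hw⟩ := hw
  exact ⟨fun v hv => ⟨hv.1.integrableOn_areaDensity,
    ExteriorBI.integrableOn_G_of_mem hn hlip hb hcar hdom hv⟩,
    ExteriorBI.exists_minimizer hn hlip hb hcar hdom hφ.1 hw⟩
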